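/- **Setting.** Let $\varepsilon_k$, $k\in\mathbb Z$, be i.i.d. random variables, $G$ a measurable function, $\mathcal F_k=(\dots,\varepsilon_{k-1},\varepsilon_k)$ and $e_i=G(\mathcal F_i)$. Let $\varepsilon_0'$ be a copy of $\varepsilon_0$ independent of $(\varepsilon_k)_{k\in\mathbb Z}$, and let $\mathcal F_k^*$ be $\mathcal F_k$ with $\varepsilon_0$ replaced by $\varepsilon_0'$. Let $\mathbf x_1,\mathbf x_2,\dots\in\mathbb R^p$ be nonrandom, and consider the linear model $y_i=\mathbf x_i'\beta_0+e_i$ with true parameter $\beta_0=0$, so that $y_i=e_i$. Let $\rho:\mathbb R\to\mathbb R$ be convex with derivative $\psi$ (at a point where $\rho$ is not differentiable, $\psi$ takes any value between the two one-sided derivatives). Write $|\cdot|$ for the Euclidean norm, $\|V\|=(\mathbb E V^2)^{1/2}$, and $$\psi_1(t;\mathcal F_i)=\mathbb E[\psi(e_{i+1}+t)\mid\mathcal F_i],\quad \varphi(t)=\mathbb E[\psi(e_1+t)],\quad m(t)=\|\psi(e_1+t)-\psi(e_1)\|,$$ where $\psi_1(t;\cdot)$ is computed from the regular conditional distribution;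 $\psi_1^{(l)}$ is its $l$-th derivative in $t$. Let $$\Sigma_n=\sum_{i=1}^n\mathbf x_i\mathbf x_i',\quad \lambda_n=\text{the minimum eigenvalue of }\Sigma_n,\quad \xi_n(r)=\sum_{i=1}^n|\mathbf x_i|^r,\quad \tilde r_n=\max_{j\le n}|\mathbf x_j|,$$ $$\tilde\Omega_n(\beta)=\sum_{i=1}^n\psi(e_i-\mathbf x_i'\beta)\,\mathbf x_i,\qquad \tilde K_n(\beta)=\tilde\Omega_n(\beta)-\mathbb E[\tilde\Omega_n(\beta)].$$ For random $\eta_n$ and $d_n>0$ (for large $n$), $\eta_n=O_{\mathrm{a.s.}}(d_n)$ means that almost surely $\eta_n/d_n$ is bounded as $n\to\infty$, by a bound that may be random. **Assumptions.** - (A1) $\rho$ is convex, $\mathbb E[\psi(e_1)]=0$ and $0<\|\psi(e_1)\|<\infty$. - (A2) $\varphi$ has a strictly positive derivative at $0$. - (A3) $m$ is continuous at $0$. - (A5) There is $\epsilon_0>0$ such that $L_i:=\sup_{|s|,|t|\le\epsilon_0,\,s\ne t}|\psi_1(s;\mathcal F_i)-\psi_1(t;\mathcal F_i)|/|s-t|\in\mathcal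 L^1$. - (A6) For each $l=0,\dots,p$: almost surely $\psi_1(\cdot;\mathcal F_i)\in\mathcal C^l$, and for some $\epsilon_0>0$, $\sup_{|\epsilon|\le\epsilon_0}\|\psi_1^{(l)}(\epsilon;\mathcal F_i)\|<\infty$ and $$\sum_{i=0}^\infty\sup_{|\epsilon|\le\epsilon_0}\big\|\mathbb E[\psi_1^{(l)}(\epsilon;\mathcal F_i)\mid\mathcal F_0]-\mathbb E[\psi_1^{(l)}(\epsilon;\mathcal F_i^*)\mid\mathcal F_0^*]\big\|<\infty.$$ - (b) $\liminf_{n\to\infty}\lambda_n/n>0$, $\xi_n(2)=O(n)$ and $\tilde r_n=O[n^{1/2}(\log n)^{-2}]$. **Notation for the rates.** Let $\iota>0$, $q>3/2$, $b_n=n^{-1/2}(\log n)^{3/2}(\log\log n)^{1/2+\iota}$, $\bar n=2^{\lceil\log n/\log 2\rceil}$, $$\tilde\tau_n(\delta)=\sum_{i=1}^n|\mathbf x_i|^2\big[m^2(|\mathbf x_i|\delta)+m^2(-|\mathbf x_i|\delta)\big],\qquad L_n=\sqrt{\tilde\tau_n(2b_n)}\,(\log n)^q,$$ $$B_n=b_n\sqrt{\xi_n(4)}\,(\log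 n)^{3/2}(\log\log n)^{(1+\iota)/2}.$$ **Theorem 3.** Under these assumptions: (i) For all large $n$, $\tilde\Omega_n(\beta)$ is integrable whenever $|\beta|\le b_n$, and $$\sup_{|\beta|\le b_n}|\tilde K_n(\beta)-\tilde K_n(0)|=O_{\mathrm{a.s.}}(L_{\bar n}+B_{\bar n}).$$ Suppose in addition that $\varphi(t)=t\varphi'(0)+O(t^2)$ and $m(t)=O(\sqrt{|t|})$ as $t\to0$. For each $n$ let $\hat\beta_n$ be (almost surely) a minimizer of $\beta\mapsto\sum_{i=1}^n\rho(y_i-\mathbf x_i'\beta)$, and suppose that $\tilde\Omega_n(\hat\beta_n)=O_{\mathrm{a.s.}}(\tilde r_n)$. Then: (ii) $\hat\beta_n=O_{\mathrm{a.s.}}(b_n)$; (iii) the strong Bahadur representation holds: $$\varphi'(0)\,\Sigma_n\hat\beta_n-\sum_{i=1}^n\psi(e_i)\,\mathbf x_i=O_{\mathrm{a.s.}}\big(L_{\bar n}+B_{\bar n}+\xi_n(3)\,b_n^2+\tilde r_n\big).$$ -/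

import Mathlib

open MeasureTheory ProbabilityTheory Filter Asymptotics Set
open scoped Topology ENNReal Matrix

namespace MEstimation

noncomputable section

/-! ### The error process -/

/-- The shift process `F_k = (…, ε_{k-1}, ε_k)`, written as the sequence whose `j`-th entry is
`ε_{k-j}`. -/
def past {Ω : Type*} (ε : ℤ → Ω → ℝ) (k : ℤ) (ω : Ω) : ℕ → ℝ :=
  fun j => ε (k - (j : ℤ)) ω

/-- The σ-algebra generated by `F_k`. -/
abbrev pastSigma {Ω : Type*} (ε : ℤ → Ω → ℝ) (k : ℤ) : MeasurableSpace Ω :=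
  MeasurableSpace.comap (past ε k) inferInstance

/-- The causal error process `e_i = G(…, ε_{i-1}, ε_i)`. -/
def err {Ω : Type*} (G : (ℕ → ℝ) → ℝ) (ε : ℤ → Ω → ℝ) (i : ℤ) (ω : Ω) : ℝ :=
  G (past ε i ω)

/-- The innovations with `ε_0` replaced by `ε'_0`; `past (coupled ε ε₀') k` is `F_k^*`. -/
def coupled {Ω : Type*} (ε : ℤ → Ω → ℝ) (ε₀' : Ω → ℝ) : ℤ → Ω → ℝ :=
  Function.update ε 0 ε₀'

/-- The innovations `ε_k`, `k ∈ ℤ`, are i.i.d. random variables, `ε'_0` is a copy of `ε_0` that is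
independent of all of them, and the filter `G` is measurable. -/
structure IsInnovationModel {Ω : Type*} [MeasurableSpace Ω] (P : Measure Ω)
    (ε : ℤ → Ω → ℝ) (ε₀' : Ω → ℝ) (G : (ℕ → ℝ) → ℝ) : Prop where
  measurable_innov : ∀ k, Measurable (ε k)
  indep : iIndepFun ε P
  identDistrib : ∀ k, IdentDistrib (ε k) (ε 0) P P
  measurable_copy : Measurable ε₀'
  indep_copy : IndepFun ε₀' (fun ω k => ε k ω) P
  identDistrib_copy : IdentDistrib ε₀' (ε 0) P P
  measurable_filter : Measurable G

/-! ### Functionals of the score function `ψ` -/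

/-- The `k`-th-step-ahead predicted function `ψ_k(t; F_0) = E[ψ(e_k + t) | F_0]`, as a function of
`t` and of the value `s` of `F_0`: the integral against the regular conditional distribution of
`e_k` given `F_0 = s`. Evaluating at `s = F_i` gives `ψ_k(t; F_i)`. -/
def psiStep {Ω : Type*} [MeasurableSpace Ω] (P : Measure Ω) [IsProbabilityMeasure P]
    (ε : ℤ → Ω → ℝ) (G : (ℕ → ℝ) → ℝ) (ψ : ℝ → ℝ) (k : ℕ) (t : ℝ) (s : ℕ → ℝ) : ℝ :=
  ∫ y, ψ (y + t) ∂(condDistrib (err G ε (k : ℤ)) (past ε 0) P s)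

/-- `φ(t) = E[ψ(e_1 + t)]`. -/
def phi {Ω : Type*} [MeasurableSpace Ω] (P : Measure Ω)
    (ε : ℤ → Ω → ℝ) (G : (ℕ → ℝ) → ℝ) (ψ : ℝ → ℝ) (t : ℝ) : ℝ :=
  ∫ ω, ψ (err G ε 1 ω + t) ∂P

/-- `m(t) = ‖ψ(e_1 + t) - ψ(e_1)‖`, the `L²` norm, with values in `[0, ∞]`. -/
def mMod {Ω : Type*} [MeasurableSpace Ω] (P : Measure Ω)
    (ε : ℤ → Ω → ℝ) (G : (ℕ → ℝ) → ℝ) (ψ : ℝ → ℝ) (t : ℝ) : ℝ≥0∞ :=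
  eLpNorm (fun ω => ψ (err G ε 1 ω + t) - ψ (err G ε 1 ω)) 2 P

/-- `ψ_1^{(l)}(t; s)`, the `l`-th derivative in `t` of `ψ_1(t; s)`. -/
def psiOneDeriv {Ω : Type*} [MeasurableSpace Ω] (P : Measure Ω) [IsProbabilityMeasure P]
    (ε : ℤ → Ω → ℝ) (G : (ℕ → ℝ) → ℝ) (ψ : ℝ → ℝ) (l : ℕ) (t : ℝ) (s : ℕ → ℝ) : ℝ :=
  iteratedDeriv l (fun u => psiStep P ε G ψ 1 u s) t

/-! ### The regularity conditions -/

/-- `ψ` is a derivative of the convex function `ρ`, in the sense that `ψ x` is a subgradient of `ρ`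
at every `x`. Where `ρ` is differentiable this says `ψ x = ρ' x`; at a kink of `ρ` any value
between the one-sided derivatives is allowed, as for `ψ(x) = α - 1_{x ≤ 0}` in quantile
regression. -/
def IsScoreOf (ψ ρ : ℝ → ℝ) : Prop :=
  ∀ x y, ρ x + ψ x * (y - x) ≤ ρ y

/-- `ρ` is convex, `E[ψ(e_1)] = 0` and `0 < ‖ψ(e_1)‖ < ∞`. -/
structure CondA1 {Ω : Type*} [MeasurableSpace Ω] (P : Measure Ω)
    (ε : ℤ → Ω → ℝ) (G : (ℕ → ℝ) → ℝ) (ρ ψ : ℝ → ℝ) : Prop where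
  convex : ConvexOn ℝ univ ρ
  memLp : MemLp (fun ω => ψ (err G ε 1 ω)) 2 P
  mean_zero : ∫ ω, ψ (err G ε 1 ω) ∂P = 0
  norm_pos : 0 < eLpNorm (fun ω => ψ (err G ε 1 ω)) 2 P

/-- `φ` has a strictly positive derivative at `0`. -/
def CondA2 {Ω : Type*} [MeasurableSpace Ω] (P : Measure Ω)
    (ε : ℤ → Ω → ℝ) (G : (ℕ → ℝ) → ℝ) (ψ : ℝ → ℝ) : Prop :=
  DifferentiableAt ℝ (phi P ε G ψ) 0 ∧ 0 < deriv (phi P ε G ψ) 0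

/-- `m` is continuous at `0`. -/
def CondA3 {Ω : Type*} [MeasurableSpace Ω] (P : Measure Ω)
    (ε : ℤ → Ω → ℝ) (G : (ℕ → ℝ) → ℝ) (ψ : ℝ → ℝ) : Prop :=
  ContinuousAt (mMod P ε G ψ) 0

/-- `L_i = sup_{|s|, |t| ≤ ε₀, s ≠ t} |ψ_1(s; F_i) - ψ_1(t; F_i)| / |s - t|`, in `[0, ∞]`. -/
def lipConst {Ω : Type*} [MeasurableSpace Ω] (P : Measure Ω) [IsProbabilityMeasure P]
    (ε : ℤ → Ω → ℝ) (G : (ℕ → ℝ) → ℝ) (ψ : ℝ → ℝ) (ε₀ : ℝ) (i : ℤ) (ω : Ω) : ℝ≥0∞ :=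
  ⨆ (s : ℝ) (t : ℝ) (_ : |s| ≤ ε₀ ∧ |t| ≤ ε₀ ∧ s ≠ t),
    ENNReal.ofReal
      (|psiStep P ε G ψ 1 s (past ε i ω) - psiStep P ε G ψ 1 t (past ε i ω)| / |s - t|)

/-- For some `ε₀ > 0`, the `L_i` are in `L¹`. -/
def CondA5 {Ω : Type*} [MeasurableSpace Ω] (P : Measure Ω) [IsProbabilityMeasure P]
    (ε : ℤ → Ω → ℝ) (G : (ℕ → ℝ) → ℝ) (ψ : ℝ → ℝ) : Prop :=
  ∃ ε₀ : ℝ, 0 < ε₀ ∧ ∀ i : ℤ, ∫⁻ ω, lipConst P ε G ψ ε₀ i ω ∂P < ∞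

/-- `ψ_1(·; F_i) ∈ C^l` almost surely and, for some `ε₀ > 0`,
`sup_{|δ| ≤ ε₀} ‖ψ_1^{(l)}(δ; F_i)‖ < ∞` and
`∑_{i ≥ 0} sup_{|δ| ≤ ε₀} ‖E[ψ_1^{(l)}(δ; F_i) | F_0] - E[ψ_1^{(l)}(δ; F_i^*) | F_0^*]‖ < ∞`. -/
def CondA6 {Ω : Type*} [MeasurableSpace Ω] (P : Measure Ω) [IsProbabilityMeasure P]
    (ε : ℤ → Ω → ℝ) (ε₀' : Ω → ℝ) (G : (ℕ → ℝ) → ℝ) (ψ : ℝ → ℝ) (l : ℕ) : Prop :=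
  (∀ i : ℤ, ∀ᵐ ω ∂P, ContDiff ℝ l (fun t => psiStep P ε G ψ 1 t (past ε i ω))) ∧
  ∃ ε₀ : ℝ, 0 < ε₀ ∧
    (∀ i : ℤ, ⨆ (δ : ℝ) (_ : |δ| ≤ ε₀),
      eLpNorm (fun ω => psiOneDeriv P ε G ψ l δ (past ε i ω)) 2 P < ∞) ∧
    ∑' i : ℕ, ⨆ (δ : ℝ) (_ : |δ| ≤ ε₀),
      eLpNorm
        (P[fun ω => psiOneDeriv P ε G ψ l δ (past ε (i : ℤ) ω) | pastSigma ε 0]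
          - P[fun ω => psiOneDeriv P ε G ψ l δ (past (coupled ε ε₀') (i : ℤ) ω) |
              pastSigma (coupled ε ε₀') 0]) 2 P < ∞

/-! ### The design vectors `x_1, x_2, …` (the value `x 0` is never used) -/

/-- The model matrix `X_n`, with rows `x_1', …, x_n'`. -/
def designMatrix {p : ℕ} (x : ℕ → EuclideanSpace ℝ (Fin p)) (n : ℕ) :
    Matrix (Fin n) (Fin p) ℝ :=
  Matrix.of fun i j => x ((i : ℕ) + 1) j

/-- `Σ_n = X_n' X_n`. -/
def gramMatrix {p : ℕ} (x : ℕ → EuclideanSpace ℝ (Fin p)) (n : ℕ) :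
    Matrix (Fin p) (Fin p) ℝ :=
  (designMatrix x n)ᵀ * designMatrix x n

theorem gramMatrix_isHermitian {p : ℕ} (x : ℕ → EuclideanSpace ℝ (Fin p)) (n : ℕ) :
    (gramMatrix x n).IsHermitian := by
  have h := Matrix.isHermitian_conjTranspose_mul_self (designMatrix x n)
  rwa [Matrix.conjTranspose_eq_transpose_of_trivial] at h

/-- The minimum eigenvalue `λ_n` of `Σ_n`. -/
def minEigenvalue {p : ℕ} (x : ℕ → EuclideanSpace ℝ (Fin p)) (n : ℕ) : ℝ :=
  ⨅ j, (gramMatrix_isHermitian x n).eigenvalues j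

/-- `ξ_n(r) = ∑_{i ≤ n} |x_i|^r`. -/
def xi {p : ℕ} (x : ℕ → EuclideanSpace ℝ (Fin p)) (n : ℕ) (r : ℝ) : ℝ :=
  ∑ i ∈ Finset.Icc 1 n, ‖x i‖ ^ r

/-- `r̃_n = max_{j ≤ n} |x_j|`. -/
def rTilde {p : ℕ} (x : ℕ → EuclideanSpace ℝ (Fin p)) (n : ℕ) : ℝ :=
  ((Finset.Icc 1 n).sup fun j => ‖x j‖₊ : NNReal)

/-! ### Rates -/

/-- `b_n = n^{-1/2} (log n)^{3/2} (log log n)^{1/2+ι}`. -/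
def bSeq (ι : ℝ) (n : ℕ) : ℝ :=
  (n : ℝ) ^ (-(1 / 2) : ℝ) * Real.log n ^ (3 / 2 : ℝ) * Real.log (Real.log n) ^ (1 / 2 + ι)

/-- `n̄ = 2^⌈log n / log 2⌉`. -/
def nBar (n : ℕ) : ℕ := 2 ^ ⌈Real.log n / Real.log 2⌉₊

/-- `τ̃_n(δ) = ∑_{i ≤ n} |x_i|² [m²(|x_i| δ) + m²(-|x_i| δ)]`. -/
def tauTilde {Ω : Type*} [MeasurableSpace Ω] (P : Measure Ω) (ε : ℤ → Ω → ℝ)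
    (G : (ℕ → ℝ) → ℝ) (ψ : ℝ → ℝ) {p : ℕ} (x : ℕ → EuclideanSpace ℝ (Fin p))
    (n : ℕ) (δ : ℝ) : ℝ :=
  ∑ i ∈ Finset.Icc 1 n, ‖x i‖ ^ 2 *
    ((mMod P ε G ψ (‖x i‖ * δ)).toReal ^ 2 + (mMod P ε G ψ (-(‖x i‖ * δ))).toReal ^ 2)

/-- `L_n = √(τ̃_n(2 b_n)) (log n)^q`. -/
def LSeq {Ω : Type*} [MeasurableSpace Ω] (P : Measure Ω) (ε : ℤ → Ω → ℝ)
    (G : (ℕ → ℝ) → ℝ) (ψ : ℝ → ℝ) {p : ℕ} (x : ℕ → EuclideanSpace ℝ (Fin p))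
    (ι q : ℝ) (n : ℕ) : ℝ :=
  √(tauTilde P ε G ψ x n (2 * bSeq ι n)) * Real.log n ^ q

/-- `B_n = b_n √(ξ_n(4)) (log n)^{3/2} (log log n)^{(1+ι)/2}`. -/
def BSeq {p : ℕ} (x : ℕ → EuclideanSpace ℝ (Fin p)) (ι : ℝ) (n : ℕ) : ℝ :=
  bSeq ι n * √(xi x n 4) * Real.log n ^ (3 / 2 : ℝ) * Real.log (Real.log n) ^ ((1 + ι) / 2)

/-! ### The M-process -/

/-- `Ω̃_n(β) = ∑_{i ≤ n} ψ(e_i - x_i'β) x_i`. -/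
def omegaTilde {Ω : Type*} (ε : ℤ → Ω → ℝ) (G : (ℕ → ℝ) → ℝ) (ψ : ℝ → ℝ) {p : ℕ}
    (x : ℕ → EuclideanSpace ℝ (Fin p)) (n : ℕ) (β : EuclideanSpace ℝ (Fin p)) (ω : Ω) :
    EuclideanSpace ℝ (Fin p) :=
  ∑ i ∈ Finset.Icc 1 n, ψ (err G ε (i : ℤ) ω - inner ℝ (x i) β) • x i

/-- `K̃_n(β) = Ω̃_n(β) - E[Ω̃_n(β)]`. -/
def KTilde {Ω : Type*} [MeasurableSpace Ω] (P : Measure Ω) (ε : ℤ → Ω → ℝ)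
    (G : (ℕ → ℝ) → ℝ) (ψ : ℝ → ℝ) {p : ℕ} (x : ℕ → EuclideanSpace ℝ (Fin p)) (n : ℕ)
    (β : EuclideanSpace ℝ (Fin p)) (ω : Ω) : EuclideanSpace ℝ (Fin p) :=
  omegaTilde ε G ψ x n β ω - ∫ ω', omegaTilde ε G ψ x n β ω' ∂P

/-- The objective `∑_{i ≤ n} ρ(y_i - x_i'β)`, where `y_i = e_i` since the true parameter is `0`. -/
def objective {Ω : Type*} (ε : ℤ → Ω → ℝ) (G : (ℕ → ℝ) → ℝ) (ρ : ℝ → ℝ) {p : ℕ}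
    (x : ℕ → EuclideanSpace ℝ (Fin p)) (n : ℕ) (ω : Ω) (β : EuclideanSpace ℝ (Fin p)) : ℝ :=
  ∑ i ∈ Finset.Icc 1 n, ρ (err G ε (i : ℤ) ω - inner ℝ (x i) β)

/-- `η_n = O_{a.s.}(d_n)`: almost surely, `η_n / d_n` is bounded (with a random bound). -/
def IsBigOAS {Ω : Type*} [MeasurableSpace Ω] (P : Measure Ω) {E : Type*} [Norm E]
    (η : ℕ → Ω → E) (d : ℕ → ℝ) : Prop :=
  ∀ᵐ ω ∂P, (fun n => η n ω) =O[atTop] d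

end

end MEstimation

/-! With t = -x_i'β, each centered score splits as ψ(e_i + t) - φ(t) = [ψ(e_i + t) - ψ_1(t;
F_{i-1})] + [ψ_1(t; F_{i-1}) - φ(t)], a martingale difference plus a predictable term. The
oscillation over |β| ≤ b_n of the first kind of sum produces L, that of the second produces B.

The predictable term is smooth in t. Its oscillation over a box is bounded pathwise by integrals of
mixed derivatives of order at most p, which removes the supremum over β
(`IsRidgeFamily.exists_oscillation_bound`). Weighted sums of these derivatives have variance of the
order of the sum of squared weights: telescope over lags, use orthogonality at a fixed lag
(`IsInnovationModel.eLpNorm_sum_le`), and bound each lag by twice the coupling distance of (A6)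
(`lagNorm_oneStepDeriv_le`). A Rademacher–Menshov argument covers all n ≤ 2^d
(`exists_dyadic_max_bound`), and Borel–Cantelli along dyadic blocks gives
`ae_eventually_predictable_le`.

For the martingale term ψ may jump, so only its monotonicity is available. Around each point of a
polynomially large net the sum is bracketed by its values at two end points, while (A5) controls the
predictor inside the bracket. The end-point sums obey an exponential inequality after truncation at
a level u close to √τ̃ (log n)^{q-1}; the union bound costs one more logarithm, which gives L
(`ae_eventually_martingale_le`). The condition q > 3/2 is what makes the failures of the truncation
summable.

For the estimator, the inner product of the M-process with a direction is monotone along that ray.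
On the sphere of radius b_n the drift points inwards with size of order n b_n, while the score sum,
the oscillation and the residual `omegaTilde` at the estimator are all o(n b_n); hence the estimator
lies in the ball (`ae_eventually_norm_le_bSeq`). Inserting it into the oscillation bound and
expanding φ to first order gives the Bahadur representation (`ae_isBigO_bahadur`). -/

namespace MEstimation

/-! ### The law of the past and one-step prediction -/

/-- The sequence with first entry `a` followed by `s`. -/
def consSeq (a : ℝ) (s : ℕ → ℝ) : ℕ → ℝ := fun j => Nat.casesOn j a s

@[simp] theorem consSeq_zero (a : ℝ) (s : ℕ → ℝ) : consSeq a s 0 = a := rfl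

@[simp] theorem consSeq_succ (a : ℝ) (s : ℕ → ℝ) (j : ℕ) : consSeq a s (j + 1) = s j := rfl

theorem measurable_consSeq : Measurable (fun z : ℝ × (ℕ → ℝ) => consSeq z.1 z.2) := by
  refine measurable_pi_lambda _ fun j => ?_
  cases j with
  | zero => exact measurable_fst
  | succ j => exact (measurable_pi_apply j).comp measurable_snd

theorem measurable_consSeq_left (s : ℕ → ℝ) : Measurable (fun a => consSeq a s) :=
  measurable_consSeq.comp (measurable_id.prodMk measurable_const)

/-- Dropping the first entry of a sequence. -/
def tailSeq (s : ℕ → ℝ) : ℕ → ℝ := fun j => s (j + 1)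

theorem measurable_tailSeq : Measurable tailSeq :=
  measurable_pi_lambda _ fun j => measurable_pi_apply (j + 1)

/-- Integrating out the most recent innovation. -/
noncomputable def predict (ν : Measure ℝ) (f : (ℕ → ℝ) → ℝ) (s : ℕ → ℝ) : ℝ :=
  ∫ a, f (consSeq a s) ∂ν

theorem measurable_predict {ν : Measure ℝ} [SFinite ν] {f : (ℕ → ℝ) → ℝ} (hf : Measurable f) :
    Measurable (predict ν f) := by
  have h : StronglyMeasurable (fun z : (ℕ → ℝ) × ℝ => f (consSeq z.2 z.1)) :=
    (hf.comp (measurable_consSeq.comp measurable_swap)).stronglyMeasurable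
  exact (h.integral_prod_right').measurable

section Model

variable {Ω : Type*} {ε : ℤ → Ω → ℝ} {ε₀' : Ω → ℝ} {G : (ℕ → ℝ) → ℝ}

theorem past_eq_consSeq (k : ℤ) (ω : Ω) :
    past ε k ω = consSeq (ε k ω) (past ε (k - 1) ω) := by
  funext j
  cases j with
  | zero => simp [past]
  | succ j => simp only [past, consSeq_succ]; congr 1; push_cast; ring

theorem tailSeq_past (k : ℤ) (ω : Ω) : tailSeq (past ε k ω) = past ε (k - 1) ω := by
  funext j; simp only [past, tailSeq]; congr 1; push_cast; ring

theorem past_coupled_zero (ω : Ω) :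
    past (coupled ε ε₀') 0 ω = consSeq (ε₀' ω) (past ε (-1) ω) := by
  funext j
  cases j with
  | zero => simp [past, coupled]
  | succ j =>
    have h : (0 : ℤ) - ((j + 1 : ℕ) : ℤ) ≠ 0 := by push_cast; omega
    simp only [past, coupled, consSeq_succ, Function.update_of_ne h]
    congr 1; push_cast; ring

theorem pastSigma_le_iSup (k : ℤ) :
    pastSigma ε k ≤ ⨆ j ∈ Set.Iic k, MeasurableSpace.comap (ε j) inferInstance := by
  rw [← measurable_iff_comap_le]
  refine @measurable_pi_lambda _ _ _ (_) _ _ fun j => ?_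
  rw [measurable_iff_comap_le]
  refine le_iSup₂_of_le (f := fun j (_ : j ∈ Set.Iic k) =>
    MeasurableSpace.comap (ε j) inferInstance) (k - (j : ℤ)) ?_ le_rfl
  simp only [Set.mem_Iic]; omega

theorem pastSigma_mono {j k : ℤ} (h : j ≤ k) : pastSigma ε j ≤ pastSigma ε k := by
  rw [pastSigma, ← measurable_iff_comap_le]
  refine @measurable_pi_lambda _ _ _ (_) _ _ fun l => ?_
  have : (fun ω => past ε j ω l) = (fun s : ℕ → ℝ => s ((k - j).toNat + l)) ∘ past ε k := by
    funext ω
    simp only [past, Function.comp_apply]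
    congr 1; push_cast; omega
  rw [this]
  exact (measurable_pi_apply _).comp (comap_measurable _)

variable [MeasurableSpace Ω] {P : Measure Ω}

namespace IsInnovationModel

theorem measurable_past (hm : IsInnovationModel P ε ε₀' G) (k : ℤ) : Measurable (past ε k) :=
  measurable_pi_lambda _ fun _ => hm.measurable_innov _

theorem measurable_past_coupled (hm : IsInnovationModel P ε ε₀' G) (k : ℤ) :
    Measurable (past (coupled ε ε₀') k) := by
  refine measurable_pi_lambda _ fun j => ?_
  by_cases h : k - (j : ℤ) = 0
  · simpa [past, coupled, h] using hm.measurable_copy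
  · simpa [past, coupled, h] using hm.measurable_innov _

theorem pastSigma_le (hm : IsInnovationModel P ε ε₀' G) (k : ℤ) :
    pastSigma ε k ≤ (inferInstance : MeasurableSpace Ω) :=
  (hm.measurable_past k).comap_le

theorem measurable_err (hm : IsInnovationModel P ε ε₀' G) (k : ℤ) : Measurable (err G ε k) :=
  hm.measurable_filter.comp (hm.measurable_past k)

theorem map_innov (hm : IsInnovationModel P ε ε₀' G) (k : ℤ) :
    P.map (ε k) = P.map (ε 0) := (hm.identDistrib k).map_eq

/-- Stationarity: every past has the same infinite product law. It moves all moments to time zero.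
-/
theorem map_past [IsProbabilityMeasure P] (hm : IsInnovationModel P ε ε₀' G) (k : ℤ) :
    P.map (past ε k) = P.map (past ε 0) := by
  have key : ∀ k : ℤ, P.map (past ε k) = Measure.infinitePi fun _ : ℕ => P.map (ε 0) := by
    intro k
    have hi : Function.Injective (fun j : ℕ => k - (j : ℤ)) := fun a b h => by
      simp only [sub_right_inj, Nat.cast_inj] at h; exact h
    have h := (iIndepFun_iff_map_fun_eq_infinitePi_map
      (X := fun (j : ℕ) => ε (k - (j : ℤ))) (P := P) (fun j => hm.measurable_innov _)).1
      (hm.indep.precomp hi)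
    have h' : (fun ω (i : ℕ) => ε (k - (i : ℤ)) ω) = past ε k := rfl
    rw [h'] at h
    rw [h]
    congr 1
    funext j
    exact hm.map_innov _
  rw [key, key]

theorem indepFun_past [IsProbabilityMeasure P] (hm : IsInnovationModel P ε ε₀' G) (k : ℤ) :
    IndepFun (ε k) (past ε (k - 1)) P := by
  have h := indep_iSup_of_disjoint (m := fun j : ℤ => MeasurableSpace.comap (ε j) inferInstance)
    (μ := P) (fun j => (hm.measurable_innov j).comap_le) hm.indep
    (S := {k}) (T := Set.Iio k) (by simp)
  refine indep_of_indep_of_le h ?_ ?_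
  · exact le_iSup₂_of_le (f := fun j (_ : j ∈ ({k} : Set ℤ)) =>
      MeasurableSpace.comap (ε j) inferInstance) k rfl le_rfl
  · rw [← measurable_iff_comap_le]
    refine @measurable_pi_lambda _ _ _ (_) _ _ fun j => ?_
    rw [measurable_iff_comap_le]
    refine le_iSup₂_of_le (f := fun j (_ : j ∈ Set.Iio k) =>
      MeasurableSpace.comap (ε j) inferInstance) (k - 1 - (j : ℤ)) ?_ le_rfl
    simp only [Set.mem_Iio]; omega

theorem indepFun_copy_past [IsProbabilityMeasure P] (hm : IsInnovationModel P ε ε₀' G) (k : ℤ) :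
    IndepFun ε₀' (past ε k) P := by
  have : past ε k = (fun (w : ℤ → ℝ) (j : ℕ) => w (k - (j : ℤ))) ∘ (fun ω k => ε k ω) := rfl
  rw [this]
  exact hm.indep_copy.comp measurable_id
    (measurable_pi_lambda _ fun j => measurable_pi_apply (k - (j : ℤ)))

theorem map_innov_past [IsProbabilityMeasure P] (hm : IsInnovationModel P ε ε₀' G) (k : ℤ) :
    P.map (fun ω => (ε k ω, past ε (k - 1) ω)) = (P.map (ε 0)).prod (P.map (past ε 0)) := by
  rw [(indepFun_iff_map_prod_eq_prod_map_map (hm.measurable_innov k).aemeasurable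
    (hm.measurable_past (k - 1)).aemeasurable).1 (hm.indepFun_past k), hm.map_innov, hm.map_past]

/-- Conditioning on the past in Tonelli form. It needs no integrability, so it serves both the
exponential supermartingale and second moments that may be infinite. -/
theorem lintegral_innov_past [IsProbabilityMeasure P] (hm : IsInnovationModel P ε ε₀' G) (k : ℤ)
    {g : ℝ → (ℕ → ℝ) → ℝ≥0∞} (hg : Measurable (fun z : ℝ × (ℕ → ℝ) => g z.1 z.2)) :
    ∫⁻ ω, g (ε k ω) (past ε (k - 1) ω) ∂P
      = ∫⁻ ω, ∫⁻ a, g a (past ε (k - 1) ω) ∂(P.map (ε 0)) ∂P := by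
  have : IsProbabilityMeasure (P.map (ε 0)) :=
    Measure.isProbabilityMeasure_map (hm.measurable_innov 0).aemeasurable
  have h1 : ∫⁻ ω, g (ε k ω) (past ε (k - 1) ω) ∂P
      = ∫⁻ z, g z.1 z.2 ∂(P.map (fun ω => (ε k ω, past ε (k - 1) ω))) :=
    (lintegral_map hg ((hm.measurable_innov k).prodMk (hm.measurable_past (k - 1)))).symm
  rw [h1, hm.map_innov_past, lintegral_prod_symm' _ hg, ← hm.map_past (k - 1),
    lintegral_map _ (hm.measurable_past (k - 1))]
  exact hg.lintegral_prod_left'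

theorem lintegral_past [IsProbabilityMeasure P] (hm : IsInnovationModel P ε ε₀' G) (k : ℤ)
    {g : (ℕ → ℝ) → ℝ≥0∞} (hg : Measurable g) :
    ∫⁻ ω, g (past ε k ω) ∂P = ∫⁻ s, g s ∂(P.map (past ε 0)) := by
  rw [← hm.map_past k, lintegral_map hg (hm.measurable_past k)]

end IsInnovationModel

/-- Conditional expectation of a function of two independent variables given one of them. -/
theorem condExp_prod_of_indepFun [IsProbabilityMeasure P] {S : Type*} [MeasurableSpace S]
    {X : Ω → S} {Y : Ω → ℝ} (hX : Measurable X) (hY : Measurable Y) (h : IndepFun Y X P)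
    {f : S × ℝ → ℝ} (hf : Measurable f) (hfi : Integrable (fun ω => f (X ω, Y ω)) P) :
    P[fun ω => f (X ω, Y ω) | MeasurableSpace.comap X inferInstance]
      =ᵐ[P] fun ω => ∫ y, f (X ω, y) ∂(P.map Y) := by
  have : IsProbabilityMeasure (P.map Y) := Measure.isProbabilityMeasure_map hY.aemeasurable
  refine (condExp_prod_ae_eq_integral_condDistrib hX hY.aemeasurable hf.stronglyMeasurable
    hfi).trans ?_
  have hk := condDistrib_ae_eq_of_measure_eq_compProd (μ := P) (Y := Y) X hY.aemeasurable
    (κ := Kernel.const S (P.map Y)) (by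
      rw [Measure.compProd_const]
      exact (indepFun_iff_map_prod_eq_prod_map_map hX.aemeasurable hY.aemeasurable).1 h.symm)
  filter_upwards [ae_of_ae_map hX.aemeasurable hk] with ω hω
  rw [hω]; rfl

/-- This replaces an almost everywhere class by a genuine function of the past, which can be
iterated and regarded pointwise as a function of t. -/
theorem IsInnovationModel.condExp_past [IsProbabilityMeasure P]
    (hm : IsInnovationModel P ε ε₀' G) (k : ℤ)
    {f : (ℕ → ℝ) → ℝ} (hf : Measurable f) (hfi : Integrable (fun ω => f (past ε k ω)) P) :
    P[fun ω => f (past ε k ω) | pastSigma ε (k - 1)]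
      =ᵐ[P] fun ω => predict (P.map (ε 0)) f (past ε (k - 1) ω) := by
  have h1 : (fun ω => f (past ε k ω))
      = fun ω => (fun z : (ℕ → ℝ) × ℝ => f (consSeq z.2 z.1)) (past ε (k - 1) ω, ε k ω) := by
    funext ω; rw [past_eq_consSeq]
  rw [h1] at hfi ⊢
  have := condExp_prod_of_indepFun (hm.measurable_past (k - 1)) (hm.measurable_innov k)
    (hm.indepFun_past k) (hf.comp (measurable_consSeq.comp measurable_swap)) hfi
  rw [hm.map_innov] at this
  exact this

/-- `E[ψ(e_1 + t) | F_0 = s]`, as an explicit integral over the next innovation. -/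
noncomputable def oneStep (P : Measure Ω) (ε : ℤ → Ω → ℝ) (G : (ℕ → ℝ) → ℝ) (ψ : ℝ → ℝ)
    (t : ℝ) (s : ℕ → ℝ) : ℝ :=
  predict (P.map (ε 0)) (fun s => ψ (G s + t)) s

/-- By uniqueness of disintegrations, the conditional law of e_1 given F_0 = s is the law of `G
(consSeq a s)` with `a` distributed as ε_0. The exceptional null set does not depend on t; this lets
smoothness and suprema in t pass from `psiStep` to `oneStep`. -/
theorem psiStep_one_ae_eq [IsProbabilityMeasure P] (hm : IsInnovationModel P ε ε₀' G)
    {ψ : ℝ → ℝ} (hψ : Measurable ψ) :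
    ∀ᵐ s ∂(P.map (past ε 0)), ∀ t, psiStep P ε G ψ 1 t s = oneStep P ε G ψ t s := by
  have : IsProbabilityMeasure (P.map (ε 0)) :=
    Measure.isProbabilityMeasure_map (hm.measurable_innov 0).aemeasurable
  let F : (ℕ → ℝ) × ℝ → ℝ := fun z => G (consSeq z.2 z.1)
  have hF : Measurable F := hm.measurable_filter.comp (measurable_consSeq.comp measurable_swap)
  let κ : Kernel (ℕ → ℝ) ℝ := Kernel.map (Kernel.id ×ₖ Kernel.const (ℕ → ℝ) (P.map (ε 0))) F
  have hFs : ∀ s, Measurable fun a => F (s, a) := fun s =>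
    hF.comp (measurable_const.prodMk measurable_id)
  have hκ : ∀ s, κ s = (P.map (ε 0)).map (fun a => F (s, a)) := by
    intro s
    simp only [κ]
    rw [Kernel.map_apply _ hF, Kernel.prod_apply, Kernel.id_apply, Kernel.const_apply,
      Measure.dirac_prod, Measure.map_map hF (by fun_prop)]
    rfl
  have : IsMarkovKernel κ := Kernel.IsMarkovKernel.map _ hF
  have key := condDistrib_ae_eq_of_measure_eq_compProd (μ := P) (Y := err G ε ((1 : ℕ) : ℤ))
    (past ε 0) (hm.measurable_err _).aemeasurable (κ := κ) (by
      refine Measure.ext_of_lintegral _ fun f hf => ?_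
      rw [Measure.lintegral_compProd hf, lintegral_map hf
        ((hm.measurable_past 0).prodMk (hm.measurable_err _))]
      have h1 : ∀ ω, (past ε 0 ω, err G ε ((1 : ℕ) : ℤ) ω)
          = ((fun a s => (s, F (s, a))) (ε 1 ω) (past ε (1 - 1) ω)) := by
        intro ω
        simp only [err, Nat.cast_one, F, sub_self, Prod.mk.injEq, true_and]
        rw [past_eq_consSeq]; simp
      simp_rw [h1]
      rw [hm.lintegral_innov_past 1 (g := fun a s => f (s, F (s, a)))]
      · rw [lintegral_map _ (hm.measurable_past 0)]
        · simp only [sub_self]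
          refine lintegral_congr fun ω => ?_
          rw [hκ, lintegral_map (by fun_prop) (hFs _)]
        · exact hf.lintegral_kernel_prod_right'
      · exact hf.comp (measurable_snd.prodMk (hF.comp measurable_swap)))
  filter_upwards [key] with s hs t
  unfold psiStep oneStep predict
  rw [hs, hκ, integral_map (hFs s).aemeasurable]
  exact ((hψ.comp (measurable_id.add_const t)).stronglyMeasurable).aestronglyMeasurable

theorem psiStep_one_past_ae_eq [IsProbabilityMeasure P] (hm : IsInnovationModel P ε ε₀' G)
    {ψ : ℝ → ℝ} (hψ : Measurable ψ) (i : ℤ) :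
    ∀ᵐ ω ∂P, ∀ t, psiStep P ε G ψ 1 t (past ε i ω) = oneStep P ε G ψ t (past ε i ω) := by
  refine ae_of_ae_map (hm.measurable_past i).aemeasurable (p := fun s => ∀ t,
    psiStep P ε G ψ 1 t s = oneStep P ε G ψ t s) ?_
  rw [hm.map_past]
  exact psiStep_one_ae_eq hm hψ

theorem IsScoreOf.monotone {ψ ρ : ℝ → ℝ} (h : IsScoreOf ψ ρ) : Monotone ψ := by
  intro x y hxy
  rcases hxy.eq_or_lt with rfl | hlt
  · exact le_rfl
  · have h1 := h x y
    have h2 := h y x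
    nlinarith

end Model

end MEstimation

namespace MEstimation

/-! ### Second moments -/

section SecondMoment

variable {Ω : Type*} [MeasurableSpace Ω] {P : Measure Ω}

theorem eLpNorm_two_sq (f : Ω → ℝ) : eLpNorm f 2 P ^ 2 = ∫⁻ ω, ‖f ω‖ₑ ^ 2 ∂P := by
  have := eLpNorm_nnreal_pow_eq_lintegral (f := f) (μ := P) (p := 2) (by norm_num)
  simpa using this

theorem lintegral_sq_sum_of_orthogonal {ι : Type*} (I : Finset ι) {g : ι → Ω → ℝ}
    (hg : ∀ i ∈ I, MemLp (g i) 2 P) (ho : ∀ i ∈ I, ∀ j ∈ I, i ≠ j → ∫ ω, g i ω * g j ω ∂P = 0) :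
    ∫⁻ ω, ‖∑ i ∈ I, g i ω‖ₑ ^ 2 ∂P = ∑ i ∈ I, ∫⁻ ω, ‖g i ω‖ₑ ^ 2 ∂P := by
  have key : ∀ f : Ω → ℝ, MemLp f 2 P → ∫⁻ ω, ‖f ω‖ₑ ^ 2 ∂P = ENNReal.ofReal (∫ ω, f ω ^ 2 ∂P) := by
    intro f hf
    rw [ofReal_integral_eq_lintegral_ofReal hf.integrable_sq (ae_of_all _ fun _ => sq_nonneg _)]
    refine lintegral_congr fun ω => ?_
    rw [← sq_abs, ENNReal.ofReal_pow (abs_nonneg _), Real.enorm_eq_ofReal_abs]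
  rw [key _ (memLp_finsetSum I hg), Finset.sum_congr rfl fun i hi => key _ (hg i hi),
    ← ENNReal.ofReal_sum_of_nonneg fun i _ => integral_nonneg fun _ => sq_nonneg _]
  congr 1
  have hint : ∀ i ∈ I, ∀ j ∈ I, Integrable (fun ω => g i ω * g j ω) P := fun i hi j hj =>
    (hg i hi).integrable_mul (hg j hj)
  have h1 : ∀ ω, (∑ i ∈ I, g i ω) ^ 2 = ∑ i ∈ I, ∑ j ∈ I, g i ω * g j ω := by
    intro ω; rw [sq, Finset.sum_mul_sum]
  simp_rw [h1]
  rw [integral_finsetSum _ fun i hi => integrable_finsetSum _ fun j hj => hint i hi j hj]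
  refine Finset.sum_congr rfl fun i hi => ?_
  rw [integral_finsetSum _ fun j hj => hint i hi j hj, Finset.sum_eq_single i]
  · simp [sq]
  · intro j hj hji; exact ho i hi j hj hji.symm
  · intro h; exact absurd hi h

end SecondMoment

theorem integral_mul_eq_zero_of_condExp {Ω : Type*} {m m0 : MeasurableSpace Ω}
    {P : Measure Ω} [IsFiniteMeasure P] (hm : m ≤ m0) {f g : Ω → ℝ}
    (hf : MemLp f 2 P) (hg : MemLp g 2 P) (hgm : StronglyMeasurable[m] g)
    (h0 : P[f | m] =ᵐ[P] 0) : ∫ ω, g ω * f ω ∂P = 0 := by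
  have h1 : ∫ ω, (g * f) ω ∂P = ∫ ω, (P[g * f | m]) ω ∂P := (integral_condExp hm).symm
  have h2 := condExp_mul_of_stronglyMeasurable_left hgm (hg.integrable_mul hf)
    (hf.integrable one_le_two)
  have h3 : ∫ ω, (P[g * f | m]) ω ∂P = 0 := by
    rw [integral_congr_ae h2]
    have : (g * P[f | m]) =ᵐ[P] 0 := by
      filter_upwards [h0] with ω hω; simp [hω]
    rw [integral_congr_ae this]; simp
  exact h1.trans h3


/-! ### Dependence through the innovation at time zero -/

section Dependence

variable {Ω : Type*} [MeasurableSpace Ω] {P : Measure Ω} [IsProbabilityMeasure P]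
  {ε : ℤ → Ω → ℝ} {ε₀' : Ω → ℝ} {G : (ℕ → ℝ) → ℝ}

/-- The projection on the innovation at time zero is controlled by the distance to any function of
the coupled past. -/
theorem IsInnovationModel.eLpNorm_sub_condExp_le (hm : IsInnovationModel P ε ε₀' G)
    {U Y : Ω → ℝ} (hU : MemLp U 2 P) (hUm : StronglyMeasurable[pastSigma ε 0] U)
    (hYm : StronglyMeasurable[pastSigma (coupled ε ε₀') 0] Y) :
    eLpNorm (U - P[U | pastSigma ε (-1)]) 2 P ≤ 2 * eLpNorm (U - Y) 2 P := by
  have hYs : StronglyMeasurable Y := hYm.mono (hm.measurable_past_coupled 0).comap_le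
  by_cases htop : eLpNorm (U - Y) 2 P = ∞
  · rw [htop]; simp
  have hUY : MemLp (U - Y) 2 P :=
    ⟨hU.1.sub hYs.aestronglyMeasurable, lt_top_iff_ne_top.2 htop⟩
  have hY : MemLp Y 2 P := by simpa using hU.sub hUY
  obtain ⟨y, hy, rfl⟩ := hYm.measurable.exists_eq_measurable_comp
  have hF : Measurable (fun z : (ℕ → ℝ) × ℝ => y (consSeq z.2 (tailSeq z.1))) :=
    hy.comp (measurable_consSeq.comp (measurable_snd.prodMk (measurable_tailSeq.comp measurable_fst)))
  have hYe : (y ∘ past (coupled ε ε₀') 0)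
      = fun ω => (fun z : (ℕ → ℝ) × ℝ => y (consSeq z.2 (tailSeq z.1))) (past ε 0 ω, ε₀' ω) := by
    funext ω
    simp only [Function.comp_apply, tailSeq_past, past_coupled_zero, zero_sub]
  -- The copy enters the coupled past only as its first entry and is independent of the original
  -- past. Conditioning Y on F_0 therefore integrates the copy out and leaves a function of F_{-1}.
  set W : Ω → ℝ := fun ω => predict (P.map ε₀') y (past ε (-1) ω) with hW
  have : IsProbabilityMeasure (P.map ε₀') :=
    Measure.isProbabilityMeasure_map hm.measurable_copy.aemeasurable
  have hcond : P[y ∘ past (coupled ε ε₀') 0 | pastSigma ε 0] =ᵐ[P] W := by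
    have hi := hY.integrable one_le_two
    rw [hYe] at hi ⊢
    refine (condExp_prod_of_indepFun (hm.measurable_past 0) hm.measurable_copy
      (hm.indepFun_copy_past 0) hF hi).trans (ae_of_all _ fun ω => ?_)
    simp only [tailSeq_past, zero_sub, hW, predict]
  have hWm : StronglyMeasurable[pastSigma ε (-1)] W :=
    ((measurable_predict hy).comp (comap_measurable _)).stronglyMeasurable
  have hWL : MemLp W 2 P := (hY.condExp one_le_two).ae_eq hcond
  have h1 : P[U - y ∘ past (coupled ε ε₀') 0 | pastSigma ε 0] =ᵐ[P] U - W := by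
    refine (condExp_sub (hU.integrable one_le_two) (hY.integrable one_le_two) _).trans ?_
    rw [condExp_of_stronglyMeasurable (hm.pastSigma_le 0) hUm (hU.integrable one_le_two)]
    exact (EventuallyEq.refl _ _).sub hcond
  have h2 : eLpNorm (U - W) 2 P ≤ eLpNorm (U - y ∘ past (coupled ε ε₀') 0) 2 P := by
    rw [← eLpNorm_congr_ae h1]
    exact eLpNorm_condExp_le_eLpNorm _ one_le_two
  -- W is already measurable at time -1, so subtracting it does not change the projection. The two
  -- terms on the right are each at most the norm of U - Y, whence the factor 2.
  have h3 : U - P[U | pastSigma ε (-1)] =ᵐ[P] (U - W) - P[U - W | pastSigma ε (-1)] := by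
    have := condExp_sub (hU.integrable one_le_two) (hWL.integrable one_le_two) (pastSigma ε (-1))
    rw [condExp_of_stronglyMeasurable (hm.pastSigma_le (-1)) hWm (hWL.integrable one_le_two)] at this
    filter_upwards [this] with ω hω
    simp only [Pi.sub_apply] at hω ⊢
    rw [hω]; ring
  rw [eLpNorm_congr_ae h3]
  have hUW : MemLp (U - W) 2 P := hU.sub hWL
  refine (eLpNorm_sub_le hUW.1 (hUW.condExp one_le_two).1 one_le_two).trans ?_
  rw [two_mul]
  exact add_le_add h2 ((eLpNorm_condExp_le_eLpNorm _ one_le_two).trans h2)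

/-- The remote past carries no information. -/
theorem IsInnovationModel.tendsto_condExp_remote (hm : IsInnovationModel P ε ε₀' G) (i : ℤ)
    {Z : Ω → ℝ} (hZ : StronglyMeasurable[pastSigma ε i] Z) (hZi : Integrable Z P) :
    Tendsto (fun M : ℕ => eLpNorm (P[Z | pastSigma ε (i - M)] - fun _ => ∫ ω, Z ω ∂P) 1 P)
      atTop (𝓝 0) := by
  -- The σ-algebra of all innovations after time i - n. It increases to one containing F_i, so E[Z |
  -- 𝒢 n] tends to Z in L¹, and it is independent of F_{i-n}. Hence E[Z | F_{i-n}] - E Z is the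
  -- conditional expectation of Z - E[Z | 𝒢 n], which tends to zero in L¹.
  let 𝒢 : Filtration ℕ (inferInstance : MeasurableSpace Ω) :=
    { seq := fun n => ⨆ j ∈ Set.Ioi (i - n), MeasurableSpace.comap (ε j) inferInstance
      mono' := by
        intro a b hab
        refine biSup_mono fun j hj => ?_
        simp only [Set.mem_Ioi] at hj ⊢; omega
      le' := fun n => iSup₂_le fun j _ => (hm.measurable_innov j).comap_le }
  have hG : ∀ n, 𝒢 n = ⨆ j ∈ Set.Ioi (i - (n : ℤ)), MeasurableSpace.comap (ε j) inferInstance :=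
    fun n => rfl
  have hsup : pastSigma ε i ≤ ⨆ n, 𝒢 n := by
    refine (pastSigma_le_iSup i).trans (iSup₂_le fun j hj => ?_)
    refine le_trans ?_ (le_iSup _ (i - j + 1).toNat)
    rw [hG]
    refine le_iSup₂_of_le (f := fun l (_ : l ∈ Set.Ioi (i - ((i - j + 1).toNat : ℤ))) =>
      MeasurableSpace.comap (ε l) inferInstance) j ?_ le_rfl
    simp only [Set.mem_Ioi, Set.mem_Iic] at hj ⊢; omega
  have hZs : P[Z | ⨆ n, 𝒢 n] = Z :=
    condExp_of_stronglyMeasurable (iSup_le fun n => 𝒢.le n) (hZ.mono hsup) hZi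
  have hlim := tendsto_eLpNorm_condExp (μ := P) (ℱ := 𝒢) Z
  rw [hZs] at hlim
  refine tendsto_of_tendsto_of_tendsto_of_le_of_le tendsto_const_nhds hlim (fun _ => zero_le) ?_
  intro n
  have hind : Indep (𝒢 n) (pastSigma ε (i - n)) P := by
    have h := indep_iSup_of_disjoint (m := fun j : ℤ => MeasurableSpace.comap (ε j) inferInstance)
      (μ := P) (fun j => (hm.measurable_innov j).comap_le) hm.indep
      (S := Set.Ioi (i - (n : ℤ))) (T := Set.Iic (i - (n : ℤ)))
      (by rw [Set.disjoint_left]; intro a ha hb; simp only [Set.mem_Ioi, Set.mem_Iic] at ha hb; omega)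
    exact indep_of_indep_of_le_right h (pastSigma_le_iSup _)
  have hc := condExp_indep_eq (μ := P) (𝒢.le n) (hm.pastSigma_le (i - n))
    (stronglyMeasurable_condExp (f := Z) (μ := P)) hind
  have hc' : P[Z | pastSigma ε (i - n)] - (fun _ => ∫ ω, Z ω ∂P)
      =ᵐ[P] P[Z - P[Z | 𝒢 n] | pastSigma ε (i - n)] := by
    filter_upwards [condExp_sub hZi (integrable_condExp (m := 𝒢 n) (f := Z) (μ := P))
      (pastSigma ε (i - n)), hc] with ω h1 h2
    rw [h1]
    simp only [Pi.sub_apply]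
    rw [h2, integral_condExp (𝒢.le n)]
  beta_reduce
  rw [eLpNorm_congr_ae hc']
  refine (eLpNorm_condExp_le_eLpNorm _ le_rfl).trans_eq ?_
  rw [← eLpNorm_neg, neg_sub]

/-- The contribution of the innovation `k` steps back to `f (past ε i)`, in `L²` norm. -/
noncomputable def lagNorm (P : Measure Ω) (ε : ℤ → Ω → ℝ) (f : (ℕ → ℝ) → ℝ) (k : ℕ) : ℝ≥0∞ :=
  eLpNorm (fun ω => (predict (P.map (ε 0)))^[k] f (past ε 0 ω)
    - (predict (P.map (ε 0)))^[k + 1] f (past ε (-1) ω)) 2 P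

theorem measurable_predict_iterate {ν : Measure ℝ} [SFinite ν] {f : (ℕ → ℝ) → ℝ}
    (hf : Measurable f) (k : ℕ) : Measurable ((predict ν)^[k] f) := by
  induction k with
  | zero => exact hf
  | succ k ih => rw [Function.iterate_succ_apply']; exact measurable_predict ih

theorem IsInnovationModel.condExp_past_iterate (hm : IsInnovationModel P ε ε₀' G) (i : ℤ)
    {f : (ℕ → ℝ) → ℝ} (hf : Measurable f) (hfi : Integrable (fun ω => f (past ε i ω)) P) (k : ℕ) :
    P[fun ω => f (past ε i ω) | pastSigma ε (i - k)]
      =ᵐ[P] fun ω => (predict (P.map (ε 0)))^[k] f (past ε (i - k) ω) := by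
  have : IsProbabilityMeasure (P.map (ε 0)) :=
    Measure.isProbabilityMeasure_map (hm.measurable_innov 0).aemeasurable
  induction k with
  | zero =>
    have hs : StronglyMeasurable[pastSigma ε (i - ((0 : ℕ) : ℤ))] (fun ω => f (past ε i ω)) := by
      rw [Nat.cast_zero, sub_zero]
      exact (hf.comp (comap_measurable (past ε i))).stronglyMeasurable
    rw [condExp_of_stronglyMeasurable (hm.pastSigma_le _) hs hfi]
    exact ae_of_all _ fun ω => by simp
  | succ k ih =>
    have he : i - ((k + 1 : ℕ) : ℤ) = i - k - 1 := by push_cast; ring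
    have h1 := condExp_condExp_of_le (μ := P) (f := fun ω => f (past ε i ω))
      (pastSigma_mono (ε := ε) (sub_le_self (i - (k : ℤ)) zero_le_one)) (hm.pastSigma_le (i - k))
    have h2 := condExp_congr_ae (m := pastSigma ε (i - k - 1)) ih
    have h3 := hm.condExp_past (i - k) (measurable_predict_iterate (ν := P.map (ε 0)) hf k)
      (integrable_condExp.congr ih)
    rw [he]
    refine h1.symm.trans (h2.trans (h3.trans (ae_of_all _ fun ω => ?_)))
    simp only [Function.iterate_succ_apply']

/-- By stationarity the size of the projection on the innovation k steps back does not depend on the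
time i. -/
theorem IsInnovationModel.eLpNorm_condExp_sub_condExp (hm : IsInnovationModel P ε ε₀' G) (i : ℤ)
    {f : (ℕ → ℝ) → ℝ} (hf : Measurable f) (hfi : Integrable (fun ω => f (past ε i ω)) P) (k : ℕ) :
    eLpNorm (P[fun ω => f (past ε i ω) | pastSigma ε (i - k)]
      - P[fun ω => f (past ε i ω) | pastSigma ε (i - (k + 1 : ℕ))]) 2 P = lagNorm P ε f k := by
  have : IsProbabilityMeasure (P.map (ε 0)) :=
    Measure.isProbabilityMeasure_map (hm.measurable_innov 0).aemeasurable
  set Φ : (ℕ → ℝ) → ℝ := fun s => (predict (P.map (ε 0)))^[k] f s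
    - (predict (P.map (ε 0)))^[k + 1] f (tailSeq s) with hΦ
  have hΦm : Measurable Φ := (measurable_predict_iterate hf k).sub
    ((measurable_predict_iterate hf (k + 1)).comp measurable_tailSeq)
  have hshift : ∀ j : ℤ, eLpNorm (Φ ∘ past ε j) 2 P = eLpNorm Φ 2 (P.map (past ε 0)) := by
    intro j
    rw [← hm.map_past j, eLpNorm_map_measure hΦm.aestronglyMeasurable
      (hm.measurable_past j).aemeasurable]
  have h1 : (P[fun ω => f (past ε i ω) | pastSigma ε (i - k)]
      - P[fun ω => f (past ε i ω) | pastSigma ε (i - (k + 1 : ℕ))]) =ᵐ[P] Φ ∘ past ε (i - k) := by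
    filter_upwards [hm.condExp_past_iterate i hf hfi k, hm.condExp_past_iterate i hf hfi (k + 1)]
      with ω h1 h2
    have he : i - (k : ℤ) - 1 = i - (k + 1 : ℕ) := by push_cast; ring
    simp only [Pi.sub_apply, h1, h2, Function.comp_apply, hΦ, tailSeq_past, he]
  have h2 : lagNorm P ε f k = eLpNorm (Φ ∘ past ε 0) 2 P := by
    unfold lagNorm
    congr 1
    funext ω
    simp only [Function.comp_apply, hΦ, tailSeq_past, zero_sub]
  rw [eLpNorm_congr_ae h1, h2, hshift, hshift]

/-- A weighted sum of functions of the past is bounded by the sum of its lag norms. -/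
theorem IsInnovationModel.eLpNorm_sum_le (hm : IsInnovationModel P ε ε₀' G) (I : Finset ℕ)
    {τ : ℕ → ℤ} (hτ : StrictMono τ) (w : ℕ → ℝ) {f : ℕ → (ℕ → ℝ) → ℝ}
    (hf : ∀ i, Measurable (f i)) (hfL : ∀ i ∈ I, MemLp (fun ω => f i (past ε (τ i) ω)) 2 P)
    {r : ℕ → ℝ≥0∞} (hr : ∀ i ∈ I, ∀ k, lagNorm P ε (f i) k ≤ r k) :
    eLpNorm (fun ω => ∑ i ∈ I, w i * (f i (past ε (τ i) ω) - ∫ ω', f i (past ε (τ i) ω') ∂P)) 2 P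
      ≤ (∑' k, r k) * ENNReal.ofReal √(∑ i ∈ I, w i ^ 2) := by
  set Z : ℕ → Ω → ℝ := fun i ω => f i (past ε (τ i) ω) with hZ
  set U : ℕ → ℕ → Ω → ℝ := fun i k => P[Z i | pastSigma ε (τ i - k)] with hU
  have hUL : ∀ i ∈ I, ∀ k, MemLp (U i k) 2 P := fun i hi k => (hfL i hi).condExp one_le_two
  have hlag : ∀ i ∈ I, ∀ k, eLpNorm (U i k - U i (k + 1)) 2 P ≤ r k := fun i hi k =>
    (hm.eLpNorm_condExp_sub_condExp (τ i) (hf i) ((hfL i hi).integrable one_le_two) k).trans_le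
      (hr i hi k)
  have hbase : ∀ i ∈ I, U i 0 = Z i := by
    intro i hi
    refine condExp_of_stronglyMeasurable (μ := P) (hm.pastSigma_le _) ?_
      ((hfL i hi).integrable one_le_two)
    rw [Nat.cast_zero, sub_zero]
    exact ((hf i).comp (comap_measurable (past ε (τ i)))).stronglyMeasurable
  -- orthogonality at a fixed lag
  have horth : ∀ k, ∀ i ∈ I, ∀ j ∈ I, i ≠ j →
      ∫ ω, (w i * (U i k - U i (k + 1)) ω) * (w j * (U j k - U j (k + 1)) ω) ∂P = 0 := by
    intro k
    have hlt : ∀ i ∈ I, ∀ j ∈ I, j < i →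
        ∫ ω, (U j k - U j (k + 1)) ω * (U i k - U i (k + 1)) ω ∂P = 0 := by
      intro i hi j hj hji
      have hle : τ j - (k : ℤ) ≤ τ i - ((k + 1 : ℕ) : ℤ) := by
        have := hτ hji; push_cast; omega
      refine integral_mul_eq_zero_of_condExp (hm.pastSigma_le (τ i - ((k + 1 : ℕ) : ℤ)))
        ((hUL i hi k).sub (hUL i hi (k + 1))) ((hUL j hj k).sub (hUL j hj (k + 1))) ?_ ?_
      · refine StronglyMeasurable.sub ?_ ?_
        · exact stronglyMeasurable_condExp.mono (pastSigma_mono hle)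
        · exact stronglyMeasurable_condExp.mono (pastSigma_mono (by push_cast at hle ⊢; omega))
      · refine (condExp_sub ((hUL i hi k).integrable one_le_two)
          ((hUL i hi (k + 1)).integrable one_le_two) _).trans ?_
        have h1 := condExp_condExp_of_le (μ := P) (f := Z i)
          (m₁ := pastSigma ε (τ i - ((k + 1 : ℕ) : ℤ))) (m₂ := pastSigma ε (τ i - (k : ℤ)))
          (pastSigma_mono (by push_cast; omega)) (hm.pastSigma_le _)
        have h2 := condExp_of_stronglyMeasurable (μ := P)
          (hm.pastSigma_le (τ i - ((k + 1 : ℕ) : ℤ)))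
          (stronglyMeasurable_condExp (f := Z i)) ((hUL i hi (k + 1)).integrable one_le_two)
        filter_upwards [h1] with ω h1
        simp only [Pi.sub_apply, Pi.zero_apply, hU] at h1 ⊢
        rw [h1, h2, sub_self]
    intro i hi j hj hij
    have h1 : ∀ ω, (w i * (U i k - U i (k + 1)) ω) * (w j * (U j k - U j (k + 1)) ω)
        = (w i * w j) * ((U j k - U j (k + 1)) ω * (U i k - U i (k + 1)) ω) := fun ω => by ring
    simp_rw [h1]
    rw [integral_const_mul]
    rcases lt_or_gt_of_ne hij with h | h
    · have := hlt j hj i hi h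
      simp_rw [mul_comm ((U j k - U j (k + 1)) _)]
      rw [this, mul_zero]
    · rw [hlt i hi j hj h, mul_zero]
  -- At a fixed lag the terms are martingale differences with distinct time stamps, so Pythagoras
  -- applies. Only the sum over lags is then taken by Minkowski, which is why summable lag norms
  -- suffice.
  have hlagsum : ∀ k, eLpNorm (fun ω => ∑ i ∈ I, w i * (U i k - U i (k + 1)) ω) 2 P
      ≤ r k * ENNReal.ofReal √(∑ i ∈ I, w i ^ 2) := by
    intro k
    have hsq : eLpNorm (fun ω => ∑ i ∈ I, w i * (U i k - U i (k + 1)) ω) 2 P ^ 2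
        ≤ (r k * ENNReal.ofReal √(∑ i ∈ I, w i ^ 2)) ^ 2 := by
      rw [eLpNorm_two_sq, lintegral_sq_sum_of_orthogonal I
        (fun i hi => ((hUL i hi k).sub (hUL i hi (k + 1))).const_mul (w i)) (horth k), mul_pow,
        ← ENNReal.ofReal_pow (Real.sqrt_nonneg _),
        Real.sq_sqrt (Finset.sum_nonneg fun i _ => sq_nonneg _),
        ENNReal.ofReal_sum_of_nonneg (fun i _ => sq_nonneg _), Finset.mul_sum]
      refine Finset.sum_le_sum fun i hi => ?_
      rw [← eLpNorm_two_sq]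
      have : eLpNorm (fun ω => w i * (U i k - U i (k + 1)) ω) 2 P
          = ‖w i‖ₑ * eLpNorm (U i k - U i (k + 1)) 2 P := eLpNorm_const_smul (w i) _ 2 P
      rw [this, mul_pow, mul_comm, ← sq_abs (w i), ENNReal.ofReal_pow (abs_nonneg _),
        Real.enorm_eq_ofReal_abs]
      gcongr
      exact hlag i hi k
    exact (ENNReal.pow_le_pow_left_iff two_ne_zero).1 hsq
  have hpart : ∀ M, eLpNorm (fun ω => ∑ i ∈ I, w i * (U i 0 ω - U i M ω)) 2 P
      ≤ (∑' k, r k) * ENNReal.ofReal √(∑ i ∈ I, w i ^ 2) := by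
    intro M
    have he : (fun ω => ∑ i ∈ I, w i * (U i 0 ω - U i M ω))
        = ∑ k ∈ Finset.range M, fun ω => ∑ i ∈ I, w i * (U i k - U i (k + 1)) ω := by
      funext ω
      rw [Finset.sum_apply, Finset.sum_comm]
      refine Finset.sum_congr rfl fun i _ => ?_
      rw [← Finset.mul_sum, ← Finset.sum_range_sub' (fun k => U i k ω) M]
      rfl
    rw [he]
    refine (MeasureTheory.eLpNorm_sum_le (fun k _ => ?_) one_le_two).trans ?_
    · exact (memLp_finsetSum I fun i hi =>
        ((hUL i hi k).sub (hUL i hi (k + 1))).const_mul (w i)).1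
    · refine (Finset.sum_le_sum fun k _ => hlagsum k).trans ?_
      rw [← Finset.sum_mul]
      gcongr
      exact ENNReal.sum_le_tsum _
  -- letting the lag tend to infinity
  have hconv : Tendsto (fun M => eLpNorm ((fun ω => ∑ i ∈ I, w i * (U i 0 ω - U i M ω))
      - fun ω => ∑ i ∈ I, w i * (U i 0 ω - ∫ ω', Z i ω' ∂P)) 1 P) atTop (𝓝 0) := by
    have hb : Tendsto (fun M => ∑ i ∈ I, ‖w i‖ₑ * eLpNorm (U i M - fun _ => ∫ ω', Z i ω' ∂P) 1 P)
        atTop (𝓝 0) := by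
      have : (0 : ℝ≥0∞) = ∑ i ∈ I, ‖w i‖ₑ * 0 := by simp
      rw [this]
      refine tendsto_finsetSum _ fun i hi => ENNReal.Tendsto.const_mul ?_ (Or.inr (by simp))
      exact hm.tendsto_condExp_remote (τ i)
        ((hf i).comp (comap_measurable (past ε (τ i)))).stronglyMeasurable
        ((hfL i hi).integrable one_le_two)
    refine tendsto_of_tendsto_of_tendsto_of_le_of_le tendsto_const_nhds hb (fun _ => zero_le) ?_
    intro M
    have he : ((fun ω => ∑ i ∈ I, w i * (U i 0 ω - U i M ω))
        - fun ω => ∑ i ∈ I, w i * (U i 0 ω - ∫ ω', Z i ω' ∂P))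
        = ∑ i ∈ I, (-w i) • (U i M - fun _ => ∫ ω', Z i ω' ∂P) := by
      funext ω
      simp only [Pi.sub_apply, Finset.sum_apply, Pi.smul_apply, smul_eq_mul,
        ← Finset.sum_sub_distrib]
      exact Finset.sum_congr rfl fun i _ => by ring
    beta_reduce
    rw [he]
    refine (MeasureTheory.eLpNorm_sum_le (fun i hi => ?_) le_rfl).trans
      (Finset.sum_le_sum fun i hi => ?_)
    · exact (((hUL i hi M).1.sub aestronglyMeasurable_const).const_smul _)
    · rw [eLpNorm_const_smul, enorm_neg]
  have hms : ∀ M, AEStronglyMeasurable (fun ω => ∑ i ∈ I, w i * (U i 0 ω - U i M ω)) P := fun M =>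
    (memLp_finsetSum I fun i hi => ((hUL i hi 0).sub (hUL i hi M)).const_mul (w i)).1
  have hms' : AEStronglyMeasurable (fun ω => ∑ i ∈ I, w i * (U i 0 ω - ∫ ω', Z i ω' ∂P)) P :=
    (memLp_finsetSum I fun i hi => ((hUL i hi 0).sub (memLp_const _)).const_mul (w i)).1
  -- The remote past vanishes only in L¹. An almost surely convergent subsequence and Fatou's lemma
  -- carry the uniform L² bound to the limit.
  obtain ⟨ns, -, hns⟩ :=
    (tendstoInMeasure_of_tendsto_eLpNorm one_ne_zero hms hms' hconv).exists_seq_tendsto_ae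
  have hfin := Lp.eLpNorm_lim_le_liminf_eLpNorm (p := 2) (fun n => hms (ns n)) _ hns
  have he : (fun ω => ∑ i ∈ I, w i * (f i (past ε (τ i) ω) - ∫ ω', f i (past ε (τ i) ω') ∂P))
      = fun ω => ∑ i ∈ I, w i * (U i 0 ω - ∫ ω', Z i ω' ∂P) := by
    funext ω
    exact Finset.sum_congr rfl fun i hi => by rw [hbase i hi]
  rw [he]
  refine hfin.trans (liminf_le_of_le (by isBoundedDefault) fun b hb => ?_)
  obtain ⟨n, hn⟩ := hb.exists
  exact hn.trans (hpart _)

end Dependence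

end MEstimation

namespace MEstimation

/-! ### A Sobolev-type bound for sums of ridge functions -/

theorem ENNReal_add_sq_le (x y : ℝ≥0∞) : (x + y) ^ 2 ≤ 4 * x ^ 2 + 4 * y ^ 2 := by
  have h : ∀ a b : ℝ≥0∞, a ≤ b → (a + b) ^ 2 ≤ 4 * b ^ 2 := fun a b hab => by
    calc (a + b) ^ 2 ≤ (b + b) ^ 2 := by gcongr
      _ = 4 * b ^ 2 := by ring
  rcases le_total x y with hxy | hxy
  · exact (h x y hxy).trans le_add_self
  · rw [add_comm x y]; exact (h y x hxy).trans le_self_add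

theorem ENNReal_sum_sq_le {ι : Type*} (s : Finset ι) (y : ι → ℝ≥0∞) :
    (∑ i ∈ s, y i) ^ 2 ≤ s.card * ∑ i ∈ s, y i ^ 2 := by
  have h := ENNReal.inner_le_Lp_mul_Lq s y (fun _ => 1) Real.HolderConjugate.two_two
  simp only [mul_one, ENNReal.one_rpow, Finset.sum_const, nsmul_eq_mul] at h
  calc (∑ i ∈ s, y i) ^ 2
      ≤ ((∑ i ∈ s, y i ^ (2 : ℝ)) ^ (1 / (2 : ℝ)) * (s.card : ℝ≥0∞) ^ (1 / (2 : ℝ))) ^ 2 := by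
        gcongr
    _ = s.card * ∑ i ∈ s, y i ^ 2 := by
      rw [mul_pow, ← ENNReal.rpow_natCast, ← ENNReal.rpow_natCast, ← ENNReal.rpow_mul,
        ← ENNReal.rpow_mul]
      norm_num
      rw [mul_comm]

theorem lintegral_sq_le {α : Type*} [MeasurableSpace α] {μ : Measure α} {f : α → ℝ≥0∞}
    (hf : AEMeasurable f μ) : (∫⁻ a, f a ∂μ) ^ 2 ≤ μ univ * ∫⁻ a, f a ^ 2 ∂μ := by
  have h := ENNReal.lintegral_mul_le_Lp_mul_Lq μ Real.HolderConjugate.two_two hf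
    (aemeasurable_const (b := (1 : ℝ≥0∞)))
  simp only [Pi.mul_apply, mul_one, ENNReal.one_rpow, lintegral_one] at h
  calc (∫⁻ a, f a ∂μ) ^ 2
      ≤ ((∫⁻ a, f a ^ (2 : ℝ) ∂μ) ^ (1 / (2 : ℝ)) * μ univ ^ (1 / (2 : ℝ))) ^ 2 := by gcongr
    _ = μ univ * ∫⁻ a, f a ^ 2 ∂μ := by
      rw [mul_pow, ← ENNReal.rpow_natCast, ← ENNReal.rpow_natCast, ← ENNReal.rpow_mul,
        ← ENNReal.rpow_mul]
      norm_num
      rw [mul_comm]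

section Ridge

variable {Ω : Type*} [MeasurableSpace Ω] {P : Measure Ω}

/-- Iterated integrals of the absolute mixed derivatives of `t ↦ ∑ w_i g_i(t_i)` along the first
`m` directions `a 0, …, a (m - 1)`. -/
noncomputable def ridgeBound (g : ℕ → ℕ → ℝ → Ω → ℝ) (I : Finset ℕ) (a : ℕ → ℕ → ℝ) (b : ℝ) :
    ℕ → ℕ → (ℕ → ℝ) → (ℕ → ℝ) → Ω → ℝ≥0∞
  | 0, l, w, t, ω => ‖∑ i ∈ I, w i * g l i (t i) ω‖ₑ
  | m + 1, l, w, t, ω => ridgeBound g I a b m l w t ω +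
      ∫⁻ u in Icc (-b) b, ridgeBound g I a b m (l + 1) (fun i => w i * a m i)
        (fun i => t i + u * a m i) ω

variable {g : ℕ → ℕ → ℝ → Ω → ℝ} {I : Finset ℕ} {a : ℕ → ℕ → ℝ} {b : ℝ}

theorem measurable_ridgeBound (hg : ∀ l i, Measurable fun z : ℝ × Ω => g l i z.1 z.2) (m l : ℕ)
    (w : ℕ → ℝ) : Measurable fun z : (ℕ → ℝ) × Ω => ridgeBound g I a b m l w z.1 z.2 := by
  induction m generalizing l w with
  | zero =>
    simp only [ridgeBound]
    refine Measurable.enorm (Finset.measurable_sum _ fun i _ => ?_)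
    have h : Measurable fun z : (ℕ → ℝ) × Ω => (z.1 i, z.2) := by fun_prop
    exact ((hg l i).comp h).const_mul (w i)
  | succ m ih =>
    simp only [ridgeBound]
    refine (ih l w).add ?_
    refine Measurable.lintegral_prod_right' (f := fun z : ((ℕ → ℝ) × Ω) × ℝ =>
      ridgeBound g I a b m (l + 1) (fun i => w i * a m i) (fun i => z.1.1 i + z.2 * a m i) z.1.2) ?_
    have h : Measurable fun z : ((ℕ → ℝ) × Ω) × ℝ =>
        ((fun i => z.1.1 i + z.2 * a m i : ℕ → ℝ), z.1.2) := by fun_prop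
    exact (ih (l + 1) _).comp h

theorem measurable_ridgeBound_comp (hg : ∀ l i, Measurable fun z : ℝ × Ω => g l i z.1 z.2)
    (m l : ℕ) (w : ℕ → ℝ) {α : Type*} [MeasurableSpace α] {τ : α → ℕ → ℝ} {o : α → Ω}
    (hτ : ∀ i, Measurable fun z => τ z i) (ho : Measurable o) :
    Measurable fun z => ridgeBound g I a b m l w (τ z) (o z) :=
  (measurable_ridgeBound hg m l w).comp ((measurable_pi_lambda _ hτ).prodMk ho)

/-- The functions `g l` are successive derivatives, in integrated form, and weighted sums of them
have second moments of the order of the sum of the squared weights. -/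
structure IsRidgeFamily (P : Measure Ω) (g : ℕ → ℕ → ℝ → Ω → ℝ) (I : Finset ℕ) (p : ℕ) (r : ℝ)
    (Θ : ℝ≥0∞) : Prop where
  measurable : ∀ l i, Measurable fun z : ℝ × Ω => g l i z.1 z.2
  bounded : ∀ l ≤ p, ∀ i ω, ∃ C, ∀ s, |s| ≤ r → |g l i s ω| ≤ C
  integral : ∀ l < p, ∀ i ω u v, |u| ≤ r → |v| ≤ r →
    g l i v ω - g l i u ω = ∫ s in u..v, g (l + 1) i s ω
  moment : ∀ l ≤ p, ∀ w t : ℕ → ℝ, (∀ i ∈ I, |t i| ≤ r) →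
    ∫⁻ ω, ‖∑ i ∈ I, w i * g l i (t i) ω‖ₑ ^ 2 ∂P ≤ Θ * ∑ i ∈ I, ENNReal.ofReal (w i ^ 2)

variable {p : ℕ} {r : ℝ} {Θ : ℝ≥0∞}

theorem abs_add_mul_le {t u c b r : ℝ} (h : |t| + b * |c| ≤ r) (hu : |u| ≤ b) :
    |t + u * c| ≤ r := by
  refine (abs_add_le _ _).trans (le_trans ?_ h)
  rw [abs_mul]
  gcongr

/-- The fundamental theorem of calculus along the direction `c`. The integral is enlarged to the
whole symmetric interval so that the bound no longer depends on `v`. -/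
theorem IsRidgeFamily.enorm_sub_le (hg : IsRidgeFamily P g I p r Θ) {l : ℕ} (hl : l < p)
    (w τ c : ℕ → ℝ) {v : ℝ} (hv : |v| ≤ b) (hτ : ∀ i ∈ I, |τ i| + b * |c i| ≤ r) (ω : Ω) :
    ‖∑ i ∈ I, w i * g l i (τ i + v * c i) ω - ∑ i ∈ I, w i * g l i (τ i) ω‖ₑ
      ≤ ∫⁻ u in Icc (-b) b, ‖∑ i ∈ I, (w i * c i) * g (l + 1) i (τ i + u * c i) ω‖ₑ := by
  have hb : 0 ≤ b := (abs_nonneg v).trans hv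
  have hmem : ∀ u ∈ Set.uIoc 0 v, |u| ≤ b := by
    intro u hu
    rw [Set.mem_uIoc] at hu
    rw [abs_le] at hv ⊢
    rcases hu with hu | hu <;> constructor <;> linarith [hu.1, hu.2, hv.1, hv.2]
  have hmeas : ∀ i, Measurable fun u => g (l + 1) i (τ i + u * c i) ω := fun i =>
    (hg.measurable (l + 1) i).comp
      (f := fun u => (τ i + u * c i, ω)) (by fun_prop)
  have hint : ∀ i ∈ I, IntervalIntegrable (fun u => g (l + 1) i (τ i + u * c i) ω) volume 0 v := by
    intro i hi
    obtain ⟨C, hC⟩ := hg.bounded (l + 1) hl i ω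
    rw [intervalIntegrable_iff]
    refine Measure.integrableOn_of_bounded (M := C) (by simp)
      (hmeas i).aestronglyMeasurable ?_
    rw [ae_restrict_iff' measurableSet_uIoc]
    exact ae_of_all _ fun u hu => hC _ (abs_add_mul_le (hτ i hi) (hmem u hu))
  have hdiff : ∑ i ∈ I, w i * g l i (τ i + v * c i) ω - ∑ i ∈ I, w i * g l i (τ i) ω
      = ∫ u in (0 : ℝ)..v, ∑ i ∈ I, (w i * c i) * g (l + 1) i (τ i + u * c i) ω := by
    rw [intervalIntegral.integral_finsetSum fun i hi => (hint i hi).const_mul _,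
      ← Finset.sum_sub_distrib]
    refine Finset.sum_congr rfl fun i hi => ?_
    have h0 : |τ i| ≤ r := by
      have := hτ i hi
      have := mul_nonneg hb (abs_nonneg (c i))
      linarith
    rw [← mul_sub, hg.integral l hl i ω _ _ h0 (abs_add_mul_le (hτ i hi) hv),
      intervalIntegral.integral_const_mul, mul_assoc]
    congr 1
    have := intervalIntegral.mul_integral_comp_add_mul (a := 0) (b := v)
      (f := fun s => g (l + 1) i s ω) (c := c i) (d := τ i)
    rw [mul_zero, add_zero] at this
    simp only [mul_comm (c i)] at this
    rw [← this, mul_comm]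
  rw [hdiff]
  have h1 : ‖∫ u in (0 : ℝ)..v, ∑ i ∈ I, (w i * c i) * g (l + 1) i (τ i + u * c i) ω‖ₑ
      ≤ ∫⁻ u in Set.uIoc 0 v, ‖∑ i ∈ I, (w i * c i) * g (l + 1) i (τ i + u * c i) ω‖ₑ := by
    rw [← ofReal_norm, intervalIntegral.norm_intervalIntegral_eq, ofReal_norm]
    exact enorm_integral_le_lintegral_enorm _
  refine h1.trans (lintegral_mono_set fun u hu => ?_)
  exact Set.mem_Icc.2 (abs_le.1 (hmem u hu))

/-- One coordinate is released at a time: the value at β_m is the value at zero plus the integral of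
a derivative. The right side is free of β, so its second moment can be computed although the left
side holds for all β at once. -/
theorem IsRidgeFamily.enorm_le_ridgeBound (hg : IsRidgeFamily P g I p r Θ) {β : ℕ → ℝ}
    (hβ : ∀ j, |β j| ≤ b) (m l : ℕ) (hml : l + m ≤ p) (w t : ℕ → ℝ)
    (ht : ∀ i ∈ I, |t i| + ∑ j ∈ Finset.range m, b * |a j i| ≤ r) (ω : Ω) :
    ‖∑ i ∈ I, w i * g l i (t i + ∑ j ∈ Finset.range m, β j * a j i) ω‖ₑ
      ≤ ridgeBound g I a b m l w t ω := by
  induction m generalizing l w t with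
  | zero => simp [ridgeBound]
  | succ m ih =>
    have hb : 0 ≤ b := (abs_nonneg _).trans (hβ 0)
    simp only [ridgeBound]
    have hτ : ∀ i ∈ I, |t i + ∑ j ∈ Finset.range m, β j * a j i| + b * |a m i| ≤ r := by
      intro i hi
      refine le_trans ?_ (ht i hi)
      rw [Finset.sum_range_succ, ← add_assoc]
      gcongr
      refine (abs_add_le _ _).trans ?_
      gcongr
      refine (Finset.abs_sum_le_sum_abs _ _).trans (Finset.sum_le_sum fun j _ => ?_)
      rw [abs_mul]
      gcongr
      exact hβ j
    have hstep := hg.enorm_sub_le (b := b) (show l < p by omega) w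
      (fun i => t i + ∑ j ∈ Finset.range m, β j * a j i) (a m) (hβ m) hτ ω
    have hsplit : ∑ i ∈ I, w i * g l i (t i + ∑ j ∈ Finset.range (m + 1), β j * a j i) ω
        = ∑ i ∈ I, w i * g l i (t i + ∑ j ∈ Finset.range m, β j * a j i) ω
          + (∑ i ∈ I, w i * g l i (t i + ∑ j ∈ Finset.range m, β j * a j i + β m * a m i) ω
            - ∑ i ∈ I, w i * g l i (t i + ∑ j ∈ Finset.range m, β j * a j i) ω) := by
      rw [add_sub_cancel]
      simp_rw [Finset.sum_range_succ, add_assoc]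
    rw [hsplit]
    refine (enorm_add_le _ _).trans (add_le_add (ih l (by omega) w t fun i hi => ?_) ?_)
    · refine le_trans ?_ (ht i hi)
      rw [Finset.sum_range_succ]
      have := mul_nonneg hb (abs_nonneg (a m i))
      linarith
    · refine hstep.trans (setLIntegral_mono' measurableSet_Icc fun u hu => ?_)
      have := ih (l + 1) (by omega) (fun i => w i * a m i) (fun i => t i + u * a m i)
        (fun i hi => ?_)
      · refine le_trans (le_of_eq ?_) this
        congr 1
        refine Finset.sum_congr rfl fun i _ => ?_
        congr 2; ring
      · refine le_trans ?_ (ht i hi)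
        rw [Finset.sum_range_succ]
        have h1 : |t i + u * a m i| ≤ |t i| + b * |a m i| :=
          abs_add_mul_le le_rfl (abs_le.2 (Set.mem_Icc.1 hu))
        linarith

theorem volume_Icc_symm (b : ℝ) : volume (Icc (-b) b) = ENNReal.ofReal (2 * b) := by
  rw [Real.volume_Icc]; congr 1; ring

theorem lintegral_sq_setLIntegral_le [SFinite P] {f : ℝ → Ω → ℝ≥0∞}
    (hf : Measurable fun z : ℝ × Ω => f z.1 z.2) {K : ℝ≥0∞}
    (hK : ∀ u ∈ Icc (-b) b, ∫⁻ ω, f u ω ^ 2 ∂P ≤ K) :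
    ∫⁻ ω, (∫⁻ u in Icc (-b) b, f u ω) ^ 2 ∂P ≤ ENNReal.ofReal (2 * b) ^ 2 * K := by
  calc ∫⁻ ω, (∫⁻ u in Icc (-b) b, f u ω) ^ 2 ∂P
      ≤ ∫⁻ ω, (ENNReal.ofReal (2 * b) * ∫⁻ u in Icc (-b) b, f u ω ^ 2) ∂P := by
        refine lintegral_mono fun ω => ?_
        have h : Measurable fun u => f u ω := hf.comp (measurable_id.prodMk measurable_const)
        refine (lintegral_sq_le h.aemeasurable).trans (le_of_eq ?_)
        rw [Measure.restrict_apply_univ, volume_Icc_symm]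
    _ = ENNReal.ofReal (2 * b) * ∫⁻ ω, (∫⁻ u in Icc (-b) b, f u ω ^ 2) ∂P :=
        lintegral_const_mul' _ _ ENNReal.ofReal_ne_top
    _ = ENNReal.ofReal (2 * b) * ∫⁻ u in Icc (-b) b, ∫⁻ ω, f u ω ^ 2 ∂P := by
        rw [lintegral_lintegral_swap]
        exact ((hf.comp measurable_swap).pow_const 2).aemeasurable
    _ ≤ ENNReal.ofReal (2 * b) * ∫⁻ u in Icc (-b) b, K := by
        gcongr ENNReal.ofReal (2 * b) * ?_
        exact setLIntegral_mono' measurableSet_Icc hK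
    _ = ENNReal.ofReal (2 * b) ^ 2 * K := by
        rw [setLIntegral_const, volume_Icc_symm]; ring

/-- Each differentiation multiplies the weight by a coordinate of the design, and each integration
by the length 2b. On a small box the product of the two is at most one. -/
theorem ofReal_mul_sq (c : ℝ) (I : Finset ℕ) (w : ℕ → ℝ) {d : ℕ → ℝ} (hc : ∀ i ∈ I, |c * d i| ≤ 1) :
    ENNReal.ofReal c ^ 2 * ∑ i ∈ I, ENNReal.ofReal ((w i * d i) ^ 2)
      ≤ ∑ i ∈ I, ENNReal.ofReal (w i ^ 2) := by
  rw [Finset.mul_sum]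
  refine Finset.sum_le_sum fun i hi => ?_
  have h0 : ENNReal.ofReal c ^ 2 ≤ ENNReal.ofReal (c ^ 2) := by
    rw [← sq_abs, ENNReal.ofReal_pow (abs_nonneg _)]
    gcongr
    exact le_abs_self c
  refine (mul_le_mul_left h0 _).trans ?_
  rw [← ENNReal.ofReal_mul (sq_nonneg _)]
  refine ENNReal.ofReal_le_ofReal ?_
  have h1 : (c * d i) ^ 2 ≤ 1 := (sq_le_one_iff_abs_le_one _).2 (hc i hi)
  calc c ^ 2 * (w i * d i) ^ 2 = w i ^ 2 * (c * d i) ^ 2 := by ring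
    _ ≤ w i ^ 2 * 1 := by gcongr
    _ = w i ^ 2 := mul_one _

/-- Squaring the two-term recursion costs a factor 4 for each term, and on a small box the
derivative term obeys the same bound as the other. This gives 8 per direction. -/
theorem IsRidgeFamily.lintegral_ridgeBound_sq_le [SFinite P] (hg : IsRidgeFamily P g I p r Θ)
    (hb : 0 ≤ b) (m l : ℕ) (hml : l + m ≤ p) (w t : ℕ → ℝ)
    (ht : ∀ i ∈ I, |t i| + ∑ j ∈ Finset.range m, b * |a j i| ≤ r)
    (ha : ∀ j < m, ∀ i ∈ I, |2 * b * a j i| ≤ 1) :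
    ∫⁻ ω, ridgeBound g I a b m l w t ω ^ 2 ∂P
      ≤ 8 ^ m * (Θ * ∑ i ∈ I, ENNReal.ofReal (w i ^ 2)) := by
  induction m generalizing l w t with
  | zero =>
    simp only [ridgeBound, pow_zero, one_mul]
    exact hg.moment l (by omega) w t fun i hi => by simpa using ht i hi
  | succ m ih =>
    simp only [ridgeBound]
    have hshift : ∀ i ∈ I, ∀ u ∈ Icc (-b) b,
        |t i + u * a m i| + ∑ j ∈ Finset.range m, b * |a j i| ≤ r := by
      intro i hi u hu
      refine le_trans ?_ (ht i hi)
      rw [Finset.sum_range_succ]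
      have h1 : |t i + u * a m i| ≤ |t i| + b * |a m i| :=
        abs_add_mul_le le_rfl (abs_le.2 (Set.mem_Icc.1 hu))
      linarith
    have ht' : ∀ i ∈ I, |t i| + ∑ j ∈ Finset.range m, b * |a j i| ≤ r := by
      intro i hi
      refine le_trans ?_ (ht i hi)
      rw [Finset.sum_range_succ]
      have := mul_nonneg hb (abs_nonneg (a m i))
      linarith
    have hA := ih l (by omega) w t ht' (fun j hj => ha j (by omega))
    have hB : ∫⁻ ω, (∫⁻ u in Icc (-b) b, ridgeBound g I a b m (l + 1) (fun i => w i * a m i)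
        (fun i => t i + u * a m i) ω) ^ 2 ∂P
        ≤ ENNReal.ofReal (2 * b) ^ 2
          * (8 ^ m * (Θ * ∑ i ∈ I, ENNReal.ofReal ((w i * a m i) ^ 2))) := by
      refine lintegral_sq_setLIntegral_le ?_ fun u hu => ?_
      · exact measurable_ridgeBound_comp hg.measurable _ _ _ (fun i => by fun_prop) measurable_snd
      · exact ih (l + 1) (by omega) _ _ (fun i hi => hshift i hi u hu) (fun j hj => ha j (by omega))
    calc _ ≤ ∫⁻ ω, (4 * ridgeBound g I a b m l w t ω ^ 2 +
            4 * (∫⁻ u in Icc (-b) b, ridgeBound g I a b m (l + 1) (fun i => w i * a m i)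
            (fun i => t i + u * a m i) ω) ^ 2) ∂P := lintegral_mono fun ω => ENNReal_add_sq_le _ _
      _ ≤ 4 * (8 ^ m * (Θ * ∑ i ∈ I, ENNReal.ofReal (w i ^ 2))) +
            4 * (ENNReal.ofReal (2 * b) ^ 2
          * (8 ^ m * (Θ * ∑ i ∈ I, ENNReal.ofReal ((w i * a m i) ^ 2)))) := by
        rw [lintegral_add_left, lintegral_const_mul' _ _ (by simp),
          lintegral_const_mul' _ _ (by simp)]
        · gcongr
        · have h : Measurable fun ω => ridgeBound g I a b m l w t ω :=
            measurable_ridgeBound_comp hg.measurable _ _ _ (fun i => measurable_const) measurable_id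
          exact (h.pow_const 2).const_mul 4
      _ = 4 * (8 ^ m * (Θ * ∑ i ∈ I, ENNReal.ofReal (w i ^ 2))) +
            4 * (8 ^ m * (Θ * (ENNReal.ofReal (2 * b) ^ 2
          * ∑ i ∈ I, ENNReal.ofReal ((w i * a m i) ^ 2)))) := by ring
      _ ≤ 4 * (8 ^ m * (Θ * ∑ i ∈ I, ENNReal.ofReal (w i ^ 2))) +
            4 * (8 ^ m * (Θ * ∑ i ∈ I, ENNReal.ofReal (w i ^ 2))) := by
        gcongr
        exact ofReal_mul_sq (2 * b) I w (ha m (by omega))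
      _ = _ := by ring

/-- The oscillation of `∑ w_i g_i(t_i)` over a box around the origin is dominated by a random
variable with a second moment of the order of the squared first derivatives. -/
theorem IsRidgeFamily.exists_oscillation_bound [SFinite P] (hg : IsRidgeFamily P g I p r Θ)
    (hb : 0 ≤ b) (w : ℕ → ℝ) (hr : ∀ i ∈ I, ∑ j ∈ Finset.range p, b * |a j i| ≤ r)
    (ha : ∀ j < p, ∀ i ∈ I, |2 * b * a j i| ≤ 1) :
    ∃ R : Ω → ℝ≥0∞, Measurable R ∧
      (∀ ω, ∀ β : ℕ → ℝ, (∀ j, |β j| ≤ b) →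
        ‖∑ i ∈ I, w i * g 0 i (∑ j ∈ Finset.range p, β j * a j i) ω
          - ∑ i ∈ I, w i * g 0 i 0 ω‖ₑ ≤ R ω) ∧
      ∫⁻ ω, R ω ^ 2 ∂P ≤ p * ∑ m ∈ Finset.range p, ENNReal.ofReal (2 * b) ^ 2
        * (8 ^ p * (Θ * ∑ i ∈ I, ENNReal.ofReal ((w i * a m i) ^ 2))) := by
  have hmono : ∀ m ≤ p, ∀ i ∈ I, ∑ j ∈ Finset.range m, b * |a j i| ≤ r := fun m hm i hi =>
    (Finset.sum_le_sum_of_subset_of_nonneg (Finset.range_subset_range.2 hm)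
      fun j _ _ => mul_nonneg hb (abs_nonneg _)).trans (hr i hi)
  let S : ℕ → Ω → ℝ≥0∞ := fun m ω => ∫⁻ u in Icc (-b) b,
    ridgeBound g I a b m 1 (fun i => w i * a m i) (fun i => u * a m i) ω
  have hshift : ∀ m < p, ∀ u ∈ Icc (-b) b, ∀ i ∈ I,
      |u * a m i| + ∑ j ∈ Finset.range m, b * |a j i| ≤ r := by
    intro m hm u hu i hi
    have := hmono (m + 1) hm i hi
    rw [Finset.sum_range_succ] at this
    have h1 : |u * a m i| ≤ b * |a m i| := by
      rw [abs_mul]; gcongr; exact abs_le.2 (Set.mem_Icc.1 hu)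
    linarith
  have hSm : ∀ m, Measurable (S m) := fun m => by
    refine Measurable.lintegral_prod_right' (f := fun z : Ω × ℝ =>
      ridgeBound g I a b m 1 (fun i => w i * a m i) (fun i => z.2 * a m i) z.1) ?_
    exact measurable_ridgeBound_comp hg.measurable _ _ _ (fun i => by fun_prop) measurable_fst
  refine ⟨fun ω => ∑ m ∈ Finset.range p, S m ω, Finset.measurable_sum _ fun m _ => hSm m, ?_, ?_⟩
  · intro ω β hβ
    -- Telescoping over coordinates makes every term carry at least one derivative. The bound thus
    -- retains the factor 2b and the weights `w i * a m i`, so it is small with the box.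
    have htel : ∑ i ∈ I, w i * g 0 i (∑ j ∈ Finset.range p, β j * a j i) ω
          - ∑ i ∈ I, w i * g 0 i 0 ω
        = ∑ m ∈ Finset.range p, (∑ i ∈ I, w i * g 0 i (∑ j ∈ Finset.range (m + 1), β j * a j i) ω
          - ∑ i ∈ I, w i * g 0 i (∑ j ∈ Finset.range m, β j * a j i) ω) := by
      rw [Finset.sum_range_sub (fun m =>
        ∑ i ∈ I, w i * g 0 i (∑ j ∈ Finset.range m, β j * a j i) ω)]
      simp
    rw [htel]
    refine (enorm_sum_le _ _).trans (Finset.sum_le_sum fun m hm => ?_)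
    rw [Finset.mem_range] at hm
    have hstep := hg.enorm_sub_le (b := b) (show 0 < p by omega) w
      (fun i => ∑ j ∈ Finset.range m, β j * a j i) (a m) (hβ m) (fun i hi => ?_) ω
    · simp_rw [Finset.sum_range_succ]
      refine hstep.trans (setLIntegral_mono' measurableSet_Icc fun u hu => ?_)
      refine le_trans (le_of_eq ?_) (hg.enorm_le_ridgeBound hβ m (0 + 1) (by omega)
        (fun i => w i * a m i) (fun i => u * a m i) (hshift m hm u hu) ω)
      congr 1
      refine Finset.sum_congr rfl fun i _ => ?_
      congr 2; ring
    · refine le_trans ?_ (hmono (m + 1) hm i hi)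
      rw [Finset.sum_range_succ]
      gcongr
      refine (Finset.abs_sum_le_sum_abs _ _).trans (Finset.sum_le_sum fun j _ => ?_)
      rw [abs_mul]
      gcongr
      exact hβ j
  · calc ∫⁻ ω, (∑ m ∈ Finset.range p, S m ω) ^ 2 ∂P
        ≤ ∫⁻ ω, p * ∑ m ∈ Finset.range p, S m ω ^ 2 ∂P := by
          refine lintegral_mono fun ω => (ENNReal_sum_sq_le _ _).trans_eq ?_
          rw [Finset.card_range]
      _ = p * ∑ m ∈ Finset.range p, ∫⁻ ω, S m ω ^ 2 ∂P := by
          rw [lintegral_const_mul' _ _ (by simp), lintegral_finsetSum _ fun m _ =>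
            (hSm m).pow_const 2]
      _ ≤ _ := by
          gcongr with m hm
          rw [Finset.mem_range] at hm
          refine lintegral_sq_setLIntegral_le (measurable_ridgeBound_comp hg.measurable _ _ _
            (fun i => by fun_prop) measurable_snd) fun u hu => ?_
          refine (hg.lintegral_ridgeBound_sq_le hb m 1 (by omega) _ _ (hshift m hm u hu)
            (fun j hj => ha j (by omega))).trans ?_
          gcongr
          · norm_num

end Ridge

end MEstimation

namespace MEstimation

/-! ### The predicted score and its derivatives -/

section Predicted

variable {Ω : Type*} [MeasurableSpace Ω] {P : Measure Ω} {ε : ℤ → Ω → ℝ} {ε₀' : Ω → ℝ}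
  {G : (ℕ → ℝ) → ℝ} {ρ ψ : ℝ → ℝ}

/-- The successive `t`-derivatives of the predicted score, as limits of difference quotients. -/
noncomputable def oneStepDeriv (P : Measure Ω) (ε : ℤ → Ω → ℝ) (G : (ℕ → ℝ) → ℝ) (ψ : ℝ → ℝ) :
    ℕ → ℝ → (ℕ → ℝ) → ℝ
  | 0, t, s => oneStep P ε G ψ t s
  | l + 1, t, s => limUnder atTop fun n : ℕ => ((n : ℝ) + 1) *
      (oneStepDeriv P ε G ψ l (t + ((n : ℝ) + 1)⁻¹) s - oneStepDeriv P ε G ψ l t s)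

theorem IsInnovationModel.isProbabilityMeasure_innov [IsProbabilityMeasure P]
    (hm : IsInnovationModel P ε ε₀' G) : IsProbabilityMeasure (P.map (ε 0)) :=
  Measure.isProbabilityMeasure_map (hm.measurable_innov 0).aemeasurable

theorem IsInnovationModel.isProbabilityMeasure_past [IsProbabilityMeasure P]
    (hm : IsInnovationModel P ε ε₀' G) : IsProbabilityMeasure (P.map (past ε 0)) :=
  Measure.isProbabilityMeasure_map (hm.measurable_past 0).aemeasurable

theorem tendsto_difference_quotient {f : ℝ → ℝ} {f' t : ℝ} (h : HasDerivAt f f' t) :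
    Tendsto (fun n : ℕ => ((n : ℝ) + 1) * (f (t + ((n : ℝ) + 1)⁻¹) - f t)) atTop (𝓝 f') := by
  have h1 := h.tendsto_slope_zero
  have h2 : Tendsto (fun n : ℕ => ((n : ℝ) + 1)⁻¹) atTop (𝓝[≠] 0) := by
    refine tendsto_nhdsWithin_iff.2 ⟨?_, Eventually.of_forall fun n => ?_⟩
    · have := tendsto_one_div_add_atTop_nhds_zero_nat (𝕜 := ℝ)
      simpa using this
    · simp only [mem_compl_iff, mem_singleton_iff, inv_eq_zero]; positivity
  have h3 := h1.comp h2
  refine h3.congr fun n => ?_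
  simp

theorem oneStepDeriv_eq_iteratedDeriv {s : ℕ → ℝ} {p : ℕ}
    (hs : ContDiff ℝ p (fun t => oneStep P ε G ψ t s)) {l : ℕ} (hl : l ≤ p) (t : ℝ) :
    oneStepDeriv P ε G ψ l t s = iteratedDeriv l (fun t => oneStep P ε G ψ t s) t := by
  induction l generalizing t with
  | zero => simp [oneStepDeriv]
  | succ l ih =>
    simp only [oneStepDeriv]
    simp_rw [ih (by omega)]
    have hd : HasDerivAt (iteratedDeriv l fun t => oneStep P ε G ψ t s)
        (iteratedDeriv (l + 1) (fun t => oneStep P ε G ψ t s) t) t := by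
      rw [iteratedDeriv_succ]
      exact (hs.differentiable_iteratedDeriv l (by exact_mod_cast hl) t).hasDerivAt
    exact (tendsto_difference_quotient hd).limUnder_eq

/-- Since m(0) = 0, continuity gives m < 1 near zero, and ψ(e_1 + t) differs from ψ(e_1) by a square
integrable variable. -/
theorem exists_memLp_radius (hm : IsInnovationModel P ε ε₀' G) (hψ : Measurable ψ)
    (hA1 : CondA1 P ε G ρ ψ) (hA3 : CondA3 P ε G ψ) :
    ∃ r : ℝ, 0 < r ∧ ∀ t, |t| ≤ r → MemLp (fun ω => ψ (err G ε 1 ω + t)) 2 P := by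
  have h0 : mMod P ε G ψ 0 = 0 := by simp [mMod]
  have h1 : ∀ᶠ t in 𝓝 (0 : ℝ), mMod P ε G ψ t < 1 := by
    have : mMod P ε G ψ 0 < 1 := by rw [h0]; exact zero_lt_one
    exact hA3.eventually_lt_const this
  obtain ⟨r, hr, hball⟩ := Metric.eventually_nhds_iff.1 h1
  refine ⟨r / 2, by positivity, fun t ht => ?_⟩
  have hlt : mMod P ε G ψ t < 1 := hball (by rw [Real.dist_eq, sub_zero]; linarith)
  have hmeas : Measurable fun ω => ψ (err G ε 1 ω + t) :=
    hψ.comp ((hm.measurable_err 1).add_const t)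
  have hmeas0 : Measurable fun ω => ψ (err G ε 1 ω) := hψ.comp (hm.measurable_err 1)
  have h2 : MemLp (fun ω => ψ (err G ε 1 ω + t) - ψ (err G ε 1 ω)) 2 P :=
    ⟨(hmeas.sub hmeas0).aestronglyMeasurable, hlt.trans (by simp)⟩
  have := h2.add hA1.memLp
  refine this.ae_eq (ae_of_all _ fun ω => ?_)
  simp

variable [IsProbabilityMeasure P]

/-- The reason for defining derivatives through limits of sequences: they are then jointly
measurable in t and the past, with no exceptional set, as Fubini in t requires. -/
theorem measurable_oneStepDeriv (hm : IsInnovationModel P ε ε₀' G) (hψ : Measurable ψ) (l : ℕ) :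
    Measurable fun z : ℝ × (ℕ → ℝ) => oneStepDeriv P ε G ψ l z.1 z.2 := by
  have := hm.isProbabilityMeasure_innov
  induction l with
  | zero =>
    simp only [oneStepDeriv, oneStep, predict]
    have h : Measurable fun z : (ℝ × (ℕ → ℝ)) × ℝ => ψ (G (consSeq z.2 z.1.2) + z.1.1) := by
      refine hψ.comp (Measurable.add (hm.measurable_filter.comp ?_) (by fun_prop))
      exact measurable_consSeq.comp (f := fun z : (ℝ × (ℕ → ℝ)) × ℝ => (z.2, z.1.2)) (by fun_prop)
    exact (h.stronglyMeasurable.integral_prod_right').measurable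
  | succ l ih =>
    simp only [oneStepDeriv]
    refine (StronglyMeasurable.limUnder (f := fun (n : ℕ) (z : ℝ × (ℕ → ℝ)) => ((n : ℝ) + 1) *
      (oneStepDeriv P ε G ψ l (z.1 + ((n : ℝ) + 1)⁻¹) z.2 - oneStepDeriv P ε G ψ l z.1 z.2))
      fun n => Measurable.stronglyMeasurable ?_).measurable
    refine Measurable.const_mul (Measurable.sub ?_ ih) _
    exact ih.comp (f := fun z : ℝ × (ℕ → ℝ) => (z.1 + ((n : ℝ) + 1)⁻¹, z.2)) (by fun_prop)

theorem measurable_oneStepDeriv_right (hm : IsInnovationModel P ε ε₀' G) (hψ : Measurable ψ)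
    (l : ℕ) (t : ℝ) : Measurable (oneStepDeriv P ε G ψ l t) :=
  (measurable_oneStepDeriv hm hψ l).comp (measurable_const.prodMk measurable_id)

/-- The event on which the predicted score at time `i` is smooth. -/
theorem exists_smooth_event (hm : IsInnovationModel P ε ε₀' G) (hψ : Measurable ψ) {p : ℕ}
    (hA6 : CondA6 P ε ε₀' G ψ p) (i : ℤ) :
    ∃ A : Set Ω, MeasurableSet A ∧ (∀ᵐ ω ∂P, ω ∈ A) ∧ ∀ ω ∈ A,
      ContDiff ℝ p (fun t => oneStep P ε G ψ t (past ε i ω)) ∧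
      ∀ t, psiStep P ε G ψ 1 t (past ε i ω) = oneStep P ε G ψ t (past ε i ω) := by
  have h : ∀ᵐ ω ∂P, ContDiff ℝ p (fun t => oneStep P ε G ψ t (past ε i ω)) ∧
      ∀ t, psiStep P ε G ψ 1 t (past ε i ω) = oneStep P ε G ψ t (past ε i ω) := by
    filter_upwards [hA6.1 i, psiStep_one_past_ae_eq hm hψ i] with ω h1 h2
    refine ⟨?_, h2⟩
    simp_rw [← h2]; exact h1
  obtain ⟨A, hA, hAm, hAp⟩ := h.exists_measurable_mem
  exact ⟨A, hAm, hA, hAp⟩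

theorem psiOneDeriv_past_ae_eq (hm : IsInnovationModel P ε ε₀' G) (hψ : Measurable ψ) {p : ℕ}
    (hA6 : CondA6 P ε ε₀' G ψ p) (i : ℤ) {l : ℕ} (hl : l ≤ p) (t : ℝ) :
    (fun ω => psiOneDeriv P ε G ψ l t (past ε i ω))
      =ᵐ[P] fun ω => oneStepDeriv P ε G ψ l t (past ε i ω) := by
  obtain ⟨A, -, hA, hAp⟩ := exists_smooth_event hm hψ hA6 i
  filter_upwards [hA] with ω hω
  obtain ⟨h1, h2⟩ := hAp ω hω
  rw [oneStepDeriv_eq_iteratedDeriv h1 hl]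
  simp only [psiOneDeriv, h2]

theorem IsInnovationModel.memLp_past_iff (hm : IsInnovationModel P ε ε₀' G) {f : (ℕ → ℝ) → ℝ}
    (hf : Measurable f) (i : ℤ) :
    MemLp (fun ω => f (past ε i ω)) 2 P ↔ MemLp f 2 (P.map (past ε 0)) := by
  rw [← hm.map_past i, memLp_map_measure_iff hf.aestronglyMeasurable
    (hm.measurable_past i).aemeasurable]
  rfl

theorem IsInnovationModel.memLp_score (hm : IsInnovationModel P ε ε₀' G) (hψ : Measurable ψ)
    {t : ℝ} (h : MemLp (fun ω => ψ (err G ε 1 ω + t)) 2 P) (i : ℤ) :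
    MemLp (fun ω => ψ (err G ε i ω + t)) 2 P := by
  have hf : Measurable fun s => ψ (G s + t) := hψ.comp (hm.measurable_filter.add_const t)
  exact (hm.memLp_past_iff hf i).2 ((hm.memLp_past_iff hf 1).1 h)

theorem IsInnovationModel.integral_past (hm : IsInnovationModel P ε ε₀' G) {f : (ℕ → ℝ) → ℝ}
    (hf : Measurable f) (i : ℤ) :
    ∫ ω, f (past ε i ω) ∂P = ∫ s, f s ∂(P.map (past ε 0)) := by
  rw [← hm.map_past i, integral_map (hm.measurable_past i).aemeasurable hf.aestronglyMeasurable]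

theorem integral_score (hm : IsInnovationModel P ε ε₀' G) (hψ : Measurable ψ) (t : ℝ) (i : ℤ) :
    ∫ ω, ψ (err G ε i ω + t) ∂P = phi P ε G ψ t := by
  have hf : Measurable fun s => ψ (G s + t) := hψ.comp (hm.measurable_filter.add_const t)
  exact (hm.integral_past hf i).trans (hm.integral_past hf 1).symm

theorem integral_oneStep (hm : IsInnovationModel P ε ε₀' G) (hψ : Measurable ψ) {t : ℝ}
    (h : Integrable (fun ω => ψ (err G ε 1 ω + t)) P) :
    ∫ s, oneStep P ε G ψ t s ∂(P.map (past ε 0)) = phi P ε G ψ t := by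
  have hf : Measurable fun s => ψ (G s + t) := hψ.comp (hm.measurable_filter.add_const t)
  have := hm.isProbabilityMeasure_innov
  have h1 := hm.condExp_past 1 hf h
  have h2 := integral_condExp (μ := P) (hm.pastSigma_le (1 - 1)) (f := fun ω => ψ (err G ε 1 ω + t))
  change ∫ s, predict (P.map (ε 0)) (fun s => ψ (G s + t)) s ∂_ = _
  rw [phi, ← h2, ← hm.integral_past (measurable_predict hf) (1 - 1)]
  exact (integral_congr_ae h1).symm

/-- The lag norms of the derivatives of the predicted score are controlled by the coupling
distances. -/
theorem lagNorm_oneStepDeriv_le (hm : IsInnovationModel P ε ε₀' G) (hψ : Measurable ψ) {p : ℕ}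
    (hA6 : CondA6 P ε ε₀' G ψ p) {l : ℕ} (hl : l ≤ p) {t : ℝ}
    (hL : MemLp (fun ω => oneStepDeriv P ε G ψ l t (past ε 0 ω)) 2 P) (k : ℕ) :
    lagNorm P ε (oneStepDeriv P ε G ψ l t) k ≤ 2 * eLpNorm
        (P[fun ω => psiOneDeriv P ε G ψ l t (past ε (k : ℤ) ω) | pastSigma ε 0]
          - P[fun ω => psiOneDeriv P ε G ψ l t (past (coupled ε ε₀') (k : ℤ) ω) |
              pastSigma (coupled ε ε₀') 0]) 2 P := by
  have hf := measurable_oneStepDeriv_right (P := P) hm hψ l t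
  have hLk : MemLp (fun ω => oneStepDeriv P ε G ψ l t (past ε (k : ℤ) ω)) 2 P :=
    (hm.memLp_past_iff hf k).2 ((hm.memLp_past_iff hf 0).1 hL)
  -- Choosing the time equal to the lag k places the projected innovation at time zero, where the
  -- coupling acts.
  rw [← hm.eLpNorm_condExp_sub_condExp k hf (hLk.integrable one_le_two) k]
  have e1 : (k : ℤ) - (k : ℕ) = 0 := by simp
  have e2 : (k : ℤ) - ((k + 1 : ℕ) : ℤ) = -1 := by push_cast; ring
  rw [e1, e2]
  set U := P[fun ω => oneStepDeriv P ε G ψ l t (past ε (k : ℤ) ω) | pastSigma ε 0] with hU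
  have h1 : P[fun ω => psiOneDeriv P ε G ψ l t (past ε (k : ℤ) ω) | pastSigma ε 0] =ᵐ[P] U :=
    condExp_congr_ae (psiOneDeriv_past_ae_eq hm hψ hA6 k hl t)
  have h2 : P[U | pastSigma ε (-1)] =ᵐ[P]
      P[fun ω => oneStepDeriv P ε G ψ l t (past ε (k : ℤ) ω) | pastSigma ε (-1)] :=
    condExp_condExp_of_le (pastSigma_mono (by norm_num)) (hm.pastSigma_le 0)
  rw [eLpNorm_congr_ae ((EventuallyEq.refl _ U).sub h2.symm),
    eLpNorm_congr_ae (h1.sub (EventuallyEq.refl _ _))]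
  exact hm.eLpNorm_sub_condExp_le (hLk.condExp one_le_two) stronglyMeasurable_condExp
    stronglyMeasurable_condExp

/-- On a common interval around zero, the derivatives of the predicted score have bounded second
moments and summable lag norms. -/
theorem exists_summable_lagNorm (hm : IsInnovationModel P ε ε₀' G) (hψ : Measurable ψ) {p : ℕ}
    (hA6 : ∀ l ≤ p, CondA6 P ε ε₀' G ψ l) :
    ∃ r₀ : ℝ, 0 < r₀ ∧ ∀ l ≤ p, ∃ (M : ℝ≥0∞) (d : ℕ → ℝ≥0∞), M < ∞ ∧ ∑' k, d k < ∞ ∧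
      (∀ t, |t| ≤ r₀ → ∀ i : ℤ, MemLp (fun ω => oneStepDeriv P ε G ψ l t (past ε i ω)) 2 P) ∧
      (∀ t, |t| ≤ r₀ →
        eLpNorm (fun ω => oneStepDeriv P ε G ψ l t (past ε 0 ω)) 2 P ≤ M) ∧
      (∀ t, |t| ≤ r₀ → ∀ k, lagNorm P ε (oneStepDeriv P ε G ψ l t) k ≤ d k) := by
  -- Each order l of derivative comes with its own radius; stating the bounds for all small radii
  -- lets finitely many orders share one.
  have hev : ∀ l ∈ Finset.range (p + 1), ∀ᶠ r₀ in 𝓝[>] (0 : ℝ),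
      ∃ (M : ℝ≥0∞) (d : ℕ → ℝ≥0∞), M < ∞ ∧ ∑' k, d k < ∞ ∧
      (∀ t, |t| ≤ r₀ → ∀ i : ℤ, MemLp (fun ω => oneStepDeriv P ε G ψ l t (past ε i ω)) 2 P) ∧
      (∀ t, |t| ≤ r₀ →
        eLpNorm (fun ω => oneStepDeriv P ε G ψ l t (past ε 0 ω)) 2 P ≤ M) ∧
      (∀ t, |t| ≤ r₀ → ∀ k, lagNorm P ε (oneStepDeriv P ε G ψ l t) k ≤ d k) := by
    intro l hl
    have hl' : l ≤ p := by simpa [Nat.lt_succ_iff] using hl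
    obtain ⟨-, e, he, hfin, hsum⟩ := hA6 l hl'
    filter_upwards [Ioc_mem_nhdsGT he] with r₀ hr₀
    have hbd : ∀ t, |t| ≤ r₀ → eLpNorm (fun ω => oneStepDeriv P ε G ψ l t (past ε 0 ω)) 2 P
        ≤ ⨆ (δ : ℝ) (_ : |δ| ≤ e), eLpNorm (fun ω => psiOneDeriv P ε G ψ l δ (past ε 0 ω)) 2 P := by
      intro t ht
      rw [← eLpNorm_congr_ae (psiOneDeriv_past_ae_eq hm hψ (hA6 l hl') 0 le_rfl t)]
      exact le_iSup₂_of_le (f := fun (δ : ℝ) (_ : |δ| ≤ e) =>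
        eLpNorm (fun ω => psiOneDeriv P ε G ψ l δ (past ε 0 ω)) 2 P) t (ht.trans hr₀.2) le_rfl
    have hf := fun t => measurable_oneStepDeriv_right (P := P) hm hψ l t
    have hL : ∀ t, |t| ≤ r₀ → MemLp (fun ω => oneStepDeriv P ε G ψ l t (past ε 0 ω)) 2 P :=
      fun t ht => ⟨((hf t).comp (hm.measurable_past 0)).aestronglyMeasurable,
        (hbd t ht).trans_lt (hfin 0)⟩
    refine ⟨_, fun k => 2 * ⨆ (δ : ℝ) (_ : |δ| ≤ e), eLpNorm
        (P[fun ω => psiOneDeriv P ε G ψ l δ (past ε (k : ℤ) ω) | pastSigma ε 0]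
          - P[fun ω => psiOneDeriv P ε G ψ l δ (past (coupled ε ε₀') (k : ℤ) ω) |
              pastSigma (coupled ε ε₀') 0]) 2 P, hfin 0, ?_, ?_, hbd, ?_⟩
    · rw [ENNReal.tsum_mul_left]
      exact ENNReal.mul_lt_top (by simp) hsum
    · intro t ht i
      exact (hm.memLp_past_iff (hf t) i).2 ((hm.memLp_past_iff (hf t) 0).1 (hL t ht))
    · intro t ht k
      refine (lagNorm_oneStepDeriv_le hm hψ (hA6 l hl') le_rfl (hL t ht) k).trans
        (mul_le_mul' le_rfl ?_)
      exact le_iSup₂_of_le (f := fun (δ : ℝ) (_ : |δ| ≤ e) => eLpNorm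
        (P[fun ω => psiOneDeriv P ε G ψ l δ (past ε (k : ℤ) ω) | pastSigma ε 0]
          - P[fun ω => psiOneDeriv P ε G ψ l δ (past (coupled ε ε₀') (k : ℤ) ω) |
              pastSigma (coupled ε ε₀') 0]) 2 P) t (ht.trans hr₀.2) le_rfl
  obtain ⟨r₀, hr₀, h⟩ := ((eventually_mem_nhdsWithin).and
    ((Finset.eventually_all (Finset.range (p + 1))).2 hev)).exists
  exact ⟨r₀, hr₀, fun l hl => h l (Finset.mem_range.2 (by omega))⟩

/-- The centered predicted scores and their derivatives form a ridge family. -/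
theorem exists_isRidgeFamily (hm : IsInnovationModel P ε ε₀' G) (hψ : Measurable ψ)
    (hA1 : CondA1 P ε G ρ ψ) (hA3 : CondA3 P ε G ψ) {p : ℕ}
    (hA6 : ∀ l ≤ p, CondA6 P ε ε₀' G ψ l) :
    ∃ (r : ℝ) (Θ : ℝ≥0∞) (g : ℕ → ℕ → ℝ → Ω → ℝ), 0 < r ∧ Θ < ∞ ∧
      (∀ I : Finset ℕ, IsRidgeFamily P g I p r Θ) ∧
      ∀ i : ℕ, ∀ᵐ ω ∂P, ∀ t, |t| ≤ r →
        g 0 i t ω = oneStep P ε G ψ t (past ε ((i : ℤ) - 1) ω) - phi P ε G ψ t := by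
  obtain ⟨r₁, hr₁, hint⟩ := exists_memLp_radius hm hψ hA1 hA3
  obtain ⟨r₀, hr₀, hlag⟩ := exists_summable_lagNorm hm hψ hA6
  choose! M d hM hd hL hMb hdb using hlag
  choose A hAm hA hAp using fun i => exists_smooth_event hm hψ (hA6 p le_rfl) i
  set D := oneStepDeriv P ε G ψ with hD
  have hDm : ∀ l, Measurable fun z : ℝ × (ℕ → ℝ) => D l z.1 z.2 :=
    fun l => measurable_oneStepDeriv hm hψ l
  have hDmr : ∀ l t, Measurable (D l t) := fun l t => measurable_oneStepDeriv_right hm hψ l t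
  have := hm.isProbabilityMeasure_past
  let c : ℕ → ℝ → ℝ := fun l t => ∫ s, D l t s ∂(P.map (past ε 0))
  have hcm : ∀ l, Measurable (c l) := fun l =>
    ((hDm l).stronglyMeasurable.integral_prod_right').measurable
  classical
  -- A ridge family must satisfy the calculus identities for every ω, so the predicted scores are
  -- set to zero off the event of smoothness.
  let H : ℕ → ℤ → ℝ → Ω → ℝ := fun l i t ω => (A i).indicator (fun ω => D l t (past ε i ω)) ω
  have hHm : ∀ l i, Measurable fun z : ℝ × Ω => H l i z.1 z.2 := by
    intro l i
    have h1 : Measurable fun z : ℝ × Ω => D l z.1 (past ε i z.2) :=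
      (hDm l).comp (measurable_fst.prodMk ((hm.measurable_past i).comp measurable_snd))
    exact h1.indicator (measurable_snd (hAm i))
  have hHae : ∀ l i t, (fun ω => H l i t ω) =ᵐ[P] fun ω => D l t (past ε i ω) := by
    intro l i t
    filter_upwards [hA i] with ω hω
    exact Set.indicator_of_mem hω _
  have hHcont : ∀ l ≤ p, ∀ i ω, Continuous fun t => H l i t ω := by
    intro l hl i ω
    by_cases hω : ω ∈ A i
    · have h1 := (hAp i ω hω).1
      have : (fun t => H l i t ω) = iteratedDeriv l fun t => oneStep P ε G ψ t (past ε i ω) := by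
        funext t
        simp only [H, Set.indicator_of_mem hω, hD]
        exact oneStepDeriv_eq_iteratedDeriv h1 hl t
      rw [this]
      exact h1.continuous_iteratedDeriv l (by exact_mod_cast hl)
    · simp only [H, Set.indicator_of_notMem hω]; exact continuous_const
  have hHderiv : ∀ l < p, ∀ i ω t, HasDerivAt (fun t => H l i t ω) (H (l + 1) i t ω) t := by
    intro l hl i ω t
    by_cases hω : ω ∈ A i
    · have h1 := (hAp i ω hω).1
      have h2 : ∀ l ≤ p, (fun t => H l i t ω)
          = iteratedDeriv l fun t => oneStep P ε G ψ t (past ε i ω) := by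
        intro l hl
        funext t
        simp only [H, Set.indicator_of_mem hω, hD]
        exact oneStepDeriv_eq_iteratedDeriv h1 hl t
      have h3 : H (l + 1) i t ω = (fun t => H (l + 1) i t ω) t := rfl
      rw [h3, h2 l hl.le, h2 (l + 1) hl, iteratedDeriv_succ]
      exact (h1.differentiable_iteratedDeriv l (by exact_mod_cast hl) t).hasDerivAt
    · simp only [H, Set.indicator_of_notMem hω]; exact hasDerivAt_const _ _
  have hcH : ∀ l i t, c l t = ∫ ω, H l i t ω ∂P := by
    intro l i t
    rw [integral_congr_ae (hHae l i t), hm.integral_past (hDmr l t)]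
  have hnorm1 : ∀ l ≤ p, ∀ t, |t| ≤ r₀ → ∀ i, ∫⁻ ω, ‖H l i t ω‖ₑ ∂P ≤ M l := by
    intro l hl t ht i
    calc ∫⁻ ω, ‖H l i t ω‖ₑ ∂P = ∫⁻ ω, ‖D l t (past ε i ω)‖ₑ ∂P :=
          lintegral_congr_ae ((hHae l i t).fun_comp (fun y => ‖y‖ₑ))
      _ = ∫⁻ ω, ‖D l t (past ε 0 ω)‖ₑ ∂P := by
          rw [hm.lintegral_past i (g := fun s => ‖D l t s‖ₑ) (hDmr l t).enorm,
            hm.lintegral_past 0 (g := fun s => ‖D l t s‖ₑ) (hDmr l t).enorm]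
      _ = eLpNorm (fun ω => D l t (past ε 0 ω)) 1 P := by rw [eLpNorm_one_eq_lintegral_enorm]
      _ ≤ eLpNorm (fun ω => D l t (past ε 0 ω)) 2 P :=
          eLpNorm_le_eLpNorm_of_exponent_le one_le_two
            ((hDmr l t).comp (hm.measurable_past 0)).aestronglyMeasurable
      _ ≤ M l := hMb l hl t ht
  have hcb : ∀ l ≤ p, ∀ t, |t| ≤ r₀ → |c l t| ≤ (M l).toReal := by
    intro l hl t ht
    rw [hcH l 0 t, ← Real.norm_eq_abs]
    refine (norm_integral_le_lintegral_norm _).trans ?_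
    refine ENNReal.toReal_mono (hM l hl).ne ?_
    simpa only [ofReal_norm] using hnorm1 l hl t ht 0
  have hHint : ∀ l ≤ p, ∀ t, |t| ≤ r₀ → ∀ i, Integrable (fun ω => H l i t ω) P := by
    intro l hl t ht i
    exact ((hL l hl t ht i).integrable one_le_two).congr (hHae l i t).symm
  have hmem : ∀ u v : ℝ, |u| ≤ r₀ → |v| ≤ r₀ → ∀ s ∈ Set.uIoc u v, |s| ≤ r₀ := by
    intro u v hu hv s hs
    rw [Set.mem_uIoc] at hs
    rw [abs_le] at hu hv ⊢
    rcases hs with hs | hs <;> constructor <;> linarith [hs.1, hs.2, hu.1, hu.2, hv.1, hv.2]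
  have hcint : ∀ l ≤ p, ∀ u v : ℝ, |u| ≤ r₀ → |v| ≤ r₀ → IntervalIntegrable (c l) volume u v := by
    intro l hl u v hu hv
    rw [intervalIntegrable_iff]
    refine Measure.integrableOn_of_bounded (M := (M l).toReal) (by simp)
      (hcm l).aestronglyMeasurable ?_
    rw [ae_restrict_iff' measurableSet_uIoc]
    exact ae_of_all _ fun s hs => hcb l hl s (hmem u v hu hv s hs)
  have hHftc : ∀ l < p, ∀ i ω u v, H l i v ω - H l i u ω = ∫ s in u..v, H (l + 1) i s ω := by
    intro l hl i ω u v
    exact (intervalIntegral.integral_eq_sub_of_hasDerivAt (fun s _ => hHderiv l hl i ω s)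
      ((hHcont (l + 1) hl i ω).intervalIntegrable u v)).symm
  -- The means inherit the integral identity by Fubini, so φ is never differentiated under the
  -- expectation.
  have hcftc : ∀ l < p, ∀ u v, |u| ≤ r₀ → |v| ≤ r₀ →
      c l v - c l u = ∫ s in u..v, c (l + 1) s := by
    intro l hl u v hu hv
    rw [hcH l 0 v, hcH l 0 u, ← integral_sub (hHint l hl.le v hv 0) (hHint l hl.le u hu 0)]
    simp_rw [hHftc l hl 0 _ u v]
    have hprod : Integrable (Function.uncurry fun s ω => H (l + 1) 0 s ω)
        ((volume.restrict (Set.uIoc u v)).prod P) := by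
      refine ⟨(hHm (l + 1) 0).aestronglyMeasurable, ?_⟩
      rw [hasFiniteIntegral_iff_enorm]
      change ∫⁻ z : ℝ × Ω, ‖H (l + 1) 0 z.1 z.2‖ₑ ∂_ < ∞
      rw [lintegral_prod _ (hHm (l + 1) 0).enorm.aemeasurable]
      calc ∫⁻ s in Set.uIoc u v, ∫⁻ ω, ‖H (l + 1) 0 s ω‖ₑ ∂P
          ≤ ∫⁻ s in Set.uIoc u v, M (l + 1) :=
            setLIntegral_mono' measurableSet_uIoc fun s hs =>
              hnorm1 (l + 1) hl s (hmem u v hu hv s hs) 0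
        _ < ∞ := by
          rw [setLIntegral_const]
          exact ENNReal.mul_lt_top (hM (l + 1) hl) (by simp [Set.uIoc])
    rw [← intervalIntegral_integral_swap hprod]
    refine intervalIntegral.integral_congr fun s _ => ?_
    simp only [hcH (l + 1) 0 s]
  -- The radius r₁ serves only to identify the mean of order zero with φ. Summing over l gives one
  -- constant valid for every order.
  refine ⟨min r₀ r₁, (∑ l ∈ Finset.range (p + 1), ∑' k, d l k) ^ 2,
    fun l i t ω => H l ((i : ℤ) - 1) t ω - c l t, lt_min hr₀ hr₁, ?_, ?_, ?_⟩
  · refine ENNReal.pow_lt_top ?_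
    exact ENNReal.sum_lt_top.2 fun l hl => hd l (by rw [Finset.mem_range] at hl; omega)
  · intro I
    refine ⟨?_, ?_, ?_, ?_⟩
    · intro l i
      exact (hHm l _).sub ((hcm l).comp measurable_fst)
    · intro l hl i ω
      obtain ⟨C, hC⟩ := (isCompact_Icc (a := -r₀) (b := r₀)).exists_bound_of_continuousOn
        (hHcont l hl ((i : ℤ) - 1) ω).continuousOn
      refine ⟨C + (M l).toReal, fun s hs => ?_⟩
      have hs' : |s| ≤ r₀ := hs.trans (min_le_left _ _)
      exact (abs_sub _ _).trans (add_le_add (hC s (Set.mem_Icc.2 (abs_le.1 hs'))) (hcb l hl s hs'))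
    · intro l hl i ω u v hu hv
      have hu' := hu.trans (min_le_left _ _)
      have hv' := hv.trans (min_le_left _ _)
      rw [intervalIntegral.integral_sub ((hHcont (l + 1) hl _ ω).intervalIntegrable u v)
        (hcint (l + 1) hl u v hu' hv'), ← hHftc l hl, ← hcftc l hl u v hu' hv']
      ring
    · intro l hl w t ht
      have ht' : ∀ i ∈ I, |t i| ≤ r₀ := fun i hi => (ht i hi).trans (min_le_left _ _)
      have hτ : StrictMono fun i : ℕ => (i : ℤ) - 1 := fun a b hab => by simpa using hab
      have hmain := hm.eLpNorm_sum_le I hτ w (f := fun i => D l (t i)) (fun i => hDmr l (t i))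
        (fun i hi => hL l hl (t i) (ht' i hi) _) (r := d l)
        (fun i hi k => hdb l hl (t i) (ht' i hi) k)
      have hae : (fun ω => ∑ i ∈ I, w i * (H l ((i : ℤ) - 1) (t i) ω - c l (t i)))
          =ᵐ[P] fun ω => ∑ i ∈ I, w i * (D l (t i) (past ε ((i : ℤ) - 1) ω)
            - ∫ ω', D l (t i) (past ε ((i : ℤ) - 1) ω') ∂P) := by
        have := (ae_ball_iff (I.countable_toSet)).2 fun i _ => hHae l ((i : ℤ) - 1) (t i)
        filter_upwards [this] with ω hω
        refine Finset.sum_congr rfl fun i hi => ?_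
        rw [hω i hi, hm.integral_past (hDmr l (t i))]
      have h2 := eLpNorm_two_sq (P := P)
        (fun ω => ∑ i ∈ I, w i * (H l ((i : ℤ) - 1) (t i) ω - c l (t i)))
      rw [← h2, eLpNorm_congr_ae hae]
      calc _ ≤ ((∑' k, d l k) * ENNReal.ofReal √(∑ i ∈ I, w i ^ 2)) ^ 2 := by gcongr
        _ = (∑' k, d l k) ^ 2 * ∑ i ∈ I, ENNReal.ofReal (w i ^ 2) := by
          rw [mul_pow, ← ENNReal.ofReal_pow (Real.sqrt_nonneg _),
            Real.sq_sqrt (Finset.sum_nonneg fun i _ => sq_nonneg _),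
            ENNReal.ofReal_sum_of_nonneg fun i _ => sq_nonneg _]
        _ ≤ _ := by
          gcongr
          exact Finset.single_le_sum (f := fun l => ∑' k, d l k) (fun _ _ => zero_le)
            (Finset.mem_range.2 (by omega))
  · intro i
    filter_upwards [hA ((i : ℤ) - 1)] with ω hω t ht
    simp only [H, Set.indicator_of_mem hω]
    have h1 : c 0 t = phi P ε G ψ t :=
      integral_oneStep hm hψ ((hint t (ht.trans (min_le_right _ _))).integrable one_le_two)
    rw [h1]
    rfl

end Predicted

end MEstimation

namespace MEstimation

/-! ### Dyadic maximal inequality and Borel–Cantelli -/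

section Dyadic

variable {Ω : Type*} [MeasurableSpace Ω] {P : Measure Ω}

theorem sum_range_sum_Ioc_mul {M : Type*} [AddCommMonoid M] (v : ℕ → M) (c k : ℕ) :
    ∑ m ∈ Finset.range k, ∑ i ∈ Finset.Ioc (c * m) (c * (m + 1)), v i
      = ∑ i ∈ Finset.Ioc 0 (c * k), v i := by
  induction k with
  | zero => simp
  | succ k ih =>
    rw [Finset.sum_range_succ, ih]
    exact Finset.sum_Ioc_consecutive v (Nat.zero_le _) (Nat.mul_le_mul_left c k.le_succ)

/-- A Rademacher–Menshov type inequality: block bounds give a bound for all partial sums up to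
`2 ^ d` at the price of the factor `(d + 1) ^ 2`. -/
theorem exists_dyadic_max_bound {ι : Type*} (d : ℕ) (F : ℕ → ι → Ω → ℝ) (v : ℕ → ℝ≥0∞)
    (h : ∀ a b : ℕ, a ≤ b → b ≤ 2 ^ d → ∃ R : Ω → ℝ≥0∞, Measurable R ∧
      (∀ ω β, ‖F b β ω - F a β ω‖ₑ ≤ R ω) ∧
      ∫⁻ ω, R ω ^ 2 ∂P ≤ ∑ i ∈ Finset.Ioc a b, v i) :
    ∃ R : Ω → ℝ≥0∞, Measurable R ∧
      (∀ ω, ∀ n ≤ 2 ^ d, ∀ β, ‖F n β ω - F 0 β ω‖ₑ ≤ R ω) ∧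
      ∫⁻ ω, R ω ^ 2 ∂P ≤ ((d : ℝ≥0∞) + 1) ^ 2 * ∑ i ∈ Finset.Ioc 0 (2 ^ d), v i := by
  choose! R hRm hRb hRs using h
  -- The sum of squares over all blocks of level r dominates the square of any one of them, and its
  -- expectation is additive over the blocks.
  let Q : ℕ → Ω → ℝ≥0∞ := fun r ω =>
    ∑ m ∈ Finset.range (2 ^ (d - r)), R (2 ^ r * m) (2 ^ r * (m + 1)) ω ^ 2
  have hle : ∀ r ≤ d, ∀ m < 2 ^ (d - r), 2 ^ r * m ≤ 2 ^ r * (m + 1) ∧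
      2 ^ r * (m + 1) ≤ 2 ^ d := by
    intro r hr m hm
    refine ⟨Nat.mul_le_mul_left _ m.le_succ, ?_⟩
    calc 2 ^ r * (m + 1) ≤ 2 ^ r * 2 ^ (d - r) := Nat.mul_le_mul_left _ hm
      _ = 2 ^ d := by rw [← pow_add]; congr 1; omega
  have hQm : ∀ r ≤ d, Measurable (Q r) := fun r hr =>
    Finset.measurable_sum _ fun m hm => by
      obtain ⟨h1, h2⟩ := hle r hr m (Finset.mem_range.1 hm)
      exact (hRm _ _ h1 h2).pow_const 2
  have hQs : ∀ r ≤ d, ∫⁻ ω, Q r ω ∂P ≤ ∑ i ∈ Finset.Ioc 0 (2 ^ d), v i := by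
    intro r hr
    rw [lintegral_finsetSum' _ fun m hm => ?_]
    · calc _ ≤ ∑ m ∈ Finset.range (2 ^ (d - r)),
            ∑ i ∈ Finset.Ioc (2 ^ r * m) (2 ^ r * (m + 1)), v i := by
            refine Finset.sum_le_sum fun m hm => ?_
            obtain ⟨h1, h2⟩ := hle r hr m (Finset.mem_range.1 hm)
            exact hRs _ _ h1 h2
        _ = _ := by
          rw [sum_range_sum_Ioc_mul, ← pow_add, Nat.add_sub_cancel' hr]
    · obtain ⟨h1, h2⟩ := hle r hr m (Finset.mem_range.1 hm)
      exact ((hRm _ _ h1 h2).pow_const 2).aemeasurable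
  refine ⟨fun ω => ∑ r ∈ Finset.range (d + 1), Q r ω ^ (1 / 2 : ℝ),
    Finset.measurable_sum _ fun r hr => (hQm r (by rw [Finset.mem_range] at hr; omega)).pow_const _,
    ?_, ?_⟩
  · intro ω n hn β
    -- Binary expansion of n: rounding down to multiples of 2^r and of 2^(r+1) differs by at most
    -- one block of length 2^r, present exactly when the binary digit is 1. Cauchy–Schwarz over the
    -- d + 1 levels gives one factor d + 1, and summing the levels gives the other.
    have htel : F n β ω - F 0 β ω = ∑ r ∈ Finset.range (d + 1),
        (F (2 ^ r * (n / 2 ^ r)) β ω - F (2 ^ (r + 1) * (n / 2 ^ (r + 1))) β ω) := by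
      rw [Finset.sum_range_sub' (fun r => F (2 ^ r * (n / 2 ^ r)) β ω)]
      have h0 : n / 2 ^ (d + 1) = 0 :=
        Nat.div_eq_of_lt (hn.trans_lt (Nat.pow_lt_pow_right one_lt_two d.lt_succ_self))
      simp [h0]
    rw [htel]
    refine (enorm_sum_le _ _).trans (Finset.sum_le_sum fun r hr => ?_)
    have hrd : r ≤ d := by rw [Finset.mem_range] at hr; omega
    set k := n / 2 ^ (r + 1) with hk
    have hdiv : n / 2 ^ r / 2 = k := by rw [hk, pow_succ, Nat.div_div_eq_div_mul]
    have h2 : 2 ^ (r + 1) * k = 2 ^ r * (2 * k) := by rw [pow_succ]; ring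
    rcases Nat.mod_two_eq_zero_or_one (n / 2 ^ r) with h0 | h1
    · have : n / 2 ^ r = 2 * k := by omega
      rw [this, h2, sub_self]; simp
    · have h3 : n / 2 ^ r = 2 * k + 1 := by omega
      have hlt : 2 * k < 2 ^ (d - r) := by
        have h4 : n / 2 ^ r ≤ 2 ^ d / 2 ^ r := Nat.div_le_div_right hn
        rw [Nat.pow_div hrd two_pos] at h4
        omega
      obtain ⟨h5, h6⟩ := hle r hrd _ hlt
      rw [h3, h2]
      refine (hRb _ _ h5 h6 ω β).trans ?_
      rw [← ENNReal.rpow_le_rpow_iff (z := 2) two_pos, ← ENNReal.rpow_mul]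
      norm_num
      exact Finset.single_le_sum (f := fun m => R (2 ^ r * m) (2 ^ r * (m + 1)) ω ^ 2)
        (fun _ _ => zero_le) (Finset.mem_range.2 hlt)
  · calc ∫⁻ ω, (∑ r ∈ Finset.range (d + 1), Q r ω ^ (1 / 2 : ℝ)) ^ 2 ∂P
        ≤ ∫⁻ ω, ((d : ℝ≥0∞) + 1) * ∑ r ∈ Finset.range (d + 1), Q r ω ∂P := by
          refine lintegral_mono fun ω => (ENNReal_sum_sq_le _ _).trans_eq ?_
          rw [Finset.card_range]
          push_cast
          congr 1
          refine Finset.sum_congr rfl fun r _ => ?_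
          rw [← ENNReal.rpow_natCast, ← ENNReal.rpow_mul]
          norm_num
      _ = ((d : ℝ≥0∞) + 1) * ∑ r ∈ Finset.range (d + 1), ∫⁻ ω, Q r ω ∂P := by
          rw [lintegral_const_mul' _ _ (by simp), lintegral_finsetSum' _ fun r hr =>
            (hQm r (by rw [Finset.mem_range] at hr; omega)).aemeasurable]
      _ ≤ ((d : ℝ≥0∞) + 1) * ∑ r ∈ Finset.range (d + 1), ∑ i ∈ Finset.Ioc 0 (2 ^ d), v i := by
          gcongr with r hr
          exact hQs r (by rw [Finset.mem_range] at hr; omega)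
      _ = _ := by
          rw [Finset.sum_const, Finset.card_range, nsmul_eq_mul]
          push_cast
          ring

theorem ae_eventually_notMem_of_le {E : ℕ → Set Ω} {s : ℕ → ℝ} (hs0 : ∀ d, 0 ≤ s d)
    (hs : Summable s) (h : ∀ᶠ d in atTop, P (E d) ≤ ENNReal.ofReal (s d)) :
    ∀ᵐ ω ∂P, ∀ᶠ d in atTop, ω ∉ E d := by
  obtain ⟨d₀, hd₀⟩ := eventually_atTop.1 h
  have h1 : ∑' d, P (E (d + d₀)) ≠ ∞ := by
    refine ne_top_of_le_ne_top ?_ (ENNReal.tsum_le_tsum fun d => hd₀ (d + d₀) (by omega))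
    rw [← ENNReal.ofReal_tsum_of_nonneg (fun d => hs0 _) ((summable_nat_add_iff d₀).2 hs)]
    exact ENNReal.ofReal_ne_top
  filter_upwards [ae_eventually_notMem h1] with ω hω
  obtain ⟨d₁, hd₁⟩ := eventually_atTop.1 hω
  filter_upwards [eventually_ge_atTop (d₁ + d₀)] with d hd
  have := hd₁ (d - d₀) (by omega)
  rwa [Nat.sub_add_cancel (by omega)] at this

theorem measure_lt_le_of_lintegral_sq {R : Ω → ℝ≥0∞} (hR : Measurable R) {K T s : ℝ}
    (hT : 0 < T) (hK : ∫⁻ ω, R ω ^ 2 ∂P ≤ ENNReal.ofReal K) (hs : K ≤ s * T ^ 2) :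
    P {ω | ENNReal.ofReal T < R ω} ≤ ENNReal.ofReal s := by
  have hT2 : ENNReal.ofReal (T ^ 2) ≠ 0 := by
    simp only [ne_eq, ENNReal.ofReal_eq_zero, not_le]; positivity
  calc P {ω | ENNReal.ofReal T < R ω} ≤ P {ω | ENNReal.ofReal (T ^ 2) ≤ R ω ^ 2} := by
        refine measure_mono fun ω hω => ?_
        simp only [mem_ofPred_eq] at hω ⊢
        rw [ENNReal.ofReal_pow hT.le]
        gcongr
    _ ≤ (∫⁻ ω, R ω ^ 2 ∂P) / ENNReal.ofReal (T ^ 2) :=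
        meas_ge_le_lintegral_div (hR.pow_const 2).aemeasurable hT2 ENNReal.ofReal_ne_top
    _ ≤ ENNReal.ofReal (s * T ^ 2) / ENNReal.ofReal (T ^ 2) := by
        gcongr
        exact hK.trans (ENNReal.ofReal_le_ofReal hs)
    _ = ENNReal.ofReal s := by
        rw [ENNReal.ofReal_mul' (by positivity)]
        exact ENNReal.mul_div_cancel_right hT2 ENNReal.ofReal_ne_top

/-- Cauchy condensation turns this into the series of k^{-(1+ι)}. The shift by 2 keeps the logarithm
positive from the first term on. -/
theorem summable_inv_mul_log_rpow {ι : ℝ} (hι : 0 < ι) :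
    Summable fun n : ℕ => ((n : ℝ) * Real.log (n + 2) ^ (1 + ι))⁻¹ := by
  have hlog : ∀ n : ℕ, 0 < Real.log ((n : ℝ) + 2) := fun n =>
    Real.log_pos (by have : (0 : ℝ) ≤ n := n.cast_nonneg; linarith)
  rw [← summable_condensed_iff_of_nonneg]
  · have hs : Summable fun k : ℕ => (Real.log 2 ^ (1 + ι))⁻¹ * ((k : ℝ) ^ (1 + ι))⁻¹ :=
      (Real.summable_nat_rpow_inv.2 (by linarith)).mul_left _
    rw [← summable_nat_add_iff 1] at hs ⊢
    refine Summable.of_nonneg_of_le (fun k => ?_) (fun k => ?_) hs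
    · have := hlog (2 ^ (k + 1)); positivity
    · have hl2 : 0 < Real.log 2 := Real.log_pos one_lt_two
      have h1 : Real.log 2 * ((k + 1 : ℕ) : ℝ) ≤ Real.log (((2 ^ (k + 1) : ℕ) : ℝ) + 2) := by
        rw [mul_comm, ← Real.log_pow]
        refine Real.log_le_log (by positivity) ?_
        push_cast; linarith
      rw [mul_inv, ← mul_assoc]
      have h2 : (2 : ℝ) ^ (k + 1) * (((2 ^ (k + 1) : ℕ) : ℝ))⁻¹ = 1 := by
        push_cast; exact mul_inv_cancel₀ (by positivity)
      rw [h2, one_mul, ← mul_inv, ← Real.mul_rpow hl2.le (by positivity)]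
      gcongr
  · intro n; have := hlog n; positivity
  · intro m n hm hmn
    have := hlog m
    have hm' : (0 : ℝ) < m := by exact_mod_cast hm
    gcongr

/-- The ratios produced by the dyadic maximal inequality are summable. -/
theorem summable_dyadic_ratio {ι : ℝ} (hι : 0 < ι) :
    ∃ s : ℕ → ℝ, (∀ d, 0 ≤ s d) ∧ Summable s ∧ ∀ᶠ d : ℕ in atTop,
      ((d : ℝ) + 1) ^ 2 ≤ s d * (Real.log ((2 ^ d : ℕ) : ℝ) ^ (3 : ℝ)
        * Real.log (Real.log ((2 ^ d : ℕ) : ℝ)) ^ (1 + ι)) := by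
  have hl2 : 0 < Real.log 2 := Real.log_pos one_lt_two
  have hl2' : 0.69 < Real.log 2 := lt_trans (by norm_num) Real.log_two_gt_d9
  -- Here 4 comes from (d + 1)² ≤ 4 d², the cube from log(2^d) = d log 2, and 2^(1+ι) from log(d +
  -- 2) ≤ 2 log(d log 2), which holds for d ≥ 5.
  refine ⟨fun d => (4 / Real.log 2 ^ (3 : ℕ) * 2 ^ (1 + ι)) *
    ((d : ℝ) * Real.log (d + 2) ^ (1 + ι))⁻¹, fun d => ?_,
    (summable_inv_mul_log_rpow hι).mul_left _, ?_⟩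
  · have : 0 < Real.log ((d : ℝ) + 2) :=
      Real.log_pos (by have : (0 : ℝ) ≤ d := d.cast_nonneg; linarith)
    positivity
  · filter_upwards [eventually_ge_atTop 5] with d hd
    have hd5 : (5 : ℝ) ≤ d := by exact_mod_cast hd
    have hlog : Real.log ((2 ^ d : ℕ) : ℝ) = d * Real.log 2 := by push_cast; rw [Real.log_pow]
    rw [hlog, Real.rpow_ofNat]
    have hpos : 0 < Real.log ((d : ℝ) + 2) := Real.log_pos (by linarith)
    have h1 : Real.log ((d : ℝ) + 2) ≤ 2 * Real.log (d * Real.log 2) := by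
      have : 2 * Real.log (d * Real.log 2) = Real.log ((d * Real.log 2) ^ 2) := by
        rw [Real.log_pow]; norm_num
      rw [this]
      refine Real.log_le_log (by linarith) ?_
      have : 0.69 * (d : ℝ) ≤ d * Real.log 2 := by nlinarith
      nlinarith
    have h2 : Real.log ((d : ℝ) + 2) ^ (1 + ι) ≤ 2 ^ (1 + ι) * Real.log (d * Real.log 2) ^ (1 + ι) := by
      rw [← Real.mul_rpow two_pos.le (by linarith)]
      exact Real.rpow_le_rpow hpos.le h1 (by linarith)
    have hL : 0 < Real.log ((d : ℝ) + 2) ^ (1 + ι) := Real.rpow_pos_of_pos hpos _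
    set L := Real.log ((d : ℝ) + 2) ^ (1 + ι)
    set L' := Real.log (d * Real.log 2) ^ (1 + ι)
    have h3 : (4 / Real.log 2 ^ (3 : ℕ) * 2 ^ (1 + ι)) * ((d : ℝ) * L)⁻¹ *
        ((d * Real.log 2) ^ (3 : ℕ) * L') = 4 * d ^ 2 * (2 ^ (1 + ι) * L' / L) := by
      field_simp
    rw [h3]
    have h4 : 1 ≤ 2 ^ (1 + ι) * L' / L := (one_le_div hL).2 h2
    nlinarith

end Dyadic

end MEstimation

namespace MEstimation

/-! ### The design -/

section Design

variable {p : ℕ}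

theorem sum_fin_shift {M : Type*} [AddCommMonoid M] (n : ℕ) (f : ℕ → M) :
    ∑ i : Fin n, f ((i : ℕ) + 1) = ∑ i ∈ Finset.Icc 1 n, f i := by
  rw [Fin.sum_univ_eq_sum_range (fun i => f (i + 1)), Finset.range_eq_Ico, Finset.sum_Ico_add']
  rfl

theorem toEuclideanLin_gramMatrix (x : ℕ → EuclideanSpace ℝ (Fin p)) (n : ℕ)
    (v : EuclideanSpace ℝ (Fin p)) :
    Matrix.toEuclideanLin (gramMatrix x n) v = ∑ i ∈ Finset.Icc 1 n, inner ℝ (x i) v • x i := by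
  ext k
  rw [Matrix.toLpLin_apply, ← sum_fin_shift]
  simp [gramMatrix, designMatrix, Matrix.mulVec, Matrix.mul_apply, dotProduct, Finset.sum_mul,
    PiLp.inner_apply]
  rw [Finset.sum_comm]
  simp only [mul_comm, mul_left_comm]

/-- The Rayleigh quotient, read off in an orthonormal eigenbasis. -/
theorem minEigenvalue_mul_le (x : ℕ → EuclideanSpace ℝ (Fin p)) (n : ℕ)
    (v : EuclideanSpace ℝ (Fin p)) :
    minEigenvalue x n * ‖v‖ ^ 2 ≤ ∑ i ∈ Finset.Icc 1 n, inner ℝ (x i) v ^ 2 := by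
  set hA := gramMatrix_isHermitian x n
  set b := hA.eigenvectorBasis
  have hsymm : ∀ u w : EuclideanSpace ℝ (Fin p),
      inner ℝ u (Matrix.toEuclideanLin (gramMatrix x n) w)
        = ∑ i ∈ Finset.Icc 1 n, inner ℝ (x i) u * inner ℝ (x i) w := by
    intro u w
    rw [toEuclideanLin_gramMatrix, inner_sum]
    refine Finset.sum_congr rfl fun i _ => ?_
    rw [real_inner_smul_right, real_inner_comm (x i) u, mul_comm]
  have heig : ∀ j, inner ℝ (b j) (Matrix.toEuclideanLin (gramMatrix x n) v)
      = hA.eigenvalues j * inner ℝ (b j) v := by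
    intro j
    have h1 : Matrix.toEuclideanLin (gramMatrix x n) (b j) = hA.eigenvalues j • b j := by
      rw [Matrix.toLpLin_apply, hA.mulVec_eigenvectorBasis j]
      rfl
    have h2 := hsymm v (b j)
    rw [h1, real_inner_smul_right, real_inner_comm] at h2
    rw [h2, hsymm]
    exact Finset.sum_congr rfl fun i _ => mul_comm _ _
  have hq : ∑ i ∈ Finset.Icc 1 n, inner ℝ (x i) v ^ 2
      = ∑ j, hA.eigenvalues j * inner ℝ (b j) v ^ 2 := by
    have h := hsymm v v
    rw [← b.sum_inner_mul_inner] at h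
    simp_rw [sq, ← h]
    refine Finset.sum_congr rfl fun j _ => ?_
    rw [heig, real_inner_comm v (b j)]; ring
  have hn : ‖v‖ ^ 2 = ∑ j, inner ℝ (b j) v ^ 2 := by
    rw [← real_inner_self_eq_norm_sq, ← b.sum_inner_mul_inner]
    exact Finset.sum_congr rfl fun j _ => by rw [real_inner_comm v (b j), sq]
  rw [hq, hn, Finset.mul_sum]
  refine Finset.sum_le_sum fun j _ => ?_
  gcongr
  exact ciInf_le (Set.finite_range _).bddBelow j

theorem norm_le_rTilde (x : ℕ → EuclideanSpace ℝ (Fin p)) {n i : ℕ} (hi : i ∈ Finset.Icc 1 n) :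
    ‖x i‖ ≤ rTilde x n := by
  have : ‖x i‖₊ ≤ (Finset.Icc 1 n).sup fun j => ‖x j‖₊ := Finset.le_sup (f := fun j => ‖x j‖₊) hi
  exact_mod_cast this

theorem rTilde_nonneg (x : ℕ → EuclideanSpace ℝ (Fin p)) (n : ℕ) : 0 ≤ rTilde x n :=
  NNReal.coe_nonneg _

theorem xi_nonneg (x : ℕ → EuclideanSpace ℝ (Fin p)) (n : ℕ) (r : ℝ) : 0 ≤ xi x n r :=
  Finset.sum_nonneg fun _ _ => by positivity

theorem xi_two (x : ℕ → EuclideanSpace ℝ (Fin p)) (n : ℕ) :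
    xi x n 2 = ∑ i ∈ Finset.Icc 1 n, ‖x i‖ ^ 2 :=
  Finset.sum_congr rfl fun _ _ => Real.rpow_ofNat _ _

theorem xi_three (x : ℕ → EuclideanSpace ℝ (Fin p)) (n : ℕ) :
    xi x n 3 = ∑ i ∈ Finset.Icc 1 n, ‖x i‖ ^ 3 :=
  Finset.sum_congr rfl fun _ _ => Real.rpow_ofNat _ _

theorem xi_four (x : ℕ → EuclideanSpace ℝ (Fin p)) (n : ℕ) :
    xi x n 4 = ∑ i ∈ Finset.Icc 1 n, ‖x i‖ ^ 4 :=
  Finset.sum_congr rfl fun _ _ => Real.rpow_ofNat _ _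

theorem xi_four_le (x : ℕ → EuclideanSpace ℝ (Fin p)) (n : ℕ) :
    xi x n 4 ≤ rTilde x n ^ 2 * xi x n 2 := by
  rw [xi_four, xi_two, Finset.mul_sum]
  refine Finset.sum_le_sum fun i hi => ?_
  calc ‖x i‖ ^ 4 = ‖x i‖ ^ 2 * ‖x i‖ ^ 2 := by ring
    _ ≤ _ := by gcongr; exact norm_le_rTilde x hi

/-- Cauchy–Schwarz; together with the lower bound on ξ_n(2) it shows that ξ_n(4) grows at least
linearly. -/
theorem xi_two_sq_le (x : ℕ → EuclideanSpace ℝ (Fin p)) (n : ℕ) :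
    xi x n 2 ^ 2 ≤ n * xi x n 4 := by
  rw [xi_four, xi_two]
  have h := sq_sum_le_card_mul_sum_sq (s := Finset.Icc 1 n) (f := fun i => ‖x i‖ ^ 2)
  simp only [Nat.card_Icc, Nat.add_sub_cancel] at h
  refine h.trans_eq ?_
  congr 1
  exact Finset.sum_congr rfl fun i _ => by ring

theorem exists_pos_mul_le_minEigenvalue {x : ℕ → EuclideanSpace ℝ (Fin p)}
    (hlam : 0 < liminf (fun n : ℕ => minEigenvalue x n / (n : ℝ)) atTop) :
    ∃ c : ℝ, 0 < c ∧ ∀ᶠ n : ℕ in atTop, c * n ≤ minEigenvalue x n := by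
  rw [Filter.liminf_eq] at hlam
  have hne : {a : ℝ | ∀ᶠ n : ℕ in atTop, a ≤ minEigenvalue x n / (n : ℝ)}.Nonempty := by
    -- The real liminf is a supremum of eventual lower bounds, and the supremum of the empty set is
    -- 0 by convention, so positivity forces the set to be nonempty.
    by_contra h
    rw [Set.not_nonempty_iff_eq_empty] at h
    rw [h, Real.sSup_empty] at hlam
    exact lt_irrefl _ hlam
  obtain ⟨c, hc, hc0⟩ := exists_lt_of_lt_csSup hne hlam
  refine ⟨c, hc0, ?_⟩
  filter_upwards [hc, eventually_gt_atTop 0] with n hn hn0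
  have : (0 : ℝ) < n := by exact_mod_cast hn0
  exact (le_div_iff₀ this).1 hn

/-- In dimension zero the minimum eigenvalue is an infimum over an empty index set, hence 0 by
convention. -/
theorem pos_dim_of_liminf_pos {x : ℕ → EuclideanSpace ℝ (Fin p)}
    (hlam : 0 < liminf (fun n : ℕ => minEigenvalue x n / (n : ℝ)) atTop) : 0 < p := by
  rcases Nat.eq_zero_or_pos p with rfl | h
  · simp [minEigenvalue] at hlam
  · exact h

theorem exists_pos_mul_le_xi_two {x : ℕ → EuclideanSpace ℝ (Fin p)}
    (hlam : 0 < liminf (fun n : ℕ => minEigenvalue x n / (n : ℝ)) atTop) :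
    ∃ c : ℝ, 0 < c ∧ ∀ᶠ n : ℕ in atTop, c * n ≤ xi x n 2 := by
  obtain ⟨c, hc, h⟩ := exists_pos_mul_le_minEigenvalue hlam
  refine ⟨c, hc, ?_⟩
  filter_upwards [h] with n hn
  have hp := pos_dim_of_liminf_pos hlam
  have h1 := minEigenvalue_mul_le x n (EuclideanSpace.single (⟨0, hp⟩ : Fin p) (1 : ℝ))
  rw [PiLp.norm_single, norm_one, one_pow, mul_one] at h1
  refine hn.trans (h1.trans ?_)
  rw [xi_two]
  refine Finset.sum_le_sum fun i _ => ?_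
  have := abs_real_inner_le_norm (x i) (EuclideanSpace.single (⟨0, hp⟩ : Fin p) (1 : ℝ))
  rw [PiLp.norm_single, norm_one, mul_one] at this
  rw [← sq_abs]
  gcongr

end Design

/-! ### Rates -/

section Rates

/-- `n ^ a (log n) ^ b (log log n) ^ s`. -/
noncomputable def logRate (a b s : ℝ) (n : ℕ) : ℝ :=
  (n : ℝ) ^ a * Real.log n ^ b * Real.log (Real.log n) ^ s

theorem tendsto_log_natCast : Tendsto (fun n : ℕ => Real.log n) atTop atTop :=
  Real.tendsto_log_atTop.comp tendsto_natCast_atTop_atTop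

theorem tendsto_log_log_natCast : Tendsto (fun n : ℕ => Real.log (Real.log n)) atTop atTop :=
  Real.tendsto_log_atTop.comp tendsto_log_natCast

theorem eventually_logs_pos : ∀ᶠ n : ℕ in atTop,
    (0 : ℝ) < n ∧ 0 < Real.log n ∧ 0 < Real.log (Real.log n) := by
  filter_upwards [eventually_gt_atTop 0, tendsto_log_natCast.eventually_gt_atTop 0,
    tendsto_log_log_natCast.eventually_gt_atTop 0] with n h1 h2 h3
  exact ⟨by exact_mod_cast h1, h2, h3⟩

theorem eventually_logRate_pos (a b s : ℝ) : ∀ᶠ n : ℕ in atTop, 0 < logRate a b s n := by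
  filter_upwards [eventually_logs_pos] with n ⟨h1, h2, h3⟩
  unfold logRate; positivity

theorem logRate_mul (a b s a' b' s' : ℝ) :
    (fun n => logRate a b s n * logRate a' b' s' n)
      =ᶠ[atTop] logRate (a + a') (b + b') (s + s') := by
  filter_upwards [eventually_logs_pos] with n ⟨h1, h2, h3⟩
  unfold logRate
  rw [Real.rpow_add h1, Real.rpow_add h2, Real.rpow_add h3]; ring

theorem logRate_sqrt (a b s : ℝ) :
    (fun n => √(logRate a b s n)) =ᶠ[atTop] logRate (a / 2) (b / 2) (s / 2) := by
  filter_upwards [eventually_logs_pos] with n ⟨h1, h2, h3⟩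
  unfold logRate
  rw [Real.sqrt_eq_rpow, Real.mul_rpow (by positivity) (by positivity),
    Real.mul_rpow (by positivity) (by positivity), ← Real.rpow_mul h1.le, ← Real.rpow_mul h2.le,
    ← Real.rpow_mul h3.le]
  congr 1
  · congr 1 <;> ring_nf
  · ring_nf

theorem logRate_isLittleO {a b b' s s' : ℝ} (h : b < b') :
    logRate a b s =o[atTop] logRate a b' s' := by
  have h1 : (fun n : ℕ => Real.log (Real.log n) ^ (s - s'))
      =o[atTop] fun n : ℕ => Real.log n ^ (b' - b) :=
    (isLittleO_log_rpow_rpow_atTop (s - s') (sub_pos.2 h)).comp_tendsto tendsto_log_natCast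
  have h2 := (isBigO_refl (logRate a b s') atTop).mul_isLittleO h1
  refine h2.congr' ?_ ?_
  · filter_upwards [eventually_logs_pos] with n ⟨h1, h2, h3⟩
    unfold logRate
    rw [mul_assoc, ← Real.rpow_add h3]; congr 2; ring
  · filter_upwards [eventually_logs_pos] with n ⟨h1, h2, h3⟩
    unfold logRate
    have : Real.log n ^ b' = Real.log n ^ b * Real.log n ^ (b' - b) := by
      rw [← Real.rpow_add h2]; congr 1; ring
    rw [this]; ring

theorem logRate_isLittleO_last {a b s s' : ℝ} (h : s < s') :
    logRate a b s =o[atTop] logRate a b s' := by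
  have h0 : Tendsto (fun n : ℕ => Real.log (Real.log n) ^ (-(s' - s))) atTop (𝓝 0) :=
    (tendsto_rpow_neg_atTop (sub_pos.2 h)).comp tendsto_log_log_natCast
  have h1 := (isLittleO_one_iff ℝ).2 h0
  have h2 := (isBigO_refl (logRate a b s') atTop).mul_isLittleO h1
  refine h2.congr' ?_ (Eventually.of_forall fun n => mul_one _)
  filter_upwards [eventually_logs_pos] with n ⟨h1, h2, h3⟩
  unfold logRate
  rw [mul_assoc, ← Real.rpow_add h3]; congr 2; ring

theorem logRate_zero : logRate 0 0 0 = fun _ => 1 := by funext n; simp [logRate]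

theorem bSeq_eq_logRate (ι : ℝ) : bSeq ι = logRate (-(1 / 2)) (3 / 2) (1 / 2 + ι) := rfl

theorem natCast_eq_logRate : (fun n : ℕ => (n : ℝ)) = logRate 1 0 0 := by
  funext n; simp [logRate]

theorem isBigO_sqrt {f g : ℕ → ℝ} (h : f =O[atTop] g)
    (hg : ∀ᶠ n in atTop, 0 ≤ g n) :
    (fun n => √(f n)) =O[atTop] fun n => √(g n) := by
  simp_rw [Real.sqrt_eq_rpow]
  exact h.rpow (by norm_num) hg

variable {p : ℕ} {x : ℕ → EuclideanSpace ℝ (Fin p)} {ι : ℝ}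

theorem rTilde_isBigO_logRate (hr : (fun n : ℕ => rTilde x n) =O[atTop]
      fun n : ℕ => (n : ℝ) ^ (1 / 2 : ℝ) * Real.log n ^ (-2 : ℝ)) :
    rTilde x =O[atTop] logRate (1 / 2) (-2) 0 := by
  refine hr.congr_right fun n => ?_
  simp [logRate]

theorem rTilde_mul_bSeq_isBigO (hr : (fun n : ℕ => rTilde x n) =O[atTop]
      fun n : ℕ => (n : ℝ) ^ (1 / 2 : ℝ) * Real.log n ^ (-2 : ℝ)) :
    (fun n => rTilde x n * bSeq ι n) =O[atTop] logRate 0 (-(1 / 2)) (1 / 2 + ι) := by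
  have h := (rTilde_isBigO_logRate hr).mul (isBigO_refl (bSeq ι) atTop)
  refine h.trans_eventuallyEq ?_
  rw [bSeq_eq_logRate]
  refine (logRate_mul _ _ _ _ _ _).trans (Eventually.of_forall fun n => ?_)
  norm_num

theorem tendsto_rTilde_mul_bSeq (hr : (fun n : ℕ => rTilde x n) =O[atTop]
      fun n : ℕ => (n : ℝ) ^ (1 / 2 : ℝ) * Real.log n ^ (-2 : ℝ)) :
    Tendsto (fun n => rTilde x n * bSeq ι n) atTop (𝓝 0) := by
  rw [← isLittleO_one_iff ℝ, ← logRate_zero]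
  exact (rTilde_mul_bSeq_isBigO hr).trans_isLittleO (logRate_isLittleO (by norm_num))

theorem BSeq_eq (n : ℕ) :
    BSeq x ι n = bSeq ι n * √(xi x n 4) * logRate 0 (3 / 2) ((1 + ι) / 2) n := by
  simp [BSeq, logRate, mul_assoc]

/-- As ξ_n(4) is at least of order n, B_n is at least of order (log n)³ up to iterated logarithms.
Its use is to absorb additive constants into the rate. -/
theorem one_isLittleO_BSeq
    (hlam : 0 < liminf (fun n : ℕ => minEigenvalue x n / (n : ℝ)) atTop) :
    (fun _ => (1 : ℝ)) =o[atTop] BSeq x ι := by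
  obtain ⟨c, hc, h⟩ := exists_pos_mul_le_xi_two hlam
  have h1 : (logRate 1 0 0) =O[atTop] fun n => xi x n 4 := by
    rw [← natCast_eq_logRate]
    refine IsBigO.of_bound (c ^ 2)⁻¹ ?_
    filter_upwards [h, eventually_gt_atTop 0] with n hn hn0
    have hn0' : (0 : ℝ) < n := by exact_mod_cast hn0
    rw [Real.norm_of_nonneg hn0'.le, Real.norm_of_nonneg (xi_nonneg _ _ _), ← div_eq_inv_mul,
      le_div_iff₀ (by positivity)]
    have h2 := xi_two_sq_le x n
    have h3 : (c * n) ^ 2 ≤ xi x n 2 ^ 2 := by gcongr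
    have h4 : n * (n * c ^ 2) ≤ n * xi x n 4 := by nlinarith
    exact le_of_mul_le_mul_left h4 hn0'
  have h2 := isBigO_sqrt h1
    (Eventually.of_forall fun n => xi_nonneg _ _ _)
  have h3 := ((isBigO_refl (bSeq ι) atTop).mul h2).mul
    (isBigO_refl (logRate 0 (3 / 2) ((1 + ι) / 2)) atTop)
  have h4 : (fun n => bSeq ι n * √(logRate 1 0 0 n) * logRate 0 (3 / 2) ((1 + ι) / 2) n)
      =ᶠ[atTop] logRate 0 3 (1 + 3 / 2 * ι) := by
    have e1 := logRate_sqrt 1 0 0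
    have e2 := logRate_mul (-(1 / 2)) (3 / 2) (1 / 2 + ι) (1 / 2) (0 / 2) (0 / 2)
    have e3 := logRate_mul (-(1 / 2) + 1 / 2) (3 / 2 + 0 / 2) (1 / 2 + ι + 0 / 2) 0 (3 / 2)
      ((1 + ι) / 2)
    filter_upwards [e1, e2, e3] with n e1 e2 e3
    rw [bSeq_eq_logRate, e1, e2, e3]
    congr 1 <;> ring
  rw [← logRate_zero]
  refine (logRate_isLittleO (s' := 1 + 3 / 2 * ι) (show (0 : ℝ) < 3 by norm_num)).trans_isBigO ?_
  refine (h4.symm.trans_isBigO h3).congr_right fun n => (BSeq_eq n).symm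

/-- The scale `n b_n`. -/
theorem mul_bSeq_eventuallyEq :
    (fun n : ℕ => (n : ℝ) * bSeq ι n) =ᶠ[atTop] logRate (1 / 2) (3 / 2) (1 / 2 + ι) := by
  have h : (fun n : ℕ => (n : ℝ) * bSeq ι n) = fun n => logRate 1 0 0 n * bSeq ι n := by
    rw [← natCast_eq_logRate]
  rw [h, bSeq_eq_logRate]
  refine (logRate_mul _ _ _ _ _ _).trans (Eventually.of_forall fun n => ?_)
  norm_num

/-- From ξ_n(4) ≤ r̃_n² ξ_n(2) = O(n² (log n)^{-4}), B_n is at most n^{1/2} log n up to iterated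
logarithms. The comparison rate is n b_n, the size of the drift. -/
theorem BSeq_isLittleO (hxi : (fun n : ℕ => xi x n 2) =O[atTop] fun n : ℕ => (n : ℝ))
    (hr : (fun n : ℕ => rTilde x n) =O[atTop]
      fun n : ℕ => (n : ℝ) ^ (1 / 2 : ℝ) * Real.log n ^ (-2 : ℝ)) :
    BSeq x ι =o[atTop] logRate (1 / 2) (3 / 2) (1 / 2 + ι) := by
  have h1 : (fun n => xi x n 4) =O[atTop] logRate 2 (-4) 0 := by
    have h2 : (fun n => xi x n 4) =O[atTop] fun n => (rTilde x n * rTilde x n) * xi x n 2 := by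
      refine IsBigO.of_bound 1 (Eventually.of_forall fun n => ?_)
      rw [Real.norm_of_nonneg (xi_nonneg _ _ _), Real.norm_of_nonneg (mul_nonneg
        (mul_self_nonneg _) (xi_nonneg _ _ _)), one_mul, ← sq]
      exact xi_four_le x n
    have h3 := ((rTilde_isBigO_logRate hr).mul (rTilde_isBigO_logRate hr)).mul
      (natCast_eq_logRate ▸ hxi)
    refine (h2.trans h3).trans_eventuallyEq ?_
    filter_upwards [logRate_mul (1 / 2) (-2) 0 (1 / 2) (-2) 0,
      logRate_mul (1 / 2 + 1 / 2) (-2 + -2) (0 + 0) 1 0 0] with n e1 e2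
    rw [e1, e2]; norm_num
  have h2 := isBigO_sqrt h1
    ((eventually_logRate_pos _ _ _).mono fun _ h => h.le)
  have h3 := ((isBigO_refl (bSeq ι) atTop).mul h2).mul
    (isBigO_refl (logRate 0 (3 / 2) ((1 + ι) / 2)) atTop)
  have h4 : (fun n => bSeq ι n * √(logRate 2 (-4) 0 n) * logRate 0 (3 / 2) ((1 + ι) / 2) n)
      =ᶠ[atTop] logRate (1 / 2) 1 (1 + 3 / 2 * ι) := by
    filter_upwards [logRate_sqrt 2 (-4) 0,
      logRate_mul (-(1 / 2)) (3 / 2) (1 / 2 + ι) (2 / 2) (-4 / 2) (0 / 2),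
      logRate_mul (-(1 / 2) + 2 / 2) (3 / 2 + -4 / 2) (1 / 2 + ι + 0 / 2) 0 (3 / 2)
      ((1 + ι) / 2)] with n e1 e2 e3
    rw [bSeq_eq_logRate, e1, e2, e3]
    congr 1 <;> ring
  refine IsBigO.trans_isLittleO ?_ (logRate_isLittleO (b := 1) (s := 1 + 3 / 2 * ι) (by norm_num))
  exact (h3.trans_eventuallyEq h4).congr_left fun n => (BSeq_eq n).symm

theorem rTilde_isLittleO (hr : (fun n : ℕ => rTilde x n) =O[atTop]
      fun n : ℕ => (n : ℝ) ^ (1 / 2 : ℝ) * Real.log n ^ (-2 : ℝ)) :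
    rTilde x =o[atTop] logRate (1 / 2) (3 / 2) (1 / 2 + ι) :=
  (rTilde_isBigO_logRate hr).trans_isLittleO (logRate_isLittleO (by norm_num))

theorem le_nBar (n : ℕ) : n ≤ nBar n := by
  rcases Nat.eq_zero_or_pos n with rfl | hn
  · exact Nat.zero_le _
  have hl2 : 0 < Real.log 2 := Real.log_pos one_lt_two
  have h1 : Real.log n ≤ ⌈Real.log n / Real.log 2⌉₊ * Real.log 2 :=
    (div_le_iff₀ hl2).1 (Nat.le_ceil _)
  rw [← Real.log_pow, Real.log_le_log_iff (by exact_mod_cast hn) (by positivity)] at h1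
  unfold nBar
  exact_mod_cast h1

theorem nBar_le {n : ℕ} (hn : 1 ≤ n) : nBar n ≤ 2 * n := by
  have hl2 : 0 < Real.log 2 := Real.log_pos one_lt_two
  have hn' : (1 : ℝ) ≤ n := by exact_mod_cast hn
  have h1 : (⌈Real.log n / Real.log 2⌉₊ : ℝ) ≤ Real.log n / Real.log 2 + 1 :=
    (Nat.ceil_lt_add_one (div_nonneg (Real.log_nonneg hn') hl2.le)).le
  have h2 : (⌈Real.log n / Real.log 2⌉₊ : ℝ) * Real.log 2 ≤ Real.log (2 * n) := by
    rw [Real.log_mul two_ne_zero (by positivity)]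
    calc _ ≤ (Real.log n / Real.log 2 + 1) * Real.log 2 := by gcongr
      _ = _ := by field_simp; ring
  rw [← Real.log_pow, Real.log_le_log_iff (by positivity) (by positivity)] at h2
  unfold nBar
  exact_mod_cast h2

theorem tendsto_ceil_log : Tendsto (fun n : ℕ => ⌈Real.log n / Real.log 2⌉₊) atTop atTop :=
  tendsto_nat_ceil_atTop.comp
    (tendsto_log_natCast.atTop_div_const (Real.log_pos one_lt_two))

theorem tendsto_nBar : Tendsto nBar atTop atTop :=
  tendsto_atTop_mono le_nBar tendsto_id

/-- Along dyadic blocks `b_n` changes at most by the factor `√2`. -/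
theorem eventually_bSeq_le (hι : 0 < ι) : ∀ᶠ n : ℕ in atTop, bSeq ι n ≤ √2 * bSeq ι (nBar n) := by
  filter_upwards [eventually_logs_pos, eventually_ge_atTop 1] with n ⟨h1, h2, h3⟩ hn
  have hN : (n : ℝ) ≤ nBar n := by exact_mod_cast le_nBar n
  have hN2 : (nBar n : ℝ) ≤ 2 * n := by exact_mod_cast nBar_le hn
  have hN0 : (0 : ℝ) < nBar n := h1.trans_le hN
  have e1 : (n : ℝ) ^ (-(1 / 2) : ℝ) ≤ √2 * (nBar n : ℝ) ^ (-(1 / 2) : ℝ) := by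
    rw [Real.rpow_neg h1.le, Real.rpow_neg hN0.le, ← Real.sqrt_eq_rpow, ← Real.sqrt_eq_rpow,
      ← div_eq_mul_inv, inv_eq_one_div, div_le_div_iff₀ (by positivity) (by positivity), one_mul,
      ← Real.sqrt_mul two_pos.le]
    exact Real.sqrt_le_sqrt hN2
  have e2 : Real.log n ≤ Real.log (nBar n) := Real.log_le_log h1 hN
  have e3 : Real.log (Real.log n) ≤ Real.log (Real.log (nBar n)) := Real.log_le_log h2 e2
  unfold bSeq
  rw [← mul_assoc, ← mul_assoc]
  gcongr

/-- Once n ≥ 2 and log n ≥ 2, the bound n̄ ≤ 2n ≤ n² at most doubles the logarithm and the iterated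
logarithm. -/
theorem logRate_nBar_isBigO {a b s : ℝ} (ha : 0 ≤ a) (hb : 0 ≤ b) (hs : 0 ≤ s) :
    (fun n => logRate a b s (nBar n)) =O[atTop] logRate a b s := by
  refine IsBigO.of_bound (2 ^ a * 2 ^ b * 2 ^ s) ?_
  filter_upwards [eventually_logs_pos, eventually_ge_atTop 2,
    tendsto_log_natCast.eventually_ge_atTop 2] with n ⟨h1, h2, h3⟩ hn hl
  have hN : (n : ℝ) ≤ nBar n := by exact_mod_cast le_nBar n
  have hN2 : (nBar n : ℝ) ≤ 2 * n := by exact_mod_cast nBar_le (by omega)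
  have hN0 : (0 : ℝ) < nBar n := h1.trans_le hN
  have hn2 : (2 : ℝ) ≤ n := by exact_mod_cast hn
  have e2 : Real.log n ≤ Real.log (nBar n) := Real.log_le_log h1 hN
  have e3 : Real.log (Real.log n) ≤ Real.log (Real.log (nBar n)) := Real.log_le_log h2 e2
  have e4 : Real.log (nBar n) ≤ 2 * Real.log n := by
    have : 2 * Real.log n = Real.log ((n : ℝ) ^ 2) := by rw [Real.log_pow]; norm_num
    rw [this]
    exact Real.log_le_log hN0 (by nlinarith)
  have e5 : Real.log (Real.log (nBar n)) ≤ 2 * Real.log (Real.log n) := by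
    have : 2 * Real.log (Real.log n) = Real.log ((Real.log n) ^ 2) := by rw [Real.log_pow]; norm_num
    rw [this]
    exact Real.log_le_log (by linarith) (by nlinarith)
  have p2 : 0 < Real.log (nBar n) := h2.trans_le e2
  have p3 : 0 < Real.log (Real.log (nBar n)) := h3.trans_le e3
  unfold logRate
  rw [Real.norm_of_nonneg (by positivity), Real.norm_of_nonneg (by positivity)]
  calc _ ≤ (2 * n : ℝ) ^ a * (2 * Real.log n) ^ b * (2 * Real.log (Real.log n)) ^ s := by gcongr
    _ = _ := by
      rw [Real.mul_rpow two_pos.le h1.le, Real.mul_rpow two_pos.le h2.le,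
        Real.mul_rpow two_pos.le h3.le]
      ring

end Rates

end MEstimation

namespace MEstimation

/-! ### The predictable part and the score sums -/

section Predictable

variable {Ω : Type*} [MeasurableSpace Ω] {P : Measure Ω}

/-- The event may be an uncountable union over β. It is contained in a measurable event for the
dominating variable, so outer measure is enough. -/
theorem measure_dyadic_le {ι : Type*} (d : ℕ) (F : ℕ → ι → Ω → ℝ) (v : ℕ → ℝ≥0∞)
    (h : ∀ a b : ℕ, a ≤ b → b ≤ 2 ^ d → ∃ R : Ω → ℝ≥0∞, Measurable R ∧
      (∀ ω β, ‖F b β ω - F a β ω‖ₑ ≤ R ω) ∧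
      ∫⁻ ω, R ω ^ 2 ∂P ≤ ∑ i ∈ Finset.Ioc a b, v i) {V T s : ℝ}
    (hv : ∑ i ∈ Finset.Ioc 0 (2 ^ d), v i ≤ ENNReal.ofReal V) (hT : 0 < T)
    (hs : ((d : ℝ) + 1) ^ 2 * V ≤ s * T ^ 2) :
    P {ω | ∃ n ≤ 2 ^ d, ∃ β, T < |F n β ω - F 0 β ω|} ≤ ENNReal.ofReal s := by
  obtain ⟨R, hRm, hRb, hRs⟩ := exists_dyadic_max_bound d F v h
  refine (measure_mono ?_).trans (measure_lt_le_of_lintegral_sq hRm hT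
    (K := ((d : ℝ) + 1) ^ 2 * V) ?_ hs)
  · rintro ω ⟨n, hn, β, hlt⟩
    refine lt_of_lt_of_le ?_ (hRb ω n hn β)
    rw [Real.enorm_eq_ofReal_abs]
    exact (ENNReal.ofReal_lt_ofReal_iff (hT.trans hlt)).2 hlt
  · refine hRs.trans ?_
    rw [ENNReal.ofReal_mul (by positivity), ENNReal.ofReal_pow (by positivity),
      ENNReal.ofReal_add (by positivity) zero_le_one, ENNReal.ofReal_natCast, ENNReal.ofReal_one]
    gcongr

theorem sum_Ioc_sub_sum_Ioc {a b : ℕ} (hab : a ≤ b) (f : ℕ → ℝ) :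
    ∑ i ∈ Finset.Ioc 0 b, f i - ∑ i ∈ Finset.Ioc 0 a, f i = ∑ i ∈ Finset.Ioc a b, f i := by
  rw [← Finset.sum_Ioc_consecutive f (Nat.zero_le a) hab]; ring

variable {p : ℕ}

theorem norm_le_sum_abs_apply (v : EuclideanSpace ℝ (Fin p)) : ‖v‖ ≤ ∑ k, |v k| := by
  rw [EuclideanSpace.norm_eq]
  refine Real.sqrt_le_iff.2 ⟨Finset.sum_nonneg fun _ _ => abs_nonneg _, ?_⟩
  simp_rw [Real.norm_eq_abs]
  exact Finset.sum_sq_le_sq_sum_of_nonneg fun _ _ => abs_nonneg _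

theorem abs_apply_le_norm (v : EuclideanSpace ℝ (Fin p)) (k : Fin p) : |v k| ≤ ‖v‖ :=
  PiLp.norm_apply_le v k

theorem norm_le_of_forall_abs_apply_le {v : EuclideanSpace ℝ (Fin p)} {C : ℝ}
    (h : ∀ k, |v k| ≤ C) : ‖v‖ ≤ p * C :=
  (norm_le_sum_abs_apply v).trans ((Finset.sum_le_sum fun k _ => h k).trans_eq (by simp))

/-- The coordinates of a vector, extended by zero. -/
noncomputable def coordZ (v : EuclideanSpace ℝ (Fin p)) (j : ℕ) : ℝ :=
  if h : j < p then v ⟨j, h⟩ else 0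

theorem abs_coordZ_le (v : EuclideanSpace ℝ (Fin p)) (j : ℕ) : |coordZ v j| ≤ ‖v‖ := by
  unfold coordZ
  split_ifs with h
  · exact abs_apply_le_norm v _
  · simp

/-- The directions are the negated coordinates of x_i because the score is evaluated at e_i - x_i'β.
-/
theorem sum_coordZ_mul (u v : EuclideanSpace ℝ (Fin p)) :
    ∑ j ∈ Finset.range p, coordZ v j * -coordZ u j = -inner ℝ u v := by
  rw [Finset.sum_range, PiLp.inner_apply, ← Finset.sum_neg_distrib]
  refine Finset.sum_congr rfl fun j _ => ?_
  simp [coordZ]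

variable {x : ℕ → EuclideanSpace ℝ (Fin p)}

/-- Tail bound for the oscillation of a weighted sum of a ridge family along a dyadic block. -/
theorem measure_ridge_oscillation_le [SFinite P] {g : ℕ → ℕ → ℝ → Ω → ℝ} {r b : ℝ} {Θ : ℝ≥0∞}
    (hg : ∀ I : Finset ℕ, IsRidgeFamily P g I p r Θ) (hΘ : Θ < ∞) (hb : 0 ≤ b) {d : ℕ}
    (hr : p * (b * rTilde x (2 ^ d)) ≤ r) (h1 : 2 * b * rTilde x (2 ^ d) ≤ 1) (w : ℕ → ℝ)
    (hw : ∀ i, |w i| ≤ ‖x i‖) {T s : ℝ} (hT : 0 < T)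
    (hs : ((d : ℝ) + 1) ^ 2 * ((p * p * 4 * 8 ^ p * Θ.toReal) * b ^ 2 * xi x (2 ^ d) 4)
      ≤ s * T ^ 2) :
    P {ω | ∃ n ≤ 2 ^ d, ∃ β : EuclideanSpace ℝ (Fin p), ‖β‖ ≤ b ∧
      T < |∑ i ∈ Finset.Icc 1 n, w i * (g 0 i (-inner ℝ (x i) β) ω - g 0 i 0 ω)|}
      ≤ ENNReal.ofReal s := by
  set K : ℝ := p * p * 4 * 8 ^ p * Θ.toReal with hK
  have hΘr : ENNReal.ofReal Θ.toReal = Θ := ENNReal.ofReal_toReal hΘ.ne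
  have hIcc : ∀ n, Finset.Icc 1 n = Finset.Ioc 0 n := fun n => rfl
  let F : ℕ → {β : EuclideanSpace ℝ (Fin p) // ‖β‖ ≤ b} → Ω → ℝ := fun n β ω =>
    ∑ i ∈ Finset.Ioc 0 n, w i * (g 0 i (-inner ℝ (x i) β.1) ω - g 0 i 0 ω)
  have hF0 : ∀ β ω, F 0 β ω = 0 := fun β ω => by simp [F]
  have hmain := measure_dyadic_le (P := P) d F
    (fun i => ENNReal.ofReal (K * b ^ 2 * ‖x i‖ ^ 4)) ?_
    (V := K * b ^ 2 * xi x (2 ^ d) 4) ?_ hT hs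
  · refine (measure_mono ?_).trans hmain
    rintro ω ⟨n, hn, β, hβ, hlt⟩
    refine ⟨n, hn, ⟨β, hβ⟩, ?_⟩
    rw [hF0, sub_zero]
    exact hlt
  · intro a c hac hc
    have hxr : ∀ i ∈ Finset.Ioc a c, ‖x i‖ ≤ rTilde x (2 ^ d) := by
      intro i hi
      rw [Finset.mem_Ioc] at hi
      exact norm_le_rTilde x (Finset.mem_Icc.2 ⟨by omega, by omega⟩)
    have hab : ∀ i ∈ Finset.Ioc a c, ∀ j, |(-coordZ (x i) j)| ≤ rTilde x (2 ^ d) := by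
      intro i hi j
      rw [abs_neg]
      exact (abs_coordZ_le _ _).trans (hxr i hi)
    -- The ball of radius b sits in the box |β_j| ≤ b, on which the oscillation bound applies.
    obtain ⟨R, hRm, hRb, hRs⟩ := (hg (Finset.Ioc a c)).exists_oscillation_bound
      (a := fun j i => -coordZ (x i) j) hb w
      (fun i hi => by
        refine le_trans (Finset.sum_le_sum fun j _ =>
          mul_le_mul_of_nonneg_left (hab i hi j) hb) ?_
        rw [Finset.sum_const, Finset.card_range, nsmul_eq_mul]
        exact hr)
      (fun j _ i hi => by
        rw [abs_mul, abs_of_nonneg (by positivity : 0 ≤ 2 * b)]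
        exact (mul_le_mul_of_nonneg_left (hab i hi j) (by positivity)).trans h1)
    refine ⟨R, hRm, fun ω β => ?_, hRs.trans ?_⟩
    · have := hRb ω (coordZ β.1) (fun j => (abs_coordZ_le _ j).trans β.2)
      refine le_trans (le_of_eq ?_) this
      congr 1
      simp only [F]
      rw [sum_Ioc_sub_sum_Ioc hac, ← Finset.sum_sub_distrib]
      refine Finset.sum_congr rfl fun i _ => ?_
      rw [sum_coordZ_mul, mul_sub]
    -- The weight and the direction each contribute a factor ‖x_i‖, hence fourth powers. The
    -- resulting bound is additive over i, as the dyadic inequality requires.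
    · have hY : ∀ m ∈ Finset.range p, ∑ i ∈ Finset.Ioc a c,
          ENNReal.ofReal ((w i * -coordZ (x i) m) ^ 2)
          ≤ ∑ i ∈ Finset.Ioc a c, ENNReal.ofReal (‖x i‖ ^ 4) := by
        intro m _
        refine Finset.sum_le_sum fun i _ => ENNReal.ofReal_le_ofReal ?_
        rw [← sq_abs, abs_mul, abs_neg]
        calc (|w i| * |coordZ (x i) m|) ^ 2 ≤ (‖x i‖ * ‖x i‖) ^ 2 := by
              gcongr
              · exact hw i
              · exact abs_coordZ_le _ _
          _ = ‖x i‖ ^ 4 := by ring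
      calc _ ≤ (p : ℝ≥0∞) * ∑ m ∈ Finset.range p, ENNReal.ofReal (2 * b) ^ 2
            * (8 ^ p * (Θ * ∑ i ∈ Finset.Ioc a c, ENNReal.ofReal (‖x i‖ ^ 4))) := by
            refine mul_le_mul' le_rfl (Finset.sum_le_sum fun m hm => ?_)
            exact mul_le_mul' le_rfl (mul_le_mul' le_rfl (mul_le_mul' le_rfl (hY m hm)))
        _ = ENNReal.ofReal (K * b ^ 2) * ∑ i ∈ Finset.Ioc a c, ENNReal.ofReal (‖x i‖ ^ 4) := by
            have hb2 : 0 ≤ 2 * b := by positivity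
            have e : K * b ^ 2 = p * p * (2 * b) ^ 2 * 8 ^ p * Θ.toReal := by rw [hK]; ring
            have e' : ENNReal.ofReal (K * b ^ 2) = p * p * ENNReal.ofReal (2 * b) ^ 2 * 8 ^ p * Θ := by
              generalize 2 * b = c at e hb2
              rw [e, ENNReal.ofReal_mul (by positivity), ENNReal.ofReal_mul (by positivity),
                ENNReal.ofReal_mul (by positivity), ENNReal.ofReal_mul (by positivity), hΘr,
                ENNReal.ofReal_pow hb2, ENNReal.ofReal_pow (by positivity),
                ENNReal.ofReal_natCast, ENNReal.ofReal_ofNat]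
            rw [e', Finset.sum_const, Finset.card_range, nsmul_eq_mul]
            ring
        _ = _ := by
            rw [Finset.mul_sum]
            refine Finset.sum_congr rfl fun i _ => ?_
            rw [← ENNReal.ofReal_mul (by positivity)]
  · rw [← ENNReal.ofReal_sum_of_nonneg fun i _ => by positivity, ← Finset.mul_sum, xi_four, hIcc]

variable {ε : ℤ → Ω → ℝ} {ε₀' : Ω → ℝ} {G : (ℕ → ℝ) → ℝ} {ρ ψ : ℝ → ℝ} {ι : ℝ}

theorem BSeq_sq : ∀ᶠ n in atTop, BSeq x ι n ^ 2
    = bSeq ι n ^ 2 * xi x n 4 * (Real.log n ^ (3 : ℝ) * Real.log (Real.log n) ^ (1 + ι)) := by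
  filter_upwards [eventually_logs_pos] with n ⟨h1, h2, h3⟩
  have e1 : (Real.log n ^ (3 / 2 : ℝ)) ^ 2 = Real.log n ^ (3 : ℝ) := by
    rw [← Real.rpow_natCast, ← Real.rpow_mul h2.le]; norm_num
  have e2 : (Real.log (Real.log n) ^ ((1 + ι) / 2)) ^ 2 = Real.log (Real.log n) ^ (1 + ι) := by
    rw [← Real.rpow_natCast, ← Real.rpow_mul h3.le]; norm_num
  unfold BSeq
  rw [mul_pow, mul_pow, mul_pow, Real.sq_sqrt (xi_nonneg _ _ _), e1, e2]
  ring

theorem tendsto_two_pow : Tendsto (fun d : ℕ => 2 ^ d) atTop atTop :=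
  tendsto_pow_atTop_atTop_of_one_lt one_lt_two

variable [IsProbabilityMeasure P]

/-- The almost sure oscillation bound for the predictable part of the M-process. -/
theorem ae_eventually_predictable_le (hm : IsInnovationModel P ε ε₀' G) (hψ : Measurable ψ)
    (hA1 : CondA1 P ε G ρ ψ) (hA3 : CondA3 P ε G ψ) (hA6 : ∀ l ≤ p, CondA6 P ε ε₀' G ψ l)
    (hlam : 0 < liminf (fun n : ℕ => minEigenvalue x n / (n : ℝ)) atTop)
    (hr : (fun n : ℕ => rTilde x n) =O[atTop]
      fun n : ℕ => (n : ℝ) ^ (1 / 2 : ℝ) * Real.log n ^ (-2 : ℝ)) (hι : 0 < ι) :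
    ∀ᵐ ω ∂P, ∀ᶠ d : ℕ in atTop, ∀ n ≤ 2 ^ d, ∀ β : EuclideanSpace ℝ (Fin p),
      ‖β‖ ≤ √2 * bSeq ι (2 ^ d) →
      ‖∑ i ∈ Finset.Icc 1 n,
        ((oneStep P ε G ψ (-inner ℝ (x i) β) (past ε ((i : ℤ) - 1) ω)
            - phi P ε G ψ (-inner ℝ (x i) β))
          - (oneStep P ε G ψ 0 (past ε ((i : ℤ) - 1) ω) - phi P ε G ψ 0)) • x i‖
        ≤ p * BSeq x ι (2 ^ d) := by
  obtain ⟨r, Θ, g, hr0, hΘ, hg, hgae⟩ := exists_isRidgeFamily hm hψ hA1 hA3 hA6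
  obtain ⟨s, hs0, hs, hratio⟩ := summable_dyadic_ratio hι
  set K : ℝ := p * p * 4 * 8 ^ p * Θ.toReal with hK
  have hK0 : 0 ≤ K := by positivity
  have hsmall : ∀ c : ℝ, 0 < c → ∀ᶠ d : ℕ in atTop,
      rTilde x (2 ^ d) * bSeq ι (2 ^ d) < c := fun c hc =>
    ((tendsto_rTilde_mul_bSeq hr).comp tendsto_two_pow).eventually_lt_const hc
  have hbpos : ∀ᶠ d : ℕ in atTop, 0 < bSeq ι (2 ^ d) :=
    tendsto_two_pow.eventually (eventually_logRate_pos (-(1 / 2)) (3 / 2) (1 / 2 + ι))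
  have hBpos : ∀ᶠ d : ℕ in atTop, 0 < BSeq x ι (2 ^ d) := by
    have h1 := (one_isLittleO_BSeq (x := x) (ι := ι) hlam).bound one_pos
    refine tendsto_two_pow.eventually (p := fun n => 0 < BSeq x ι n) ?_
    filter_upwards [h1, eventually_logs_pos] with n hn ⟨h1, h2, h3⟩
    have h0 : 0 ≤ BSeq x ι n := by unfold BSeq bSeq; positivity
    rw [norm_one, one_mul, Real.norm_of_nonneg h0] at hn
    linarith
  have h2le : √2 ≤ 2 := Real.sqrt_le_iff.2 ⟨by norm_num, by norm_num⟩
  have hcoord : ∀ k : Fin p, ∀ᵐ ω ∂P, ∀ᶠ d : ℕ in atTop, ω ∉ {ω | ∃ n ≤ 2 ^ d,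
      ∃ β : EuclideanSpace ℝ (Fin p), ‖β‖ ≤ √2 * bSeq ι (2 ^ d) ∧ BSeq x ι (2 ^ d) <
        |∑ i ∈ Finset.Icc 1 n, x i k * (g 0 i (-inner ℝ (x i) β) ω - g 0 i 0 ω)|} := by
    intro k
    -- The radius is √2 b because b_n ≤ √2 b_{n̄}; its square is the factor 2. The thresholds 1/4
    -- and r / (2 (p + 1)) below use √2 ≤ 2.
    refine ae_eventually_notMem_of_le (s := fun d => 2 * K * s d)
      (fun d => mul_nonneg (by positivity) (hs0 d)) (hs.mul_left _) ?_
    filter_upwards [hsmall (1 / 4) (by norm_num), hsmall (r / (2 * (p + 1))) (by positivity), hbpos,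
      hBpos, hratio, tendsto_two_pow.eventually (BSeq_sq (x := x))] with d h1 h2 h3 h4 h5 h6
    have hrt := rTilde_nonneg x (2 ^ d)
    have hprod : 0 ≤ rTilde x (2 ^ d) * bSeq ι (2 ^ d) := mul_nonneg hrt h3.le
    have hle : √2 * bSeq ι (2 ^ d) * rTilde x (2 ^ d)
        ≤ 2 * (rTilde x (2 ^ d) * bSeq ι (2 ^ d)) := by nlinarith
    refine measure_ridge_oscillation_le hg hΘ (by positivity) ?_ ?_ (fun i => x i k)
      (fun i => abs_apply_le_norm _ _) h4 ?_
    · rw [lt_div_iff₀ (by positivity)] at h2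
      have hp : (0 : ℝ) ≤ p := p.cast_nonneg
      calc (p : ℝ) * (√2 * bSeq ι (2 ^ d) * rTilde x (2 ^ d))
          ≤ p * (2 * (rTilde x (2 ^ d) * bSeq ι (2 ^ d))) := by gcongr
        _ ≤ r := by nlinarith
    · linarith
    · rw [h6, mul_pow, Real.sq_sqrt two_pos.le]
      have hx4 := xi_nonneg x (2 ^ d) 4
      calc ((d : ℝ) + 1) ^ 2 * (K * (2 * bSeq ι (2 ^ d) ^ 2) * xi x (2 ^ d) 4)
          = (2 * K * bSeq ι (2 ^ d) ^ 2 * xi x (2 ^ d) 4) * ((d : ℝ) + 1) ^ 2 := by ring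
        _ ≤ (2 * K * bSeq ι (2 ^ d) ^ 2 * xi x (2 ^ d) 4) *
            (s d * (Real.log ((2 ^ d : ℕ) : ℝ) ^ (3 : ℝ)
              * Real.log (Real.log ((2 ^ d : ℕ) : ℝ)) ^ (1 + ι))) := by gcongr
        _ = _ := by ring
  filter_upwards [ae_all_iff.2 hcoord, ae_all_iff.2 hgae] with ω hω hgω
  have hrad : ∀ᶠ d : ℕ in atTop, rTilde x (2 ^ d) * (√2 * bSeq ι (2 ^ d)) ≤ r := by
    filter_upwards [hsmall (r / 2) (by positivity), hbpos] with d h1 h2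
    have := rTilde_nonneg x (2 ^ d)
    have hprod : 0 ≤ rTilde x (2 ^ d) * bSeq ι (2 ^ d) := mul_nonneg this h2.le
    nlinarith
  filter_upwards [eventually_all.2 hω, hrad] with d hd hrd n hn β hβ
  refine norm_le_of_forall_abs_apply_le fun k => ?_
  have h1 := hd k
  simp only [not_exists, not_and, not_lt] at h1
  refine le_trans (le_of_eq ?_) (h1 n hn β hβ)
  congr 1
  rw [WithLp.ofLp_sum, Finset.sum_apply]
  refine Finset.sum_congr rfl fun i hi => ?_
  have hi' : i ∈ Finset.Icc 1 (2 ^ d) := by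
    rw [Finset.mem_Icc] at hi ⊢; omega
  have ht : |(-inner ℝ (x i) β)| ≤ r := by
    rw [abs_neg]
    refine (abs_real_inner_le_norm _ _).trans (le_trans ?_ hrd)
    exact mul_le_mul (norm_le_rTilde x hi') hβ (norm_nonneg _) (rTilde_nonneg _ _)
  rw [hgω i _ ht, hgω i 0 (by simpa using hr0.le)]
  simp [mul_comm]

/-- Second moments of weighted sums of the scores. -/
theorem exists_lintegral_sum_score_sq_le (hm : IsInnovationModel P ε ε₀' G) (hψ : Measurable ψ)
    (hA1 : CondA1 P ε G ρ ψ) (hA6 : CondA6 P ε ε₀' G ψ 0) :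
    ∃ Θ : ℝ≥0∞, Θ < ∞ ∧ ∀ (I : Finset ℕ) (w : ℕ → ℝ),
      ∫⁻ ω, ‖∑ i ∈ I, w i * ψ (err G ε (i : ℤ) ω)‖ₑ ^ 2 ∂P
        ≤ Θ * ∑ i ∈ I, ENNReal.ofReal (w i ^ 2) := by
  obtain ⟨r₀, hr₀, h⟩ := exists_summable_lagNorm (p := 0) hm hψ fun l hl => by
    obtain rfl : l = 0 := by omega
    exact hA6
  obtain ⟨M, d, hM, hd, hL, -, hlag⟩ := h 0 le_rfl
  -- The summand 0 makes the prediction of `f` equal to the predicted score at t = 0 by definition.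
  let f : (ℕ → ℝ) → ℝ := fun s => ψ (G s + 0)
  have hf : Measurable f := hψ.comp (hm.measurable_filter.add_const 0)
  have := hm.isProbabilityMeasure_innov
  have hfL : ∀ i : ℤ, MemLp (fun ω => f (past ε i ω)) 2 P := fun i =>
    hm.memLp_score hψ (t := 0) (by simpa using hA1.memLp) i
  have hpred : predict (P.map (ε 0)) f = oneStepDeriv P ε G ψ 0 0 := rfl
  have h0 : |(0 : ℝ)| ≤ r₀ := by simpa using hr₀.le
  -- One prediction turns the score into the predicted score, so lag k + 1 of the former is lag k of
  -- the latter. Only lag zero needs a separate, merely finite, bound.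
  let r : ℕ → ℝ≥0∞ := fun k => Nat.casesOn k (lagNorm P ε f 0) d
  have hr : ∀ k, lagNorm P ε f k ≤ r k := by
    intro k
    cases k with
    | zero => exact le_rfl
    | succ k =>
      have : lagNorm P ε f (k + 1) = lagNorm P ε (oneStepDeriv P ε G ψ 0 0) k := by
        simp only [lagNorm, Function.iterate_succ_apply, hpred]
      rw [this]
      exact hlag 0 h0 k
  have hrsum : ∑' k, r k < ∞ := by
    rw [tsum_eq_zero_add' ENNReal.summable]
    refine ENNReal.add_lt_top.2 ⟨?_, hd⟩
    change lagNorm P ε f 0 < ∞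
    simp only [lagNorm, Function.iterate_succ_apply, Function.iterate_zero_apply, hpred]
    exact ((hfL 0).sub (hL 0 h0 (-1))).2
  refine ⟨(∑' k, r k) ^ 2, ENNReal.pow_lt_top hrsum, fun I w => ?_⟩
  have hmain := hm.eLpNorm_sum_le I (τ := fun i : ℕ => (i : ℤ)) (fun a b hab => by simpa using hab) w
    (f := fun _ => f) (fun _ => hf) (fun i _ => hfL i) (r := r) (fun i _ => hr)
  have hmean : ∀ i : ℤ, ∫ ω, f (past ε i ω) ∂P = 0 := fun i => by
    refine (integral_score hm hψ 0 i).trans ?_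
    simpa [phi] using hA1.mean_zero
  simp only [hmean, sub_zero] at hmain
  have h2 := eLpNorm_two_sq (P := P) (fun ω => ∑ i ∈ I, w i * f (past ε (i : ℤ) ω))
  have h3 : ∀ ω, ∑ i ∈ I, w i * ψ (err G ε (i : ℤ) ω) = ∑ i ∈ I, w i * f (past ε (i : ℤ) ω) := by
    intro ω; simp [f, err]
  simp_rw [h3]
  rw [← h2]
  calc _ ≤ ((∑' k, r k) * ENNReal.ofReal √(∑ i ∈ I, w i ^ 2)) ^ 2 := by gcongr
    _ = _ := by
      rw [mul_pow, ← ENNReal.ofReal_pow (Real.sqrt_nonneg _),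
        Real.sq_sqrt (Finset.sum_nonneg fun i _ => sq_nonneg _),
        ENNReal.ofReal_sum_of_nonneg fun i _ => sq_nonneg _]

/-- The almost sure rate of the M-process at the true parameter. -/
theorem ae_eventually_score_sum_le (hm : IsInnovationModel P ε ε₀' G) (hψ : Measurable ψ)
    (hA1 : CondA1 P ε G ρ ψ) (hA6 : CondA6 P ε ε₀' G ψ 0)
    (hxi : (fun n : ℕ => xi x n 2) =O[atTop] fun n : ℕ => (n : ℝ)) (hι : 0 < ι) :
    ∀ᵐ ω ∂P, ∀ᶠ d : ℕ in atTop, ∀ n : ℕ, n ≤ 2 ^ d →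
      ‖∑ i ∈ Finset.Icc (1 : ℕ) n, ψ (err G ε (i : ℤ) ω) • x i‖
        ≤ p * logRate (1 / 2) (3 / 2) ((1 + ι) / 2) (2 ^ d) := by
  obtain ⟨Θ, hΘ, hmom⟩ := exists_lintegral_sum_score_sq_le hm hψ hA1 hA6
  obtain ⟨s, hs0, hs, hratio⟩ := summable_dyadic_ratio hι
  obtain ⟨C, hC0, hC⟩ := hxi.exists_pos
  have hΘr : ENNReal.ofReal Θ.toReal = Θ := ENNReal.ofReal_toReal hΘ.ne
  have hIcc : ∀ n : ℕ, Finset.Icc 1 n = Finset.Ioc 0 n := fun n => rfl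
  have hcoord : ∀ k : Fin p, ∀ᵐ ω ∂P, ∀ᶠ d : ℕ in atTop, ω ∉ {ω | ∃ n : ℕ, n ≤ 2 ^ d ∧ ∃ _ : Unit,
      logRate (1 / 2) (3 / 2) ((1 + ι) / 2) (2 ^ d) <
        |∑ i ∈ Finset.Ioc (0 : ℕ) n, x i k * ψ (err G ε (i : ℤ) ω)
          - ∑ i ∈ Finset.Ioc (0 : ℕ) 0, x i k * ψ (err G ε (i : ℤ) ω)|} := by
    intro k
    refine ae_eventually_notMem_of_le (s := fun d => Θ.toReal * C * s d)
      (fun d => mul_nonneg (by positivity) (hs0 d)) (hs.mul_left _) ?_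
    filter_upwards [hratio, tendsto_two_pow.eventually hC.bound,
      tendsto_two_pow.eventually eventually_logs_pos,
      tendsto_two_pow.eventually (eventually_logRate_pos (1 / 2) (3 / 2) ((1 + ι) / 2))]
      with d h1 h2 ⟨h3, h4, h5⟩ h6
    refine measure_dyadic_le (P := P) d
      (fun n (_ : Unit) ω => ∑ i ∈ Finset.Ioc (0 : ℕ) n, x i k * ψ (err G ε (i : ℤ) ω))
      (fun i => Θ * ENNReal.ofReal (‖x i‖ ^ 2)) ?_ (V := Θ.toReal * xi x (2 ^ d) 2) ?_ h6 ?_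
    · intro a b hab _
      refine ⟨fun ω => ‖∑ i ∈ Finset.Ioc a b, x i k * ψ (err G ε (i : ℤ) ω)‖ₑ, ?_, ?_, ?_⟩
      · exact (Finset.measurable_sum _ fun (i : ℕ) _ =>
          (hψ.comp (hm.measurable_err (i : ℤ))).const_mul (x i k)).enorm
      · intro ω _
        rw [sum_Ioc_sub_sum_Ioc hab]
      · refine (hmom _ _).trans ?_
        rw [← Finset.mul_sum]
        refine mul_le_mul' le_rfl (Finset.sum_le_sum fun i _ => ENNReal.ofReal_le_ofReal ?_)
        exact sq_le_sq' (neg_le_of_abs_le (abs_apply_le_norm (x i) k))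
          (le_of_abs_le (abs_apply_le_norm (x i) k))
    · rw [← Finset.mul_sum, ← ENNReal.ofReal_sum_of_nonneg fun i _ => by positivity,
        ENNReal.ofReal_mul (by positivity), hΘr, xi_two, hIcc]
    · rw [Real.norm_of_nonneg (xi_nonneg _ _ _), Real.norm_of_nonneg h3.le] at h2
      have e0 : (((2 ^ d : ℕ) : ℝ) ^ (1 / 2 : ℝ)) ^ 2 = ((2 ^ d : ℕ) : ℝ) := by
        rw [← Real.rpow_natCast, ← Real.rpow_mul h3.le]; norm_num
      have e1 : (Real.log ((2 ^ d : ℕ) : ℝ) ^ (3 / 2 : ℝ)) ^ 2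
          = Real.log ((2 ^ d : ℕ) : ℝ) ^ (3 : ℝ) := by
        rw [← Real.rpow_natCast, ← Real.rpow_mul h4.le]; norm_num
      have e2 : (Real.log (Real.log ((2 ^ d : ℕ) : ℝ)) ^ ((1 + ι) / 2)) ^ 2
          = Real.log (Real.log ((2 ^ d : ℕ) : ℝ)) ^ (1 + ι) := by
        rw [← Real.rpow_natCast, ← Real.rpow_mul h5.le]; norm_num
      unfold logRate
      rw [mul_pow, mul_pow, e0, e1, e2]
      calc ((d : ℝ) + 1) ^ 2 * (Θ.toReal * xi x (2 ^ d) 2)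
          ≤ (s d * (Real.log ((2 ^ d : ℕ) : ℝ) ^ (3 : ℝ)
              * Real.log (Real.log ((2 ^ d : ℕ) : ℝ)) ^ (1 + ι)))
            * (Θ.toReal * (C * ((2 ^ d : ℕ) : ℝ))) := by
            have := xi_nonneg x (2 ^ d) 2
            exact mul_le_mul h1 (mul_le_mul_of_nonneg_left h2 ENNReal.toReal_nonneg)
              (mul_nonneg ENNReal.toReal_nonneg this) ((sq_nonneg _).trans h1)
        _ = _ := by ring
  filter_upwards [ae_all_iff.2 hcoord] with ω hω
  filter_upwards [eventually_all.2 hω] with d hd n hn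
  refine norm_le_of_forall_abs_apply_le fun k => ?_
  have h1 := hd k
  simp only [not_exists, not_and, not_lt] at h1
  refine le_trans (le_of_eq ?_) (h1 n hn ())
  congr 1
  rw [WithLp.ofLp_sum, Finset.sum_apply, Finset.Ioc_self, Finset.sum_empty, sub_zero, hIcc]
  refine Finset.sum_congr rfl fun i _ => ?_
  simp [mul_comm]

end Predictable

end MEstimation

namespace MEstimation

/-! ### An exponential inequality for sums of martingale differences -/

section Exponential

theorem exp_le_one_add_add_sq {y : ℝ} (h : |y| ≤ 1) : Real.exp y ≤ 1 + y + y ^ 2 := by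
  have := Real.abs_exp_sub_one_sub_id_le h
  linarith [(abs_le.1 this).2]

/-- For |y| ≤ 1, exp y ≤ 1 + y + y². The linear term integrates to zero, and 1 + c² Var f ≤ exp(c² E
f²), so the uncentered second moment may serve as compensator. -/
theorem lintegral_exp_centered_le_one {α : Type*} [MeasurableSpace α] {ν : Measure α}
    [IsProbabilityMeasure ν] {f : α → ℝ} (hf : Measurable f) {u c : ℝ} (hb : ∀ a, |f a| ≤ u)
    (hc : 0 ≤ c) (hcu : c * (2 * u) ≤ 1) :
    ∫⁻ a, ENNReal.ofReal (Real.exp (c * (f a - ∫ a, f a ∂ν) - c ^ 2 * ∫ a, f a ^ 2 ∂ν)) ∂ν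
      ≤ 1 := by
  set m := ∫ a, f a ∂ν
  set v := ∫ a, f a ^ 2 ∂ν
  have hfi : Integrable f ν := Integrable.of_bound hf.aestronglyMeasurable u (ae_of_all _ hb)
  have hf2 : Integrable (fun a => f a ^ 2) ν :=
    Integrable.of_bound (hf.pow_const 2).aestronglyMeasurable (u ^ 2) (ae_of_all _ fun a => by
      rw [Real.norm_of_nonneg (sq_nonneg _), ← sq_abs]
      exact pow_le_pow_left₀ (abs_nonneg _) (hb a) 2)
  have hm : |m| ≤ u := by
    have := norm_integral_le_of_norm_le_const (μ := ν) (f := f) (ae_of_all _ hb)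
    simpa using this
  have hpt : ∀ a, Real.exp (c * (f a - m) - c ^ 2 * v)
      ≤ Real.exp (-(c ^ 2 * v)) * (1 + c * (f a - m) + c ^ 2 * (f a ^ 2 - 2 * m * f a + m ^ 2)) := by
    intro a
    have h1 : |c * (f a - m)| ≤ 1 := by
      rw [abs_mul, abs_of_nonneg hc]
      refine le_trans (mul_le_mul_of_nonneg_left ?_ hc) hcu
      calc |f a - m| ≤ |f a| + |m| := abs_sub _ _
        _ ≤ 2 * u := by linarith [hb a]
    rw [sub_eq_add_neg, Real.exp_add, mul_comm]
    refine mul_le_mul_of_nonneg_left ((exp_le_one_add_add_sq h1).trans_eq ?_) (Real.exp_nonneg _)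
    ring
  have hint : Integrable (fun a => Real.exp (-(c ^ 2 * v)) *
      (1 + c * (f a - m) + c ^ 2 * (f a ^ 2 - 2 * m * f a + m ^ 2))) ν := by
    refine Integrable.const_mul ?_ _
    exact ((integrable_const _).add ((hfi.sub (integrable_const _)).const_mul _)).add
      (((hf2.sub (hfi.const_mul _)).add (integrable_const _)).const_mul _)
  calc _ ≤ ∫⁻ a, ENNReal.ofReal (Real.exp (-(c ^ 2 * v)) *
        (1 + c * (f a - m) + c ^ 2 * (f a ^ 2 - 2 * m * f a + m ^ 2))) ∂ν :=
        lintegral_mono fun a => ENNReal.ofReal_le_ofReal (hpt a)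
    _ = ENNReal.ofReal (Real.exp (-(c ^ 2 * v)) * (1 + c ^ 2 * (v - m ^ 2))) := by
        rw [← ofReal_integral_eq_lintegral_ofReal hint
          (ae_of_all _ fun a => (Real.exp_nonneg _).trans (hpt a)), integral_const_mul]
        congr 2
        have e0 : ∀ a, 1 + c * (f a - m) + c ^ 2 * (f a ^ 2 - 2 * m * f a + m ^ 2)
            = ((1 - c * m + c ^ 2 * m ^ 2) + (c - 2 * c ^ 2 * m) * f a) + c ^ 2 * f a ^ 2 :=
          fun a => by ring
        have i1 : Integrable (fun a => (c - 2 * c ^ 2 * m) * f a) ν := hfi.const_mul _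
        have i2 : Integrable (fun a =>
            (1 - c * m + c ^ 2 * m ^ 2) + (c - 2 * c ^ 2 * m) * f a) ν := (integrable_const _).add i1
        simp_rw [e0]
        rw [integral_add i2 (hf2.const_mul _), integral_add (integrable_const _) i1,
          integral_const_mul, integral_const_mul, integral_const]
        simp only [probReal_univ, one_smul]
        change 1 - c * m + c ^ 2 * m ^ 2 + (c - 2 * c ^ 2 * m) * m + c ^ 2 * v = _
        ring
    _ ≤ 1 := by
        rw [← ENNReal.ofReal_one]
        refine ENNReal.ofReal_le_ofReal ?_
        rw [Real.exp_neg, inv_mul_le_iff₀ (Real.exp_pos _), mul_one]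
        have := Real.add_one_le_exp (c ^ 2 * v)
        nlinarith [sq_nonneg (c * m)]

variable {Ω : Type*} [MeasurableSpace Ω] {P : Measure Ω} [IsProbabilityMeasure P]
  {ε : ℤ → Ω → ℝ} {ε₀' : Ω → ℝ} {G : (ℕ → ℝ) → ℝ}

/-- The logarithm of the exponential supermartingale of the sums
`∑ (f i (past i) - E[f i (past i) | past (i - 1)])`, as a function of the past. -/
noncomputable def expWeight (ν : Measure ℝ) (f : ℕ → (ℕ → ℝ) → ℝ) (c : ℝ) : ℕ → (ℕ → ℝ) → ℝ
  | 0 => fun _ => 0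
  | n + 1 => fun s => expWeight ν f c n (tailSeq s)
      + (c * (f (n + 1) s - predict ν (f (n + 1)) (tailSeq s))
        - c ^ 2 * predict ν (fun s => f (n + 1) s ^ 2) (tailSeq s))

theorem measurable_expWeight {ν : Measure ℝ} [SFinite ν] {f : ℕ → (ℕ → ℝ) → ℝ}
    (hf : ∀ i, Measurable (f i)) (c : ℝ) (n : ℕ) : Measurable (expWeight ν f c n) := by
  induction n with
  | zero => exact measurable_const
  | succ n ih =>
    have h1 := (measurable_predict (ν := ν) (hf (n + 1))).comp measurable_tailSeq
    have h2 := (measurable_predict (ν := ν) ((hf (n + 1)).pow_const 2)).comp measurable_tailSeq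
    exact (ih.comp measurable_tailSeq).add
      ((((hf (n + 1)).sub h1).const_mul c).sub (h2.const_mul (c ^ 2)))

theorem expWeight_past {Ω : Type*} {ε : ℤ → Ω → ℝ} (ν : Measure ℝ) (f : ℕ → (ℕ → ℝ) → ℝ) (c : ℝ) (n : ℕ) (ω : Ω) :
    expWeight ν f c n (past ε (n : ℤ) ω)
      = c * ∑ i ∈ Finset.Icc 1 n,
          (f i (past ε (i : ℤ) ω) - predict ν (f i) (past ε ((i : ℤ) - 1) ω))
        - c ^ 2 * ∑ i ∈ Finset.Icc 1 n,
          predict ν (fun s => f i s ^ 2) (past ε ((i : ℤ) - 1) ω) := by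
  induction n with
  | zero => simp [expWeight]
  | succ n ih =>
    have e : tailSeq (past ε ((n + 1 : ℕ) : ℤ) ω) = past ε (n : ℤ) ω := by
      rw [tailSeq_past]; congr 1; push_cast; ring
    have e' : ((n + 1 : ℕ) : ℤ) - 1 = n := by push_cast; ring
    rw [expWeight]
    beta_reduce
    rw [Finset.sum_Icc_succ_top (by omega), Finset.sum_Icc_succ_top (by omega), e, ih, e']
    ring

/-- Integrating out the newest innovation with the older past fixed multiplies the weight by a
factor of mean at most one. -/
theorem IsInnovationModel.lintegral_expWeight_le_one (hm : IsInnovationModel P ε ε₀' G)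
    {f : ℕ → (ℕ → ℝ) → ℝ} (hf : ∀ i, Measurable (f i)) {u c : ℝ} (hb : ∀ i s, |f i s| ≤ u)
    (hc : 0 ≤ c) (hcu : c * (2 * u) ≤ 1) (n : ℕ) :
    ∫⁻ ω, ENNReal.ofReal (Real.exp (expWeight (P.map (ε 0)) f c n (past ε (n : ℤ) ω))) ∂P ≤ 1 := by
  have := hm.isProbabilityMeasure_innov
  set ν := P.map (ε 0)
  induction n with
  | zero => simp [expWeight]
  | succ n ih =>
    have hW := measurable_expWeight (ν := ν) hf c n
    have hWs := measurable_expWeight (ν := ν) hf c (n + 1)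
    have e' : ((n + 1 : ℕ) : ℤ) - 1 = n := by push_cast; ring
    have h1 := hm.lintegral_innov_past ((n + 1 : ℕ) : ℤ)
      (g := fun a s => ENNReal.ofReal (Real.exp (expWeight ν f c (n + 1) (consSeq a s))))
      ((hWs.comp measurable_consSeq).exp.ennreal_ofReal)
    simp only [e'] at h1
    have e2 : ∀ ω, past ε ((n + 1 : ℕ) : ℤ) ω = consSeq (ε ((n + 1 : ℕ) : ℤ) ω) (past ε n ω) := by
      intro ω
      rw [past_eq_consSeq, e']
    simp_rw [e2, h1]
    refine le_trans (lintegral_mono fun ω => ?_) ih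
    set s := past ε (n : ℤ) ω
    have h3 : ∀ a, ENNReal.ofReal (Real.exp (expWeight ν f c (n + 1) (consSeq a s)))
        = ENNReal.ofReal (Real.exp (expWeight ν f c n s)) * ENNReal.ofReal (Real.exp
          (c * (f (n + 1) (consSeq a s) - ∫ a, f (n + 1) (consSeq a s) ∂ν)
            - c ^ 2 * ∫ a, f (n + 1) (consSeq a s) ^ 2 ∂ν)) := by
      intro a
      rw [← ENNReal.ofReal_mul (Real.exp_nonneg _), ← Real.exp_add]
      rfl
    simp_rw [h3]
    rw [lintegral_const_mul' _ _ ENNReal.ofReal_ne_top]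
    exact mul_le_of_le_one_right' (lintegral_exp_centered_le_one
      ((hf _).comp (measurable_consSeq_left s)) (fun a => hb _ _) hc hcu)

/-- An exponential inequality for the sums of bounded martingale differences. -/
theorem IsInnovationModel.measure_martingale_ge_le (hm : IsInnovationModel P ε ε₀' G)
    {f : ℕ → (ℕ → ℝ) → ℝ} (hf : ∀ i, Measurable (f i)) {u : ℝ} (hu : 0 < u)
    (hb : ∀ i s, |f i s| ≤ u) (n : ℕ) (T : ℝ) :
    P {ω | T ≤ ∑ i ∈ Finset.Icc 1 n,
          (f i (past ε (i : ℤ) ω) - predict (P.map (ε 0)) (f i) (past ε ((i : ℤ) - 1) ω)) ∧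
        ∑ i ∈ Finset.Icc 1 n,
          predict (P.map (ε 0)) (fun s => f i s ^ 2) (past ε ((i : ℤ) - 1) ω) ≤ u ^ 2}
      ≤ ENNReal.ofReal (Real.exp (1 / 4 - T / (2 * u))) := by
  have := hm.isProbabilityMeasure_innov
  set ν := P.map (ε 0)
  -- The largest c allowed by c · 2u ≤ 1. The compensator is then at most c² u² = 1/4 and the
  -- exponent is c T = T / (2u).
  set c := 1 / (2 * u) with hc
  have hle := hm.lintegral_expWeight_le_one hf hb (c := c) (by positivity)
    (by rw [hc, one_div, inv_mul_cancel₀ (by positivity)]) n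
  have hWm : Measurable fun ω =>
      ENNReal.ofReal (Real.exp (expWeight ν f c n (past ε (n : ℤ) ω))) :=
    ((measurable_expWeight hf c n).comp (hm.measurable_past _)).exp.ennreal_ofReal
  set K := Real.exp (T / (2 * u) - 1 / 4) with hK
  have hmk := mul_meas_ge_le_lintegral (μ := P) hWm (ENNReal.ofReal K)
  have hsub : P {ω | T ≤ ∑ i ∈ Finset.Icc 1 n,
          (f i (past ε (i : ℤ) ω) - predict ν (f i) (past ε ((i : ℤ) - 1) ω)) ∧
        ∑ i ∈ Finset.Icc 1 n, predict ν (fun s => f i s ^ 2) (past ε ((i : ℤ) - 1) ω) ≤ u ^ 2}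
      ≤ P {ω | ENNReal.ofReal K
        ≤ ENNReal.ofReal (Real.exp (expWeight ν f c n (past ε (n : ℤ) ω)))} := by
    refine measure_mono ?_
    rintro ω ⟨h1, h2⟩
    refine ENNReal.ofReal_le_ofReal (Real.exp_le_exp.2 ?_)
    rw [expWeight_past]
    have e1 : c ^ 2 * u ^ 2 = 1 / 4 := by rw [hc]; field_simp; norm_num
    have e2 : c * T = T / (2 * u) := by rw [hc]; ring
    have h3 := mul_le_mul_of_nonneg_left h1 (by positivity : 0 ≤ c)
    have h4 := mul_le_mul_of_nonneg_left h2 (by positivity : 0 ≤ c ^ 2)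
    linarith
  have hKpos : 0 < K := Real.exp_pos _
  have e : ENNReal.ofReal (Real.exp (1 / 4 - T / (2 * u))) = (ENNReal.ofReal K)⁻¹ := by
    rw [← ENNReal.ofReal_inv_of_pos hKpos, hK, ← Real.exp_neg]
    congr 2; ring
  rw [e]
  refine hsub.trans ?_
  rw [ENNReal.le_inv_iff_mul_le, mul_comm]
  exact hmk.trans hle

end Exponential

end MEstimation

namespace MEstimation

/-! ### Truncation -/

section Truncation

/-- The truncation of `q` where the envelope `y` exceeds `u`. -/
noncomputable def truncate {α : Type*} (y q : α → ℝ) (u : ℝ) (a : α) : ℝ := by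
  classical exact if y a ≤ u then q a else 0

theorem measurable_truncate {α : Type*} [MeasurableSpace α] {y q : α → ℝ} (hy : Measurable y)
    (hq : Measurable q) (u : ℝ) : Measurable (truncate y q u) := by
  classical
  exact Measurable.ite (measurableSet_le hy measurable_const) hq measurable_const

theorem abs_truncate_le {α : Type*} {y q : α → ℝ} (hq : ∀ a, |q a| ≤ y a) {u : ℝ} (hu : 0 ≤ u)
    (a : α) : |truncate y q u a| ≤ u := by
  unfold truncate
  split_ifs with h
  · exact (hq a).trans h
  · simpa using hu

theorem truncate_of_le {α : Type*} {y : α → ℝ} (q : α → ℝ) {u : ℝ} {a : α} (h : y a ≤ u) :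
    truncate y q u a = q a := by
  simp [truncate, h]

/-- Where the envelope exceeds u, |q| ≤ y ≤ y² / u, so truncation moves the mean by at most the
second moment over u. -/
theorem integral_truncate_bounds {α : Type*} [MeasurableSpace α] {ν : Measure α}
    [IsProbabilityMeasure ν] {y q : α → ℝ} (hy : Measurable y) (hq : Measurable q)
    (hqy : ∀ a, |q a| ≤ y a) {u : ℝ} (hu : 0 < u)
    (hfin : ∫⁻ a, ENNReal.ofReal (y a ^ 2) ∂ν < ∞) :
    |∫ a, q a ∂ν - ∫ a, truncate y q u a ∂ν|
        ≤ (∫⁻ a, ENNReal.ofReal (y a ^ 2) ∂ν).toReal / u ∧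
      ∫ a, truncate y q u a ^ 2 ∂ν ≤ (∫⁻ a, ENNReal.ofReal (y a ^ 2) ∂ν).toReal := by
  have hy2 : Integrable (fun a => y a ^ 2) ν := by
    refine ⟨(hy.pow_const 2).aestronglyMeasurable, ?_⟩
    rw [hasFiniteIntegral_iff_ofReal (ae_of_all _ fun a => sq_nonneg _)]
    exact hfin
  have hY : (∫⁻ a, ENNReal.ofReal (y a ^ 2) ∂ν).toReal = ∫ a, y a ^ 2 ∂ν :=
    (integral_eq_lintegral_of_nonneg_ae (ae_of_all _ fun a => sq_nonneg _)
      (hy.pow_const 2).aestronglyMeasurable).symm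
  have hqi : Integrable q ν := by
    refine Integrable.mono' ((integrable_const 1).add hy2) hq.aestronglyMeasurable
      (ae_of_all _ fun a => ?_)
    have h1 := hqy a
    simp only [Real.norm_eq_abs, Pi.add_apply]
    nlinarith [sq_nonneg (y a - 1), abs_nonneg (q a)]
  have htm := measurable_truncate hy hq u
  have hti : Integrable (truncate y q u) ν :=
    Integrable.of_bound htm.aestronglyMeasurable u
      (ae_of_all _ fun a => abs_truncate_le hqy hu.le a)
  refine ⟨?_, ?_⟩
  · rw [hY, ← integral_sub hqi hti, ← integral_div]
    refine (abs_integral_le_integral_abs).trans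
      (integral_mono (hqi.sub hti).abs (hy2.div_const u) fun a => ?_)
    beta_reduce
    unfold truncate
    split_ifs with h
    · simp only [sub_self, abs_zero]; positivity
    · rw [sub_zero, le_div_iff₀ hu]
      rw [not_le] at h
      nlinarith [hqy a, abs_nonneg (q a)]
  · rw [hY]
    refine integral_mono_of_nonneg (ae_of_all _ fun a => sq_nonneg _) hy2 (ae_of_all _ fun a => ?_)
    beta_reduce
    unfold truncate
    split_ifs with h
    · exact sq_le_sq' (neg_le_of_abs_le (hqy a)) (le_of_abs_le (hqy a))
    · simpa using sq_nonneg (y a)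

variable {Ω : Type*} [MeasurableSpace Ω] {P : Measure Ω} 
  {ε : ℤ → Ω → ℝ} {ε₀' : Ω → ℝ} {G : (ℕ → ℝ) → ℝ}

/-- The event that the envelopes and the sum of their conditional second moments are small. -/
def envelopeEvent (P : Measure Ω) (ε : ℤ → Ω → ℝ) (y : ℕ → (ℕ → ℝ) → ℝ) (N : ℕ) (u : ℝ) : Set Ω :=
  {ω | (∀ i ∈ Finset.Icc 1 N, y i (past ε (i : ℤ) ω) ≤ u) ∧
    ∑ i ∈ Finset.Icc 1 N, ∫⁻ a, ENNReal.ofReal (y i (consSeq a (past ε ((i : ℤ) - 1) ω)) ^ 2)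
      ∂(P.map (ε 0)) ≤ ENNReal.ofReal (u ^ 2)}

/-- The sum of the squared envelopes dominates their squared maximum and has the same expectation as
the sum of their conditional second moments. Markov's inequality for the total of the two sums gives
the factor 2. -/
theorem IsInnovationModel.measure_envelopeEvent_compl_le [IsProbabilityMeasure P]
    (hm : IsInnovationModel P ε ε₀' G)
    {y : ℕ → (ℕ → ℝ) → ℝ} (hy : ∀ i, Measurable (y i)) {N : ℕ}
    {u K s : ℝ} (hu : 0 < u)
    (hK : ∑ i ∈ Finset.Icc 1 N, ∫⁻ ω, ENNReal.ofReal (y i (past ε (i : ℤ) ω) ^ 2) ∂P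
      ≤ ENNReal.ofReal K) (hs : 2 * K ≤ s * u ^ 2) :
    P (envelopeEvent P ε y N u)ᶜ ≤ ENNReal.ofReal s := by
  have := hm.isProbabilityMeasure_innov
  set ν := P.map (ε 0)
  have hym : ∀ i : ℕ, Measurable fun ω => ENNReal.ofReal (y i (past ε (i : ℤ) ω) ^ 2) := fun i =>
    (((hy i).comp (hm.measurable_past _)).pow_const 2).ennreal_ofReal
  have hvm' : ∀ i : ℕ, Measurable fun s => ∫⁻ a, ENNReal.ofReal (y i (consSeq a s) ^ 2) ∂ν := by
    intro i
    have h : Measurable (fun z : ℝ × (ℕ → ℝ) => ENNReal.ofReal (y i (consSeq z.1 z.2) ^ 2)) :=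
      (((hy i).comp measurable_consSeq).pow_const 2).ennreal_ofReal
    exact h.lintegral_prod_left'
  have hvm : ∀ i : ℕ, Measurable fun ω =>
      ∫⁻ a, ENNReal.ofReal (y i (consSeq a (past ε ((i : ℤ) - 1) ω)) ^ 2) ∂ν := fun i =>
    (hvm' i).comp (hm.measurable_past _)
  let Z : Ω → ℝ≥0∞ := fun ω => ∑ i ∈ Finset.Icc 1 N, ENNReal.ofReal (y i (past ε (i : ℤ) ω) ^ 2)
    + ∑ i ∈ Finset.Icc 1 N,
      ∫⁻ a, ENNReal.ofReal (y i (consSeq a (past ε ((i : ℤ) - 1) ω)) ^ 2) ∂ν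
  have hZm : Measurable Z := (Finset.measurable_sum _ fun i _ => hym i).add
    (Finset.measurable_sum _ fun i _ => hvm i)
  have hZ : ∫⁻ ω, Z ω ∂P ≤ ENNReal.ofReal (2 * K) := by
    rw [lintegral_add_left (Finset.measurable_sum _ fun i _ => hym i),
      lintegral_finsetSum _ (fun i _ => hym i), lintegral_finsetSum _ (fun i _ => hvm i)]
    have e : ∀ i : ℕ, ∫⁻ ω, ∫⁻ a, ENNReal.ofReal (y i (consSeq a (past ε ((i : ℤ) - 1) ω)) ^ 2)
        ∂ν ∂P = ∫⁻ ω, ENNReal.ofReal (y i (past ε (i : ℤ) ω) ^ 2) ∂P := by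
      intro i
      rw [← hm.lintegral_innov_past (i : ℤ) (g := fun a s => ENNReal.ofReal (y i (consSeq a s) ^ 2))
        (((hy i).comp measurable_consSeq).pow_const 2).ennreal_ofReal]
      refine lintegral_congr fun ω => ?_
      rw [past_eq_consSeq (i : ℤ)]
    simp_rw [e]
    rw [← two_mul, ENNReal.ofReal_mul two_pos.le, ENNReal.ofReal_ofNat]
    gcongr
  have hu2 : ENNReal.ofReal (u ^ 2) ≠ 0 := by
    simp only [ne_eq, ENNReal.ofReal_eq_zero, not_le]; positivity
  have hsub : (envelopeEvent P ε y N u)ᶜ ⊆ {ω | ENNReal.ofReal (u ^ 2) ≤ Z ω} := by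
    intro ω hω
    rw [envelopeEvent, mem_compl_iff, mem_ofPred_eq, not_and_or] at hω
    rcases hω with h | h
    · push Not at h
      obtain ⟨i, hi, hlt⟩ := h
      refine le_trans (le_trans ?_ (Finset.single_le_sum
        (f := fun i : ℕ => ENNReal.ofReal (y i (past ε (i : ℤ) ω) ^ 2)) (fun _ _ => zero_le) hi)) le_self_add
      exact ENNReal.ofReal_le_ofReal (pow_le_pow_left₀ hu.le hlt.le 2)
    · exact (not_le.1 h).le.trans le_add_self
  have hmk := mul_meas_ge_le_lintegral (μ := P) hZm (ENNReal.ofReal (u ^ 2))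
  have h1 : ENNReal.ofReal (u ^ 2) * P (envelopeEvent P ε y N u)ᶜ
      ≤ ENNReal.ofReal (u ^ 2) * ENNReal.ofReal s := by
    calc _ ≤ ENNReal.ofReal (2 * K) := (mul_le_mul' le_rfl (measure_mono hsub)).trans (hmk.trans hZ)
      _ ≤ _ := by
        rw [← ENNReal.ofReal_mul (sq_nonneg _)]
        exact ENNReal.ofReal_le_ofReal (hs.trans_eq (mul_comm _ _))
  exact (ENNReal.mul_le_mul_iff_right hu2 ENNReal.ofReal_ne_top).1 h1

/-- On the envelope event, enveloped increments may be replaced by their truncations. -/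
theorem sum_truncate_bounds {y q : ℕ → (ℕ → ℝ) → ℝ} [IsProbabilityMeasure (P.map (ε 0))]
    (hy : ∀ i, Measurable (y i)) (hq : ∀ i, Measurable (q i)) (hqy : ∀ i s, |q i s| ≤ y i s)
    {N n : ℕ} (hn : n ≤ N) {u : ℝ} (hu : 0 < u) {ω : Ω} (hω : ω ∈ envelopeEvent P ε y N u) :
    |∑ i ∈ Finset.Icc 1 n,
        (q i (past ε (i : ℤ) ω) - predict (P.map (ε 0)) (q i) (past ε ((i : ℤ) - 1) ω))
      - ∑ i ∈ Finset.Icc 1 n, (truncate (y i) (q i) u (past ε (i : ℤ) ω)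
        - predict (P.map (ε 0)) (truncate (y i) (q i) u) (past ε ((i : ℤ) - 1) ω))| ≤ u ∧
    ∑ i ∈ Finset.Icc 1 n, predict (P.map (ε 0)) (fun s => truncate (y i) (q i) u s ^ 2)
        (past ε ((i : ℤ) - 1) ω) ≤ u ^ 2 := by
  obtain ⟨h1, h2⟩ := hω
  set ν := P.map (ε 0)
  let v : ℕ → ℝ≥0∞ := fun i =>
    ∫⁻ a, ENNReal.ofReal (y i (consSeq a (past ε ((i : ℤ) - 1) ω)) ^ 2) ∂ν
  have hsub : Finset.Icc 1 n ⊆ Finset.Icc 1 N := Finset.Icc_subset_Icc le_rfl hn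
  have hfin : ∀ i ∈ Finset.Icc 1 N, v i < ∞ := fun i hi =>
    ((Finset.single_le_sum (f := v) (fun _ _ => zero_le) hi).trans h2).trans_lt
      ENNReal.ofReal_lt_top
  have hsum : ∑ i ∈ Finset.Icc 1 n, (v i).toReal ≤ u ^ 2 := by
    rw [← ENNReal.toReal_sum fun i hi => (hfin i (hsub hi)).ne]
    refine ENNReal.toReal_le_of_le_ofReal (sq_nonneg _) (le_trans ?_ h2)
    exact Finset.sum_le_sum_of_subset hsub
  have hb : ∀ i ∈ Finset.Icc 1 n, _ := fun i hi =>
    integral_truncate_bounds (ν := ν) ((hy i).comp (measurable_consSeq_left _))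
      ((hq i).comp (measurable_consSeq_left _)) (fun a => hqy i _) hu (hfin i (hsub hi))
  constructor
  · rw [← Finset.sum_sub_distrib]
    refine (Finset.abs_sum_le_sum_abs _ _).trans ?_
    calc _ ≤ ∑ i ∈ Finset.Icc 1 n, (v i).toReal / u := by
          refine Finset.sum_le_sum fun i hi => ?_
          rw [truncate_of_le _ (h1 i (hsub hi))]
          refine le_trans (le_of_eq ?_) (hb i hi).1
          rw [← abs_neg]
          congr 1
          simp only [predict]
          ring_nf
          rfl
      _ ≤ u := by
          rw [← Finset.sum_div, div_le_iff₀ hu]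
          linarith
  · exact (Finset.sum_le_sum fun i hi => (hb i hi).2).trans hsum

/-- Exponential tail bound for the martingale with enveloped increments. -/
theorem IsInnovationModel.measure_enveloped_martingale_le [IsProbabilityMeasure P]
    (hm : IsInnovationModel P ε ε₀' G)
    {y q : ℕ → (ℕ → ℝ) → ℝ} (hy : ∀ i, Measurable (y i)) (hq : ∀ i, Measurable (q i))
    (hqy : ∀ i s, |q i s| ≤ y i s) {N n : ℕ} (hn : n ≤ N) {u : ℝ} (hu : 0 < u) (T : ℝ) :
    P (envelopeEvent P ε y N u ∩ {ω | T + u ≤ ∑ i ∈ Finset.Icc 1 n,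
        (q i (past ε (i : ℤ) ω) - predict (P.map (ε 0)) (q i) (past ε ((i : ℤ) - 1) ω))})
      ≤ ENNReal.ofReal (Real.exp (1 / 4 - T / (2 * u))) := by
  have := hm.isProbabilityMeasure_innov
  refine (measure_mono ?_).trans (hm.measure_martingale_ge_le
    (f := fun i => truncate (y i) (q i) u)
    (fun i => measurable_truncate (hy i) (hq i) u) hu
    (fun i s => abs_truncate_le (hqy i) hu.le s) n T)
  rintro ω ⟨h1, h2⟩
  obtain ⟨h3, h4⟩ := sum_truncate_bounds hy hq hqy hn hu h1
  refine ⟨?_, h4⟩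
  have := (abs_le.1 h3).2
  rw [mem_ofPred_eq] at h2
  linarith

end Truncation

end MEstimation

namespace MEstimation

/-! ### Finite nets, brackets and the Lipschitz modulus of the one-step prediction -/

section Brackets

/-- The grid of spacing 1/M, with coordinates rounded down. The error is bounded through the sum of
coordinates, and net points may leave the ball. -/
theorem exists_finite_net (p : ℕ) {M : ℕ} (hM : 0 < M) :
    ∃ F : Finset (EuclideanSpace ℝ (Fin p)), F.card ≤ (2 * M + 1) ^ p ∧
      ∀ β : EuclideanSpace ℝ (Fin p), ‖β‖ ≤ 1 → ∃ θ ∈ F, ‖β - θ‖ ≤ p / M := by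
  classical
  have hM' : (0 : ℝ) < M := by exact_mod_cast hM
  let g : (Fin p → ℤ) → EuclideanSpace ℝ (Fin p) := fun z => WithLp.toLp 2 fun k => (z k : ℝ) / M
  refine ⟨(Fintype.piFinset fun _ : Fin p => Finset.Icc (-(M : ℤ)) M).image g, ?_, fun β hβ => ?_⟩
  · refine Finset.card_image_le.trans ?_
    rw [Fintype.card_piFinset_const, Int.card_Icc]
    refine le_of_eq ?_
    congr 1; omega
  · refine ⟨g fun k => ⌊β k * M⌋, Finset.mem_image_of_mem _ (Fintype.mem_piFinset.2 fun k => ?_), ?_⟩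
    · have h1 := abs_le.1 ((abs_apply_le_norm β k).trans hβ)
      rw [Finset.mem_Icc]
      constructor
      · rw [Int.le_floor]; push_cast; nlinarith
      · have h2 : ((⌊β k * M⌋ : ℤ) : ℝ) ≤ M := (Int.floor_le _).trans (by nlinarith)
        exact_mod_cast h2
    · refine (norm_le_of_forall_abs_apply_le (C := 1 / M) fun k => ?_).trans_eq (by ring)
      have h1 := Int.floor_le (β k * M)
      have h2 := Int.lt_floor_add_one (β k * M)
      have e : (β - g fun k => ⌊β k * M⌋) k = (β k * M - ⌊β k * M⌋) / M := by
        simp only [g, PiLp.sub_apply]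
        field_simp
      rw [e, abs_div, abs_of_pos hM']
      gcongr
      rw [abs_of_nonneg (by linarith)]
      linarith

/-- A sum of differences of monotone functions and Lipschitz functions is controlled by its values
at the end points of the brackets. -/
theorem abs_sum_le_of_brackets {κ : Type*} (I : Finset κ) {w ℓ a t c : κ → ℝ}
    {f h : κ → ℝ → ℝ} (hf : ∀ i ∈ I, Monotone (f i)) (hw : ∀ i ∈ I, 0 ≤ w i)
    (hat : ∀ i ∈ I, a i ≤ t i) (htc : ∀ i ∈ I, t i ≤ c i)
    (hha : ∀ i ∈ I, |h i (t i) - h i (a i)| ≤ ℓ i) (hhc : ∀ i ∈ I, |h i (t i) - h i (c i)| ≤ ℓ i)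
    {A E : ℝ} (hE : ∑ i ∈ I, w i * ℓ i ≤ E) {b : κ → ℝ}
    (hA : -A ≤ ∑ i ∈ I, w i * (f i (a i) - h i (a i) - b i))
    (hC : ∑ i ∈ I, w i * (f i (c i) - h i (c i) - b i) ≤ A) :
    |∑ i ∈ I, w i * (f i (t i) - h i (t i) - b i)| ≤ A + E := by
  rw [abs_le]
  constructor
  · have h1 : ∑ i ∈ I, w i * (f i (a i) - h i (a i) - b i) - ∑ i ∈ I, w i * ℓ i
        ≤ ∑ i ∈ I, w i * (f i (t i) - h i (t i) - b i) := by
      rw [← Finset.sum_sub_distrib]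
      refine Finset.sum_le_sum fun i hi => ?_
      rw [← mul_sub]
      refine mul_le_mul_of_nonneg_left ?_ (hw i hi)
      linarith [hf i hi (hat i hi), (abs_le.1 (hha i hi)).2]
    linarith
  · have h1 : ∑ i ∈ I, w i * (f i (t i) - h i (t i) - b i)
        ≤ ∑ i ∈ I, w i * (f i (c i) - h i (c i) - b i) + ∑ i ∈ I, w i * ℓ i := by
      rw [← Finset.sum_add_distrib]
      refine Finset.sum_le_sum fun i hi => ?_
      rw [← mul_add]
      refine mul_le_mul_of_nonneg_left ?_ (hw i hi)
      linarith [hf i hi (htc i hi), (abs_le.1 (hhc i hi)).1]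
    linarith

variable {Ω : Type*} [MeasurableSpace Ω] {P : Measure Ω} {ε : ℤ → Ω → ℝ} {ε₀' : Ω → ℝ}
  {G : (ℕ → ℝ) → ℝ} {ρ ψ : ℝ → ℝ}

/-- The Lipschitz modulus of `t ↦ oneStep t s` over the rationals of `(-δ, δ)`. -/
noncomputable def lipSup (P : Measure Ω) (ε : ℤ → Ω → ℝ) (G : (ℕ → ℝ) → ℝ) (ψ : ℝ → ℝ)
    (δ : ℝ) (s : ℕ → ℝ) : ℝ≥0∞ :=
  ⨆ (a : ℚ) (b : ℚ) (_ : |(a : ℝ)| < δ ∧ |(b : ℝ)| < δ ∧ (a : ℝ) ≠ b),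
    ENNReal.ofReal (|oneStep P ε G ψ a s - oneStep P ε G ψ b s| / |(a : ℝ) - b|)

/-- The supremum is taken over rationals for the sake of measurability; density and continuity
extend the Lipschitz bound to all reals, one variable at a time. -/
theorem abs_oneStep_sub_le {δ : ℝ} {s : ℕ → ℝ} (hc : Continuous fun t => oneStep P ε G ψ t s)
    (hfin : lipSup P ε G ψ δ s ≠ ∞) {t t' : ℝ} (ht : |t| < δ) (ht' : |t'| < δ) :
    |oneStep P ε G ψ t s - oneStep P ε G ψ t' s| ≤ (lipSup P ε G ψ δ s).toReal * |t - t'| := by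
  set L := (lipSup P ε G ψ δ s).toReal
  set h : ℝ → ℝ := fun t => oneStep P ε G ψ t s with hh
  have hQ : Dense (range ((↑) : ℚ → ℝ)) := Rat.denseRange_cast
  have hU : Ioo (-δ) δ ⊆ closure (Ioo (-δ) δ ∩ range ((↑) : ℚ → ℝ)) :=
    hQ.open_subset_closure_inter isOpen_Ioo
  have hrat : ∀ a ∈ Ioo (-δ) δ ∩ range ((↑) : ℚ → ℝ), ∀ b ∈ Ioo (-δ) δ ∩ range ((↑) : ℚ → ℝ),
      |h a - h b| ≤ L * |a - b| := by
    rintro _ ⟨ha, a, rfl⟩ _ ⟨hb, b, rfl⟩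
    by_cases hab : (a : ℝ) = b
    · simp [hab]
    have h1 : ENNReal.ofReal (|h a - h b| / |(a : ℝ) - b|) ≤ lipSup P ε G ψ δ s :=
      le_iSup_of_le a (le_iSup_of_le b (le_iSup_of_le ⟨abs_lt.2 ha, abs_lt.2 hb, hab⟩ le_rfl))
    rw [ENNReal.ofReal_le_iff_le_toReal hfin, div_le_iff₀ (abs_pos.2 (sub_ne_zero.2 hab))] at h1
    exact h1
  have hhc : Continuous h := hc
  have hleft : ∀ a ∈ Ioo (-δ) δ, ∀ b ∈ Ioo (-δ) δ ∩ range ((↑) : ℚ → ℝ),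
      |h a - h b| ≤ L * |a - b| := by
    intro a ha b hb
    have hcl : IsClosed {a | |h a - h b| ≤ L * |a - b|} :=
      isClosed_le (by fun_prop) (by fun_prop)
    exact hcl.closure_subset_iff.2 (fun a ha => hrat a ha b hb) (hU ha)
  have hcl : IsClosed {b | |h t - h b| ≤ L * |t - b|} :=
    isClosed_le (by fun_prop) (by fun_prop)
  exact hcl.closure_subset_iff.2 (fun b hb => hleft t (abs_lt.1 ht) b hb) (hU (abs_lt.1 ht'))

variable [IsProbabilityMeasure P]

theorem measurable_lipSup (hm : IsInnovationModel P ε ε₀' G) (hψ : Measurable ψ) (δ : ℝ) :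
    Measurable (lipSup P ε G ψ δ) := by
  have := hm.isProbabilityMeasure_innov
  have h : ∀ t : ℝ, Measurable (oneStep P ε G ψ t) := fun t =>
    measurable_predict (hψ.comp (hm.measurable_filter.add_const t))
  exact .iSup fun a => .iSup fun b => .iSup_Prop _
    ((((h a).sub (h b)).abs.div_const _).ennreal_ofReal)

theorem exists_lintegral_lipSup_lt_top (hm : IsInnovationModel P ε ε₀' G) (hψ : Measurable ψ)
    (hA5 : CondA5 P ε G ψ) :
    ∃ δ : ℝ, 0 < δ ∧ ∫⁻ s, lipSup P ε G ψ δ s ∂(P.map (past ε 0)) < ∞ := by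
  obtain ⟨δ, hδ, h⟩ := hA5
  refine ⟨δ, hδ, ?_⟩
  rw [← hm.lintegral_past 0 (measurable_lipSup hm hψ δ)]
  refine (lintegral_mono_ae ?_).trans_lt (h 0)
  filter_upwards [psiStep_one_past_ae_eq hm hψ 0] with ω hω
  refine iSup_le fun a => iSup_le fun b => iSup_le fun hab => ?_
  rw [← hω, ← hω]
  exact le_iSup_of_le (a : ℝ) (le_iSup_of_le (b : ℝ)
    (le_iSup_of_le ⟨hab.1.le, hab.2.1.le, hab.2.2⟩ le_rfl))

theorem ae_continuous_oneStep (hm : IsInnovationModel P ε ε₀' G) (hψ : Measurable ψ)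
    (hA6 : CondA6 P ε ε₀' G ψ 0) :
    ∀ᵐ ω ∂P, ∀ i : ℤ, Continuous fun t => oneStep P ε G ψ t (past ε i ω) := by
  rw [ae_all_iff]
  intro i
  obtain ⟨A, -, hA, h⟩ := exists_smooth_event hm hψ hA6 i
  filter_upwards [hA] with ω hω
  exact (h ω hω).1.continuous

theorem ae_integrable_innov (hm : IsInnovationModel P ε ε₀' G) (hψ : Measurable ψ) {t : ℝ}
    (h : MemLp (fun ω => ψ (err G ε 1 ω + t)) 2 P) (i : ℤ) :
    ∀ᵐ ω ∂P, Integrable (fun a => ψ (G (consSeq a (past ε (i - 1) ω)) + t)) (P.map (ε 0)) := by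
  have := hm.isProbabilityMeasure_innov
  have hi := (hm.memLp_score hψ h i).integrable one_le_two
  have hf : Measurable fun s => ψ (G s + t) := hψ.comp (hm.measurable_filter.add_const t)
  have hg : Measurable (fun z : ℝ × (ℕ → ℝ) => ‖ψ (G (consSeq z.1 z.2) + t)‖ₑ) :=
    (hf.comp measurable_consSeq).enorm
  have h1 := hm.lintegral_innov_past i (g := fun a s => ‖ψ (G (consSeq a s) + t)‖ₑ) hg
  have h2 : ∫⁻ ω, ‖ψ (G (consSeq (ε i ω) (past ε (i - 1) ω)) + t)‖ₑ ∂P < ∞ := by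
    have := hi.2
    rw [hasFiniteIntegral_iff_enorm] at this
    refine lt_of_le_of_lt (le_of_eq ?_) this
    refine lintegral_congr fun ω => ?_
    rw [err, past_eq_consSeq i ω]
  rw [h1] at h2
  filter_upwards [ae_lt_top ((hg.lintegral_prod_left').comp (hm.measurable_past _)) h2.ne] with ω hω
  refine ⟨(hf.comp (measurable_consSeq_left _)).aestronglyMeasurable, ?_⟩
  rw [hasFiniteIntegral_iff_enorm]
  exact hω

/-- By monotonicity the scores shifted by r and by -r dominate every intermediate shift, so a single
null set serves all t. -/
theorem exists_ae_integrable_innov (hm : IsInnovationModel P ε ε₀' G) (hψ : Measurable ψ)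
    (hmono : Monotone ψ) (hA1 : CondA1 P ε G ρ ψ) (hA3 : CondA3 P ε G ψ) :
    ∃ r : ℝ, 0 < r ∧ ∀ᵐ ω ∂P, ∀ i : ℤ, ∀ t : ℝ, |t| ≤ r →
      Integrable (fun a => ψ (G (consSeq a (past ε (i - 1) ω)) + t)) (P.map (ε 0)) := by
  obtain ⟨r, hr, h⟩ := exists_memLp_radius hm hψ hA1 hA3
  refine ⟨r, hr, ?_⟩
  filter_upwards [ae_all_iff.2 fun i => ae_integrable_innov hm hψ (h r (abs_of_pos hr).le) i,
    ae_all_iff.2 fun i => ae_integrable_innov hm hψ (h (-r) (by rw [abs_neg, abs_of_pos hr])) i]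
    with ω h1 h2 i t ht
  have hf : Measurable fun s => ψ (G s + t) := hψ.comp (hm.measurable_filter.add_const t)
  refine Integrable.mono' ((h1 i).abs.add (h2 i).abs)
    (hf.comp (measurable_consSeq_left _)).aestronglyMeasurable (ae_of_all _ fun a => ?_)
  obtain ⟨h3, h4⟩ := abs_le.1 ht
  have h5 : ψ (G (consSeq a (past ε (i - 1) ω)) + t) ≤ ψ (G (consSeq a (past ε (i - 1) ω)) + r) :=
    hmono (by linarith)
  have h6 : ψ (G (consSeq a (past ε (i - 1) ω)) + -r) ≤ ψ (G (consSeq a (past ε (i - 1) ω)) + t) :=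
    hmono (by linarith)
  exact (abs_le_max_abs_abs h6 h5).trans ((max_le_add_of_nonneg (abs_nonneg _)
    (abs_nonneg _)).trans_eq (add_comm _ _))

end Brackets

end MEstimation

namespace MEstimation

/-! ### The martingale part of the M-process -/

section Martingale

variable {Ω : Type*} [MeasurableSpace Ω] {P : Measure Ω} {ε : ℤ → Ω → ℝ} {ε₀' : Ω → ℝ}
  {G : (ℕ → ℝ) → ℝ} {ρ ψ : ℝ → ℝ} {p : ℕ} {x : ℕ → EuclideanSpace ℝ (Fin p)} {ι q : ℝ}

/-- An envelope for the increments of the weighted scores. -/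
def scoreEnvelope (G : (ℕ → ℝ) → ℝ) (ψ : ℝ → ℝ) (c δ : ℝ) (s : ℕ → ℝ) : ℝ :=
  c * (|ψ (G s + c * δ) - ψ (G s)| + |ψ (G s + -(c * δ)) - ψ (G s)|)

theorem measurable_scoreEnvelope (hG : Measurable G) (hψ : Measurable ψ) (c δ : ℝ) :
    Measurable (scoreEnvelope G ψ c δ) := by
  have h : ∀ t : ℝ, Measurable fun s => |ψ (G s + t) - ψ (G s)| := fun t =>
    ((hψ.comp (hG.add_const t)).sub (hψ.comp hG)).abs
  exact ((h _).add (h _)).const_mul c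

theorem abs_mul_score_sub_le_scoreEnvelope (hmono : Monotone ψ) {c δ w t : ℝ} (hw : |w| ≤ c)
    (ht : |t| ≤ c * δ) (s : ℕ → ℝ) :
    |w * (ψ (G s + t) - ψ (G s))| ≤ scoreEnvelope G ψ c δ s := by
  obtain ⟨h1, h2⟩ := abs_le.1 ht
  have h3 : ψ (G s + t) ≤ ψ (G s + c * δ) := hmono (by linarith)
  have h4 : ψ (G s + -(c * δ)) ≤ ψ (G s + t) := hmono (by linarith)
  have h5 : |ψ (G s + t) - ψ (G s)|
      ≤ |ψ (G s + c * δ) - ψ (G s)| + |ψ (G s + -(c * δ)) - ψ (G s)| := by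
    refine (abs_le_max_abs_abs (sub_le_sub_right h4 _) (sub_le_sub_right h3 _)).trans ?_
    exact (max_le_add_of_nonneg (abs_nonneg _) (abs_nonneg _)).trans_eq (add_comm _ _)
  rw [abs_mul]
  exact mul_le_mul hw h5 (abs_nonneg _) ((abs_nonneg _).trans hw)

theorem lintegral_score_sub_sq [IsProbabilityMeasure P] (hm : IsInnovationModel P ε ε₀' G)
    (hψ : Measurable ψ) (t : ℝ) (i : ℤ) :
    ∫⁻ ω, ENNReal.ofReal ((ψ (G (past ε i ω) + t) - ψ (G (past ε i ω))) ^ 2) ∂P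
      = mMod P ε G ψ t ^ 2 := by
  have hf : Measurable fun s => ENNReal.ofReal ((ψ (G s + t) - ψ (G s)) ^ 2) :=
    (((hψ.comp (hm.measurable_filter.add_const t)).sub
      (hψ.comp hm.measurable_filter)).pow_const 2).ennreal_ofReal
  rw [mMod, eLpNorm_two_sq, hm.lintegral_past i hf, ← hm.lintegral_past 1 hf]
  refine lintegral_congr fun ω => ?_
  rw [Real.enorm_eq_ofReal_abs, ← ENNReal.ofReal_pow (abs_nonneg _), sq_abs]
  rfl

theorem lintegral_scoreEnvelope_sq_le [IsProbabilityMeasure P] (hm : IsInnovationModel P ε ε₀' G)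
    (hψ : Measurable ψ) {c δ : ℝ} (h1 : mMod P ε G ψ (c * δ) ≠ ∞)
    (h2 : mMod P ε G ψ (-(c * δ)) ≠ ∞) (i : ℤ) :
    ∫⁻ ω, ENNReal.ofReal (scoreEnvelope G ψ c δ (past ε i ω) ^ 2) ∂P
      ≤ ENNReal.ofReal (2 * (c ^ 2 * ((mMod P ε G ψ (c * δ)).toReal ^ 2
        + (mMod P ε G ψ (-(c * δ))).toReal ^ 2))) := by
  have hf : ∀ t : ℝ, Measurable fun ω =>
      ENNReal.ofReal ((ψ (G (past ε i ω) + t) - ψ (G (past ε i ω))) ^ 2) := fun t =>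
    ((((hψ.comp (hm.measurable_filter.add_const t)).sub
      (hψ.comp hm.measurable_filter)).pow_const 2).ennreal_ofReal).comp (hm.measurable_past i)
  have e : ∀ t, mMod P ε G ψ t ≠ ∞ →
      ∫⁻ ω, ENNReal.ofReal ((ψ (G (past ε i ω) + t) - ψ (G (past ε i ω))) ^ 2) ∂P
        = ENNReal.ofReal ((mMod P ε G ψ t).toReal ^ 2) := by
    intro t ht
    rw [lintegral_score_sub_sq hm hψ, ENNReal.ofReal_pow ENNReal.toReal_nonneg,
      ENNReal.ofReal_toReal ht]
  calc _ ≤ ∫⁻ ω, ENNReal.ofReal (2 * c ^ 2) *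
        (ENNReal.ofReal ((ψ (G (past ε i ω) + c * δ) - ψ (G (past ε i ω))) ^ 2)
          + ENNReal.ofReal ((ψ (G (past ε i ω) + -(c * δ)) - ψ (G (past ε i ω))) ^ 2)) ∂P := by
        refine lintegral_mono fun ω => ?_
        rw [← ENNReal.ofReal_add (sq_nonneg _) (sq_nonneg _), ← ENNReal.ofReal_mul (by positivity)]
        refine ENNReal.ofReal_le_ofReal ?_
        unfold scoreEnvelope
        set A := ψ (G (past ε i ω) + c * δ) - ψ (G (past ε i ω))
        set B := ψ (G (past ε i ω) + -(c * δ)) - ψ (G (past ε i ω))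
        have h3 := sq_abs A
        have h4 := sq_abs B
        rw [← h3, ← h4, mul_pow, mul_comm 2, mul_assoc]
        refine mul_le_mul_of_nonneg_left ?_ (sq_nonneg c)
        nlinarith [sq_nonneg (|A| - |B|)]
    _ = _ := by
        rw [lintegral_const_mul' _ _ ENNReal.ofReal_ne_top, lintegral_add_left (hf _), e _ h1, e _ h2,
          ← ENNReal.ofReal_add (sq_nonneg _) (sq_nonneg _), ← ENNReal.ofReal_mul (by positivity)]
        congr 1; ring

/-- The truncation level for the martingale part. -/
noncomputable def truncLevel (P : Measure Ω) (ε : ℤ → Ω → ℝ) (G : (ℕ → ℝ) → ℝ) (ψ : ℝ → ℝ)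
    (x : ℕ → EuclideanSpace ℝ (Fin p)) (ι q : ℝ) (n : ℕ) : ℝ :=
  √(tauTilde P ε G ψ x n (2 * bSeq ι n)) * Real.log n ^ (q - 1) + 1 / Real.log n

theorem tauTilde_nonneg (n : ℕ) (δ : ℝ) : 0 ≤ tauTilde P ε G ψ x n δ :=
  Finset.sum_nonneg fun _ _ => by positivity

theorem truncLevel_pos {n : ℕ} (hn : 0 < Real.log n) : 0 < truncLevel P ε G ψ x ι q n := by
  unfold truncLevel; positivity

/-- The union bound costs one factor log n, which completes the exponent q - 1 to q. The summand 1 /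
log n keeps the level positive when τ̃ vanishes and contributes only 1. -/
theorem truncLevel_mul_log {n : ℕ} (hn : 0 < Real.log n) :
    truncLevel P ε G ψ x ι q n * Real.log n = LSeq P ε G ψ x ι q n + 1 := by
  unfold truncLevel LSeq
  rw [add_mul, mul_assoc, ← Real.rpow_add_one hn.ne', sub_add_cancel, one_div_mul_cancel hn.ne']

theorem log_two_pow (d : ℕ) : Real.log ((2 ^ d : ℕ) : ℝ) = d * Real.log 2 := by
  push_cast; rw [Real.log_pow]

theorem summable_two_pow_inv : Summable fun d : ℕ => (((2 ^ d : ℕ) : ℝ))⁻¹ := by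
  have := summable_geometric_of_lt_one (r := (1 / 2 : ℝ)) (by norm_num) (by norm_num)
  refine this.congr fun d => ?_
  push_cast
  rw [one_div, inv_pow]

theorem exists_mMod_ne_top (hA3 : CondA3 P ε G ψ) :
    ∃ r : ℝ, 0 < r ∧ ∀ t, |t| ≤ r → mMod P ε G ψ t ≠ ∞ := by
  have h0 : mMod P ε G ψ 0 = 0 := by simp [mMod]
  have h1 : ∀ᶠ t in 𝓝 (0 : ℝ), mMod P ε G ψ t < 1 := by
    have h2 : Tendsto (mMod P ε G ψ) (𝓝 0) (𝓝 0) := h0 ▸ hA3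
    exact h2.eventually_lt_const (by norm_num)
  obtain ⟨r, hr, h⟩ := Metric.eventually_nhds_iff.1 h1
  refine ⟨r / 2, by positivity, fun t ht => ((h (y := t) ?_).trans ENNReal.one_lt_top).ne⟩
  rw [Real.dist_0_eq_abs]; linarith

variable [IsProbabilityMeasure P]

/-- The failure probability is at most 4 τ̃ / u² ≤ 4 (d log 2)^{-(2q-2)} along n = 2^d. This is
summable because 2q - 2 > 1, that is, q > 3/2. -/
theorem ae_eventually_mem_envelopeEvent (hm : IsInnovationModel P ε ε₀' G) (hψ : Measurable ψ)
    (hA3 : CondA3 P ε G ψ)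
    (hr : (fun n : ℕ => rTilde x n) =O[atTop]
      fun n : ℕ => (n : ℝ) ^ (1 / 2 : ℝ) * Real.log n ^ (-2 : ℝ)) (hq : 3 / 2 < q) :
    ∀ᵐ ω ∂P, ∀ᶠ d : ℕ in atTop, ω ∈ envelopeEvent P ε
      (fun i => scoreEnvelope G ψ ‖x i‖ (2 * bSeq ι (2 ^ d))) (2 ^ d)
      (truncLevel P ε G ψ x ι q (2 ^ d)) := by
  obtain ⟨r, hr0, hfin⟩ := exists_mMod_ne_top hA3
  have hsum : Summable fun d : ℕ => 4 * ((d : ℝ) * Real.log 2) ^ (-(2 * q - 2)) := by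
    have h2 := (Real.summable_nat_rpow (p := -(2 * q - 2))).2 (by linarith)
    refine ((h2.mul_right (Real.log 2 ^ (-(2 * q - 2)))).mul_left 4).congr fun d => ?_
    rw [Real.mul_rpow d.cast_nonneg (Real.log_nonneg one_le_two)]
  have hlog2 := Real.log_nonneg one_le_two
  have key := ae_eventually_notMem_of_le (P := P) (E := fun d => (envelopeEvent P ε
      (fun i => scoreEnvelope G ψ ‖x i‖ (2 * bSeq ι (2 ^ d))) (2 ^ d)
      (truncLevel P ε G ψ x ι q (2 ^ d)))ᶜ) (fun d => by positivity) hsum ?_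
  · filter_upwards [key] with ω hω
    filter_upwards [hω] with d hd
    exact not_notMem.1 hd
  · have hbpos : ∀ᶠ d : ℕ in atTop, 0 < bSeq ι (2 ^ d) :=
      tendsto_two_pow.eventually (eventually_logRate_pos (-(1 / 2)) (3 / 2) (1 / 2 + ι))
    filter_upwards [tendsto_two_pow.eventually eventually_logs_pos, hbpos,
      ((tendsto_rTilde_mul_bSeq (x := x) (ι := ι) hr).comp tendsto_two_pow).eventually_lt_const
        (show (0 : ℝ) < r / 2 by positivity)] with d ⟨h1, h2, h3⟩ hb hrb
    refine hm.measure_envelopeEvent_compl_le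
      (fun i => measurable_scoreEnvelope hm.measurable_filter hψ _ _) (truncLevel_pos h2)
      (K := 2 * tauTilde P ε G ψ x (2 ^ d) (2 * bSeq ι (2 ^ d))) ?_ ?_
    · rw [tauTilde, Finset.mul_sum, ENNReal.ofReal_sum_of_nonneg fun i _ => by positivity]
      refine Finset.sum_le_sum fun i hi => ?_
      have hle : |‖x i‖ * (2 * bSeq ι (2 ^ d))| ≤ r := by
        rw [abs_of_nonneg (by positivity)]
        have h4 := mul_le_mul_of_nonneg_right (norm_le_rTilde x hi) hb.le
        simp only [Function.comp_apply] at hrb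
        linarith
      exact lintegral_scoreEnvelope_sq_le hm hψ (hfin _ hle) (hfin _ (by rwa [abs_neg])) i
    · rw [← log_two_pow]
      set τ := tauTilde P ε G ψ x (2 ^ d) (2 * bSeq ι (2 ^ d)) with hτ
      set l := Real.log ((2 ^ d : ℕ) : ℝ) with hl
      have hτ0 : 0 ≤ τ := tauTilde_nonneg _ _
      have h5 : √τ * l ^ (q - 1) ≤ truncLevel P ε G ψ x ι q (2 ^ d) := by
        rw [truncLevel, ← hτ, ← hl]
        have : 0 ≤ 1 / l := by positivity
        linarith
      have h6 : τ * l ^ (2 * q - 2) ≤ truncLevel P ε G ψ x ι q (2 ^ d) ^ 2 := by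
        refine le_trans (le_of_eq ?_) (pow_le_pow_left₀ (by positivity) h5 2)
        rw [mul_pow, Real.sq_sqrt hτ0, ← Real.rpow_natCast (l ^ (q - 1)), ← Real.rpow_mul h2.le]
        congr 2; push_cast; ring
      have h7 := mul_le_mul_of_nonneg_left h6
        (by positivity : 0 ≤ 4 * l ^ (-(2 * q - 2)))
      refine le_trans (le_of_eq ?_) h7
      rw [Real.rpow_neg h2.le]
      have : 0 < l ^ (2 * q - 2) := Real.rpow_pos_of_pos h2 _
      rw [show 4 * (l ^ (2 * q - 2))⁻¹ * (τ * l ^ (2 * q - 2))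
        = 4 * τ * ((l ^ (2 * q - 2))⁻¹ * l ^ (2 * q - 2)) by ring, inv_mul_cancel₀ this.ne']
      ring

end Martingale

end MEstimation

namespace MEstimation

/-! ### Bracketing sums over the net and the Lipschitz error -/

section Oscillation

variable {Ω : Type*} [MeasurableSpace Ω] {P : Measure Ω} {ε : ℤ → Ω → ℝ} {ε₀' : Ω → ℝ}
  {G : (ℕ → ℝ) → ℝ} {ρ ψ : ℝ → ℝ} {p : ℕ} {x : ℕ → EuclideanSpace ℝ (Fin p)} {ι q : ℝ}

/-- The signed weighted score increment at an end point of a bracket around `θ`: `σ.1` selects the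
positive or negative part of the weight, `σ.2.1` the sign and `σ.2.2` the end point. -/
noncomputable def bracketIncr (G : (ℕ → ℝ) → ℝ) (ψ : ℝ → ℝ) (x : ℕ → EuclideanSpace ℝ (Fin p)) (η : ℝ)
    (θ : EuclideanSpace ℝ (Fin p)) (k : Fin p) (σ : ℝ × ℝ × ℝ) (i : ℕ) (s : ℕ → ℝ) : ℝ :=
  σ.2.1 * max (σ.1 * x i k) 0 *
    (ψ (G s + (-inner ℝ (x i) θ + σ.2.2 * (‖x i‖ * η))) - ψ (G s))

/-- The triples of signs. -/
noncomputable def signTriples : Finset (ℝ × ℝ × ℝ) := by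
  classical exact {1, -1} ×ˢ ({1, -1} ×ˢ {1, -1})

theorem mem_signTriples {σ : ℝ × ℝ × ℝ} : σ ∈ signTriples ↔
    (σ.1 = 1 ∨ σ.1 = -1) ∧ (σ.2.1 = 1 ∨ σ.2.1 = -1) ∧ (σ.2.2 = 1 ∨ σ.2.2 = -1) := by
  simp [signTriples, Finset.mem_product]

theorem card_signTriples_le : signTriples.card ≤ 8 := by
  classical
  have h : (({1, -1} : Finset ℝ)).card ≤ 2 := Finset.card_le_two
  simp only [signTriples, Finset.card_product]
  nlinarith [Nat.mul_le_mul h h, Nat.mul_le_mul h (Nat.mul_le_mul h h)]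

theorem measurable_bracketIncr (hG : Measurable G) (hψ : Measurable ψ) (η : ℝ)
    (θ : EuclideanSpace ℝ (Fin p)) (k : Fin p) (σ : ℝ × ℝ × ℝ) (i : ℕ) :
    Measurable (bracketIncr G ψ x η θ k σ i) :=
  ((hψ.comp (hG.add_const _)).sub (hψ.comp hG)).const_mul _

theorem abs_max_mul_apply_le {a : ℝ} (ha : |a| = 1) (v : EuclideanSpace ℝ (Fin p)) (k : Fin p) :
    max (a * v k) 0 ≤ ‖v‖ := by
  refine max_le ((le_abs_self _).trans ?_) (norm_nonneg _)
  rw [abs_mul, ha, one_mul]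
  exact abs_apply_le_norm v k

theorem abs_bracketIncr_le (hmono : Monotone ψ) {η b : ℝ} (hη : 0 ≤ η)
    {θ : EuclideanSpace ℝ (Fin p)} (hθ : ‖θ‖ + η ≤ 2 * b) (k : Fin p) {σ : ℝ × ℝ × ℝ}
    (hσ : σ ∈ signTriples) (i : ℕ) (s : ℕ → ℝ) :
    |bracketIncr G ψ x η θ k σ i s| ≤ scoreEnvelope G ψ ‖x i‖ (2 * b) s := by
  obtain ⟨h1, h2, h3⟩ := mem_signTriples.1 hσ
  have habs : ∀ {a : ℝ}, a = 1 ∨ a = -1 → |a| = 1 := by rintro a (rfl | rfl) <;> simp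
  refine abs_mul_score_sub_le_scoreEnvelope hmono ?_ ?_ s
  · rw [abs_mul, habs h2, one_mul, abs_of_nonneg (le_max_right _ _)]
    exact abs_max_mul_apply_le (habs h1) _ _
  · calc |(-inner ℝ (x i) θ + σ.2.2 * (‖x i‖ * η))|
        ≤ |(-inner ℝ (x i) θ)| + |σ.2.2 * (‖x i‖ * η)| := abs_add_le _ _
      _ ≤ ‖x i‖ * ‖θ‖ + ‖x i‖ * η := by
          rw [abs_neg, abs_mul, habs h3, one_mul, abs_of_nonneg (mul_nonneg (norm_nonneg _) hη)]
          exact add_le_add (abs_real_inner_le_norm _ _) le_rfl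
      _ ≤ ‖x i‖ * (2 * b) := by
          rw [← mul_add]
          exact mul_le_mul_of_nonneg_left hθ (norm_nonneg _)

/-- The event that some bracketing sum exceeds the level `T + u`. -/
def bracketEvent (P : Measure Ω) (ε : ℤ → Ω → ℝ) (G : (ℕ → ℝ) → ℝ) (ψ : ℝ → ℝ)
    (x : ℕ → EuclideanSpace ℝ (Fin p)) (F : Finset (EuclideanSpace ℝ (Fin p))) (b η : ℝ) (N : ℕ)
    (T u : ℝ) : Set Ω :=
  {ω | ∃ θ ∈ F, ‖θ‖ + η ≤ 2 * b ∧ ∃ n ≤ N, ∃ k, ∃ σ ∈ signTriples,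
    T + u ≤ ∑ i ∈ Finset.Icc 1 n, (bracketIncr G ψ x η θ k σ i (past ε (i : ℤ) ω)
      - predict (P.map (ε 0)) (bracketIncr G ψ x η θ k σ i) (past ε ((i : ℤ) - 1) ω))}

variable [IsProbabilityMeasure P]

/-- A union bound over net points, sample sizes n ≤ N, coordinates and signs. The exponential tail
is strong enough to treat every n separately, with no maximal inequality. -/
theorem measure_bracketEvent_le (hm : IsInnovationModel P ε ε₀' G) (hψ : Measurable ψ)
    (hmono : Monotone ψ) (F : Finset (EuclideanSpace ℝ (Fin p))) {b η : ℝ} (hη : 0 ≤ η) (N : ℕ)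
    (T : ℝ) {u : ℝ} (hu : 0 < u) :
    P (envelopeEvent P ε (fun i => scoreEnvelope G ψ ‖x i‖ (2 * b)) N u
        ∩ bracketEvent P ε G ψ x F b η N T u)
      ≤ ENNReal.ofReal (F.card * (N + 1) * p * 8 * Real.exp (1 / 4 - T / (2 * u))) := by
  classical
  set E := envelopeEvent P ε (fun i => scoreEnvelope G ψ ‖x i‖ (2 * b)) N u with hE
  let K : Finset (EuclideanSpace ℝ (Fin p) × ℕ × Fin p × (ℝ × ℝ × ℝ)) := (F.filter fun θ => ‖θ‖ + η ≤ 2 * b) ×ˢ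
    (Finset.range (N + 1) ×ˢ (Finset.univ ×ˢ signTriples))
  let B : EuclideanSpace ℝ (Fin p) × ℕ × Fin p × (ℝ × ℝ × ℝ) → Set Ω := fun z => E ∩ {ω | T + u ≤ ∑ i ∈ Finset.Icc 1 z.2.1,
    (bracketIncr G ψ x η z.1 z.2.2.1 z.2.2.2 i (past ε (i : ℤ) ω)
      - predict (P.map (ε 0)) (bracketIncr G ψ x η z.1 z.2.2.1 z.2.2.2 i)
        (past ε ((i : ℤ) - 1) ω))}
  have hsub : E ∩ bracketEvent P ε G ψ x F b η N T u ⊆ ⋃ z ∈ K, B z := by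
    rintro ω ⟨h1, θ, hθ, hθb, n, hn, k, σ, hσ, hle⟩
    refine mem_biUnion (x := (θ, n, k, σ)) ?_ ⟨h1, hle⟩
    simp only [K, SetLike.mem_coe, Finset.mem_product, Finset.mem_filter, Finset.mem_range,
      Finset.mem_univ, true_and]
    exact ⟨⟨hθ, hθb⟩, by omega, hσ⟩
  have hB : ∀ z ∈ K, P (B z) ≤ ENNReal.ofReal (Real.exp (1 / 4 - T / (2 * u))) := by
    intro z hz
    simp only [K, Finset.mem_product, Finset.mem_filter, Finset.mem_range,
      Finset.mem_univ, true_and] at hz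
    exact hm.measure_enveloped_martingale_le
      (fun i => measurable_scoreEnvelope hm.measurable_filter hψ _ _)
      (fun i => measurable_bracketIncr hm.measurable_filter hψ _ _ _ _ i)
      (fun i s => abs_bracketIncr_le hmono hη hz.1.2 _ hz.2.2 i s) (by omega) hu T
  have hcard : K.card ≤ F.card * (N + 1) * p * 8 := by
    simp only [K, Finset.card_product, Finset.card_range, Finset.card_univ, Fintype.card_fin]
    calc _ ≤ F.card * ((N + 1) * (p * 8)) :=
          Nat.mul_le_mul (Finset.card_filter_le _ _) (Nat.mul_le_mul le_rfl
            (Nat.mul_le_mul le_rfl card_signTriples_le))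
      _ = _ := by ring
  calc _ ≤ P (⋃ z ∈ K, B z) := measure_mono hsub
    _ ≤ ∑ z ∈ K, P (B z) := measure_biUnion_finset_le _ _
    _ ≤ ∑ _z ∈ K, ENNReal.ofReal (Real.exp (1 / 4 - T / (2 * u))) := Finset.sum_le_sum hB
    _ ≤ _ := by
        rw [Finset.sum_const, nsmul_eq_mul, ← ENNReal.ofReal_natCast,
          ← ENNReal.ofReal_mul (Nat.cast_nonneg _)]
        refine ENNReal.ofReal_le_ofReal (mul_le_mul_of_nonneg_right ?_ (Real.exp_nonneg _))
        exact_mod_cast hcard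

/-- With T = (4p + 4) u log N the exponential tail is of order N^{-(2p+2)}. It beats the N^{2p} net
points and the N sample sizes and leaves N^{-1}, summable over N = 2^d. -/
theorem ae_eventually_notMem_bracketEvent (hm : IsInnovationModel P ε ε₀' G) (hψ : Measurable ψ)
    (hmono : Monotone ψ) {F : ℕ → Finset (EuclideanSpace ℝ (Fin p))}
    (hF : ∀ d, (F d).card ≤ (2 * (2 ^ d) ^ 2 + 1) ^ p) {b η u : ℕ → ℝ} (hη : ∀ d, 0 ≤ η d)
    (hu : ∀ᶠ d in atTop, 0 < u d) :
    ∀ᵐ ω ∂P, ∀ᶠ d : ℕ in atTop,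
      ω ∉ envelopeEvent P ε (fun i => scoreEnvelope G ψ ‖x i‖ (2 * b d)) (2 ^ d) (u d)
        ∩ bracketEvent P ε G ψ x (F d) (b d) (η d) (2 ^ d)
          ((4 * p + 4) * (u d * Real.log ((2 ^ d : ℕ) : ℝ))) (u d) := by
  refine ae_eventually_notMem_of_le
    (s := fun d => 3 ^ p * 2 * p * 8 * Real.exp (1 / 4) * (((2 ^ d : ℕ) : ℝ))⁻¹)
    (fun d => by positivity) (summable_two_pow_inv.mul_left _) ?_
  filter_upwards [hu] with d hud
  refine (measure_bracketEvent_le hm hψ hmono (F d) (hη d) (2 ^ d) _ hud).trans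
    (ENNReal.ofReal_le_ofReal ?_)
  set N : ℕ := 2 ^ d with hN
  have hN1 : (1 : ℝ) ≤ N := by exact_mod_cast Nat.one_le_two_pow
  have hN0 : (0 : ℝ) < N := by linarith
  have e1 : 1 / 4 - (4 * (p : ℝ) + 4) * (u d * Real.log N) / (2 * u d)
      = 1 / 4 + -(((2 * p + 2 : ℕ) : ℝ) * Real.log N) := by
    push_cast; field_simp; ring
  have e2 : Real.exp (1 / 4 + -(((2 * p + 2 : ℕ) : ℝ) * Real.log N))
      = Real.exp (1 / 4) * ((N : ℝ) ^ (2 * p + 2))⁻¹ := by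
    rw [Real.exp_add, Real.exp_neg, Real.exp_nat_mul, Real.exp_log hN0]
  have h1 : ((F d).card : ℝ) ≤ (3 * (N : ℝ) ^ 2) ^ p := by
    have : ((F d).card : ℝ) ≤ (2 * (N : ℝ) ^ 2 + 1) ^ p := by exact_mod_cast hF d
    refine this.trans (pow_le_pow_left₀ (by positivity) ?_ p)
    nlinarith
  have h2 : (N : ℝ) + 1 ≤ 2 * N := by linarith
  rw [e1, e2]
  calc ((F d).card : ℝ) * (N + 1) * p * 8 * (Real.exp (1 / 4) * ((N : ℝ) ^ (2 * p + 2))⁻¹)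
      ≤ (3 * (N : ℝ) ^ 2) ^ p * (2 * N) * p * 8
        * (Real.exp (1 / 4) * ((N : ℝ) ^ (2 * p + 2))⁻¹) := by gcongr
    _ = 3 ^ p * 2 * p * 8 * Real.exp (1 / 4)
        * ((N : ℝ) ^ (2 * p + 1) * ((N : ℝ) ^ (2 * p + 2))⁻¹) := by
        rw [mul_pow, ← pow_mul]; ring
    _ = _ := by
        congr 1
        rw [pow_succ (N : ℝ) (2 * p + 1), mul_inv, ← mul_assoc, mul_inv_cancel₀ (by positivity),
          one_mul]

/-- The expectation is ξ_N(2) times K N^{-2} times a constant, hence O(1/N). Markov's inequality is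
summable along N = 2^d. -/
theorem ae_eventually_sum_lipSup_le (hm : IsInnovationModel P ε ε₀' G) (hψ : Measurable ψ)
    (hxi : (fun n : ℕ => xi x n 2) =O[atTop] fun n : ℕ => (n : ℝ)) {δ : ℝ}
    (hδ : ∫⁻ s, lipSup P ε G ψ δ s ∂(P.map (past ε 0)) < ∞) {K : ℝ} (hK : 0 ≤ K) :
    ∀ᵐ ω ∂P, ∀ᶠ d : ℕ in atTop, ∑ i ∈ Finset.Icc 1 (2 ^ d),
      ENNReal.ofReal (‖x i‖ ^ 2 * (K / ((2 ^ d : ℕ) : ℝ) ^ 2))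
        * lipSup P ε G ψ δ (past ε ((i : ℤ) - 1) ω) ≤ 1 := by
  set Λ := ∫⁻ s, lipSup P ε G ψ δ s ∂(P.map (past ε 0)) with hΛ
  obtain ⟨C, hC0, hC⟩ := hxi.exists_pos
  have hm' : ∀ i : ℤ, Measurable fun ω => lipSup P ε G ψ δ (past ε i ω) := fun i =>
    (measurable_lipSup hm hψ δ).comp (hm.measurable_past i)
  have key := ae_eventually_notMem_of_le (P := P)
    (E := fun d => {ω | 1 ≤ ∑ i ∈ Finset.Icc 1 (2 ^ d),
      ENNReal.ofReal (‖x i‖ ^ 2 * (K / ((2 ^ d : ℕ) : ℝ) ^ 2))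
        * lipSup P ε G ψ δ (past ε ((i : ℤ) - 1) ω)})
    (s := fun d => C * K * Λ.toReal * (((2 ^ d : ℕ) : ℝ))⁻¹)
    (fun d => by positivity) (summable_two_pow_inv.mul_left _) ?_
  · filter_upwards [key] with ω hω
    filter_upwards [hω] with d hd
    exact (not_le.1 hd).le
  · filter_upwards [tendsto_two_pow.eventually hC.bound] with d hd
    set N : ℕ := 2 ^ d with hN
    have hN0 : (0 : ℝ) < N := by
      have : 0 < N := by positivity
      exact_mod_cast this
    rw [Real.norm_of_nonneg (xi_nonneg _ _ _), Real.norm_of_nonneg hN0.le] at hd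
    have hmk := mul_meas_ge_le_lintegral (μ := P) (f := fun ω => ∑ i ∈ Finset.Icc 1 N,
      ENNReal.ofReal (‖x i‖ ^ 2 * (K / (N : ℝ) ^ 2))
        * lipSup P ε G ψ δ (past ε ((i : ℤ) - 1) ω))
      (Finset.measurable_sum _ fun i _ => (hm' _).const_mul _) 1
    rw [one_mul] at hmk
    refine hmk.trans ?_
    rw [lintegral_finsetSum _ fun i _ => (hm' _).const_mul _]
    have e : ∀ i : ℕ, ∫⁻ ω, ENNReal.ofReal (‖x i‖ ^ 2 * (K / (N : ℝ) ^ 2))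
        * lipSup P ε G ψ δ (past ε ((i : ℤ) - 1) ω) ∂P
        = ENNReal.ofReal (‖x i‖ ^ 2 * (K / (N : ℝ) ^ 2)) * ENNReal.ofReal Λ.toReal := by
      intro i
      rw [lintegral_const_mul _ (hm' _), hm.lintegral_past _ (measurable_lipSup hm hψ δ),
        ENNReal.ofReal_toReal hδ.ne]
    simp_rw [e]
    rw [← Finset.sum_mul, ← ENNReal.ofReal_sum_of_nonneg fun i _ => by positivity,
      ← ENNReal.ofReal_mul (Finset.sum_nonneg fun i _ => by positivity), ← Finset.sum_mul, ← xi_two]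
    refine ENNReal.ofReal_le_ofReal ?_
    calc xi x N 2 * (K / (N : ℝ) ^ 2) * Λ.toReal ≤ C * N * (K / (N : ℝ) ^ 2) * Λ.toReal := by
          gcongr
      _ = _ := by field_simp

end Oscillation

end MEstimation

namespace MEstimation

/-! ### Oscillation of the martingale part -/

section MartingaleBound

variable {Ω : Type*} [MeasurableSpace Ω] {P : Measure Ω} {ε : ℤ → Ω → ℝ} {ε₀' : Ω → ℝ}
  {G : (ℕ → ℝ) → ℝ} {ρ ψ : ℝ → ℝ} {p : ℕ} {x : ℕ → EuclideanSpace ℝ (Fin p)} {ι q : ℝ}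

theorem tendsto_bSeq (ι : ℝ) : Tendsto (bSeq ι) atTop (𝓝 0) := by
  have h1 : bSeq ι =o[atTop] logRate (-(1 / 2)) 2 0 :=
    logRate_isLittleO (by norm_num)
  refine h1.trans_tendsto ?_
  have h2 : (fun n : ℕ => Real.log (n : ℝ) ^ (2 : ℝ)) =o[atTop] fun n : ℕ => (n : ℝ) ^ (1 / 2 : ℝ) :=
    (isLittleO_log_rpow_rpow_atTop 2 (by norm_num)).comp_tendsto tendsto_natCast_atTop_atTop
  refine (h2.tendsto_div_nhds_zero).congr' ?_
  filter_upwards [eventually_logs_pos] with n ⟨h3, h4, h5⟩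
  rw [logRate, Real.rpow_zero, mul_one, Real.rpow_neg h3.le, div_eq_inv_mul]

/-- The mesh of the net, of order N^{-2}, is negligible against the radius b_N. -/
theorem eventually_div_sq_le_bSeq {ι : ℝ} (hι : 0 < ι) (c : ℝ) :
    ∀ᶠ n : ℕ in atTop, c / (n : ℝ) ^ 2 ≤ bSeq ι n := by
  filter_upwards [tendsto_log_natCast.eventually_ge_atTop 1,
    tendsto_log_log_natCast.eventually_ge_atTop 1,
    tendsto_natCast_atTop_atTop.eventually_ge_atTop (max c 1)] with n h1 h2 h3
  have hn1 : (1 : ℝ) ≤ n := (le_max_right _ _).trans h3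
  have hn0 : (0 : ℝ) < n := by linarith
  calc c / (n : ℝ) ^ 2 ≤ n / (n : ℝ) ^ 2 := by
        gcongr; exact (le_max_left _ _).trans h3
    _ = (n : ℝ) ^ (-1 : ℝ) := by rw [Real.rpow_neg_one]; field_simp
    _ ≤ (n : ℝ) ^ (-(1 / 2) : ℝ) := Real.rpow_le_rpow_of_exponent_le hn1 (by norm_num)
    _ = (n : ℝ) ^ (-(1 / 2) : ℝ) * 1 * 1 := by ring
    _ ≤ bSeq ι n := by
        unfold bSeq
        have h4 := Real.one_le_rpow h1 (by norm_num : (0 : ℝ) ≤ 3 / 2)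
        have h5 := Real.one_le_rpow h2 (by linarith : (0 : ℝ) ≤ 1 / 2 + ι)
        gcongr

theorem predict_bracketIncr {η : ℝ} {θ : EuclideanSpace ℝ (Fin p)} {k : Fin p} {σ : ℝ × ℝ × ℝ}
    {i : ℕ} {s : ℕ → ℝ}
    (h : Integrable (fun a => ψ (G (consSeq a s)
      + (-inner ℝ (x i) θ + σ.2.2 * (‖x i‖ * η)))) (P.map (ε 0)))
    (h0 : Integrable (fun a => ψ (G (consSeq a s) + 0)) (P.map (ε 0))) :
    predict (P.map (ε 0)) (bracketIncr G ψ x η θ k σ i) s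
      = σ.2.1 * max (σ.1 * x i k) 0 *
        (oneStep P ε G ψ (-inner ℝ (x i) θ + σ.2.2 * (‖x i‖ * η)) s - oneStep P ε G ψ 0 s) := by
  unfold predict bracketIncr oneStep predict
  rw [integral_const_mul, ← integral_sub h h0]
  simp

/-- The increments of the martingale part of the M-process. -/
noncomputable def martIncr (P : Measure Ω) (ε : ℤ → Ω → ℝ) (G : (ℕ → ℝ) → ℝ) (ψ : ℝ → ℝ) (i : ℕ)
    (t : ℝ) (ω : Ω) : ℝ :=
  ψ (err G ε (i : ℤ) ω + t) - oneStep P ε G ψ t (past ε ((i : ℤ) - 1) ω)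
    - (ψ (err G ε (i : ℤ) ω) - oneStep P ε G ψ 0 (past ε ((i : ℤ) - 1) ω))

/-- A bound for the martingale part outside the exceptional events. -/
theorem norm_sum_martIncr_le (hmono : Monotone ψ) {F : Finset (EuclideanSpace ℝ (Fin p))}
    {b b' η δ r T u : ℝ} {N : ℕ} {ω : Ω} (hη : 0 ≤ η)
    (hF : ∀ β : EuclideanSpace ℝ (Fin p), ‖β‖ ≤ b' → ∃ θ ∈ F, ‖β - θ‖ ≤ η)
    (hb : b' + 2 * η ≤ 2 * b) (hrδ : rTilde x N * (2 * b) < δ) (hrr : rTilde x N * (2 * b) ≤ r)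
    (hr : 0 < r)
    (hint : ∀ i : ℤ, ∀ t : ℝ, |t| ≤ r →
      Integrable (fun a => ψ (G (consSeq a (past ε (i - 1) ω)) + t)) (P.map (ε 0)))
    (hcont : ∀ i : ℤ, Continuous fun t => oneStep P ε G ψ t (past ε i ω))
    (hfin : ∀ i : ℤ, lipSup P ε G ψ δ (past ε i ω) ≠ ∞)
    (hlip : ∑ i ∈ Finset.Icc 1 N, ENNReal.ofReal (‖x i‖ ^ 2 * (2 * η))
      * lipSup P ε G ψ δ (past ε ((i : ℤ) - 1) ω) ≤ 1)
    (hbr : ω ∉ bracketEvent P ε G ψ x F b η N T u) {n : ℕ} (hn : n ≤ N)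
    {β : EuclideanSpace ℝ (Fin p)} (hβ : ‖β‖ ≤ b') :
    ‖∑ i ∈ Finset.Icc 1 n, martIncr P ε G ψ i (-inner ℝ (x i) β) ω • x i‖
      ≤ p * (2 * (T + u + 1)) := by
  obtain ⟨θ, hθF, hβθ⟩ := hF β hβ
  have hθ : ‖θ‖ + η ≤ 2 * b := by
    have h1 : ‖θ‖ ≤ ‖β‖ + ‖β - θ‖ := by
      have := norm_sub_le β (β - θ)
      rwa [sub_sub_cancel] at this
    linarith
  have hsub : Finset.Icc 1 n ⊆ Finset.Icc 1 N := Finset.Icc_subset_Icc le_rfl hn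
  let L : ℕ → ℝ := fun i => (lipSup P ε G ψ δ (past ε ((i : ℤ) - 1) ω)).toReal
  -- End points at distance ‖x_i‖ η from -x_i'θ, so that they enclose -x_i'β. They depend on β only
  -- through the net point θ.
  let e : ℝ → ℕ → ℝ := fun σ i => -inner ℝ (x i) θ + σ * (‖x i‖ * η)
  let t : ℕ → ℝ := fun i => -inner ℝ (x i) β
  have hinner : ∀ i, |inner ℝ (x i) β - inner ℝ (x i) θ| ≤ ‖x i‖ * η := by
    intro i
    rw [← inner_sub_right]
    exact (abs_real_inner_le_norm _ _).trans (mul_le_mul_of_nonneg_left hβθ (norm_nonneg _))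
  have hxη : ∀ i, 0 ≤ ‖x i‖ * η := fun i => mul_nonneg (norm_nonneg _) hη
  have hradius : ∀ i ∈ Finset.Icc 1 N, ‖x i‖ * (2 * b) ≤ rTilde x N * (2 * b) := fun i hi =>
    mul_le_mul_of_nonneg_right (norm_le_rTilde x hi) (by linarith [norm_nonneg θ])
  have he : ∀ σ : ℝ, σ = 1 ∨ σ = -1 → ∀ i ∈ Finset.Icc 1 N, |e σ i| ≤ rTilde x N * (2 * b) := by
    intro σ hσ i hi
    refine le_trans ?_ (hradius i hi)
    have h1 : |σ| = 1 := by rcases hσ with rfl | rfl <;> simp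
    calc |e σ i| ≤ |(-inner ℝ (x i) θ)| + |σ * (‖x i‖ * η)| := abs_add_le _ _
      _ ≤ ‖x i‖ * ‖θ‖ + ‖x i‖ * η := by
          rw [abs_neg, abs_mul, h1, one_mul, abs_of_nonneg (hxη i)]
          exact add_le_add (abs_real_inner_le_norm _ _) le_rfl
      _ ≤ ‖x i‖ * (2 * b) := by
          rw [← mul_add]
          exact mul_le_mul_of_nonneg_left hθ (norm_nonneg _)
  have ht : ∀ i ∈ Finset.Icc 1 N, |t i| < δ := by
    intro i hi
    refine lt_of_le_of_lt (le_trans ?_ (hradius i hi)) hrδ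
    rw [abs_neg]
    exact (abs_real_inner_le_norm _ _).trans
      (mul_le_mul_of_nonneg_left (by linarith) (norm_nonneg _))
  have hte : ∀ σ : ℝ, σ = 1 ∨ σ = -1 → ∀ i ∈ Finset.Icc 1 N,
      |oneStep P ε G ψ (t i) (past ε ((i : ℤ) - 1) ω)
        - oneStep P ε G ψ (e σ i) (past ε ((i : ℤ) - 1) ω)| ≤ L i * (2 * (‖x i‖ * η)) := by
    intro σ hσ i hi
    refine (abs_oneStep_sub_le (hcont _) (hfin _) (ht i hi) ((he σ hσ i hi).trans_lt hrδ)).trans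
      (mul_le_mul_of_nonneg_left ?_ ENNReal.toReal_nonneg)
    obtain ⟨h1, h2⟩ := abs_le.1 (hinner i)
    have := hxη i
    simp only [t, e]
    rw [abs_le]
    rcases hσ with rfl | rfl <;> constructor <;> linarith
  have hE : ∀ w : ℕ → ℝ, (∀ i, 0 ≤ w i ∧ w i ≤ ‖x i‖) →
      ∑ i ∈ Finset.Icc 1 n, w i * (L i * (2 * (‖x i‖ * η))) ≤ 1 := by
    intro w hw
    have h1 : ∑ i ∈ Finset.Icc 1 N, ‖x i‖ ^ 2 * (2 * η) * L i ≤ 1 := by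
      have h2 := ENNReal.toReal_mono ENNReal.one_ne_top hlip
      rw [ENNReal.toReal_sum fun i _ => ENNReal.mul_ne_top ENNReal.ofReal_ne_top (hfin _)] at h2
      simp only [ENNReal.toReal_mul, ENNReal.toReal_one] at h2
      refine le_trans (le_of_eq (Finset.sum_congr rfl fun i _ => ?_)) h2
      rw [ENNReal.toReal_ofReal (by positivity)]
    refine le_trans (Finset.sum_le_sum fun i hi => ?_) ((Finset.sum_le_sum_of_subset_of_nonneg hsub
      fun i _ _ => by positivity).trans h1)
    have h3 : 0 ≤ L i * (2 * (‖x i‖ * η)) :=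
      mul_nonneg ENNReal.toReal_nonneg (mul_nonneg two_pos.le (hxη i))
    calc _ ≤ ‖x i‖ * (L i * (2 * (‖x i‖ * η))) := mul_le_mul_of_nonneg_right (hw i).2 h3
      _ = _ := by ring
  have hsum : ∀ (k : Fin p) (σ : ℝ × ℝ × ℝ), σ ∈ signTriples →
      σ.2.1 * ∑ i ∈ Finset.Icc 1 n, max (σ.1 * x i k) 0 * martIncr P ε G ψ i (e σ.2.2 i) ω
        ≤ T + u := by
    intro k σ hσ
    refine le_of_lt (lt_of_eq_of_lt ?_ (not_le.1 fun h =>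
      hbr ⟨θ, hθF, hθ, n, hn, k, σ, hσ, h⟩))
    rw [Finset.mul_sum]
    refine Finset.sum_congr rfl fun i hi => ?_
    rw [predict_bracketIncr
      (hint _ _ ((he _ (mem_signTriples.1 hσ).2.2 i (hsub hi)).trans hrr))
      (hint _ 0 (by simpa using hr.le))]
    simp only [bracketIncr, martIncr, err, e]
    ring
  -- The lower end point with sign -1 bounds the sum from below and the upper end point with sign +1
  -- from above. The extra 1 is the Lipschitz error of the predictor.
  have hpart : ∀ (k : Fin p) (σ : ℝ), σ = 1 ∨ σ = -1 →
      |∑ i ∈ Finset.Icc 1 n, max (σ * x i k) 0 * martIncr P ε G ψ i (t i) ω| ≤ T + u + 1 := by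
    intro k σ hσ
    have h1 : |σ| = 1 := by rcases hσ with rfl | rfl <;> simp
    have hlo := hsum k (σ, -1, -1) (mem_signTriples.2 ⟨hσ, by simp, by simp⟩)
    have hhi := hsum k (σ, 1, 1) (mem_signTriples.2 ⟨hσ, by simp, by simp⟩)
    simp only [one_mul, neg_mul] at hlo hhi
    refine abs_sum_le_of_brackets (Finset.Icc 1 n) (w := fun i => max (σ * x i k) 0)
      (ℓ := fun i => L i * (2 * (‖x i‖ * η))) (a := e (-1)) (t := t) (c := e 1)
      (f := fun i t => ψ (err G ε (i : ℤ) ω + t))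
      (h := fun i t => oneStep P ε G ψ t (past ε ((i : ℤ) - 1) ω))
      (fun i _ => fun a b hab => hmono (by linarith)) (fun i _ => le_max_right _ _) ?_ ?_
      (fun i hi => hte _ (Or.inr rfl) i (hsub hi)) (fun i hi => hte _ (Or.inl rfl) i (hsub hi))
      (hE _ fun i => ⟨le_max_right _ _, abs_max_mul_apply_le h1 _ _⟩) ?_ ?_
    · intro i _
      have := (abs_le.1 (hinner i)).2
      simp only [e, t]; linarith
    · intro i _
      have := (abs_le.1 (hinner i)).1
      simp only [e, t]; linarith
    · exact neg_le.1 hlo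
    · exact hhi
  refine norm_le_of_forall_abs_apply_le fun k => ?_
  -- Brackets need nonnegative weights, so the coordinates are split into positive and negative
  -- parts; this doubles the bound.
  have hsplit : (∑ i ∈ Finset.Icc 1 n, martIncr P ε G ψ i (t i) ω • x i) k
      = ∑ i ∈ Finset.Icc 1 n, max (1 * x i k) 0 * martIncr P ε G ψ i (t i) ω
        - ∑ i ∈ Finset.Icc 1 n, max (-1 * x i k) 0 * martIncr P ε G ψ i (t i) ω := by
    rw [← Finset.sum_sub_distrib, WithLp.ofLp_sum, Finset.sum_apply]
    refine Finset.sum_congr rfl fun i _ => ?_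
    rw [← sub_mul, one_mul, neg_one_mul]
    have h : max (x i k) 0 - max (-x i k) 0 = x i k := by
      rcases le_total 0 (x i k) with h | h
      · rw [max_eq_left h, max_eq_right (by linarith), sub_zero]
      · rw [max_eq_right h, max_eq_left (by linarith)]; ring
    rw [h]
    simp [mul_comm]
  rw [hsplit]
  refine (abs_sub _ _).trans ?_
  linarith [hpart k 1 (Or.inl rfl), hpart k (-1) (Or.inr rfl)]

variable [IsProbabilityMeasure P]

/-- The almost sure oscillation bound for the martingale part of the M-process. -/
theorem ae_eventually_martingale_le (hm : IsInnovationModel P ε ε₀' G) (hψ : Measurable ψ)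
    (hmono : Monotone ψ) (hA1 : CondA1 P ε G ρ ψ) (hA3 : CondA3 P ε G ψ) (hA5 : CondA5 P ε G ψ)
    (hA6 : CondA6 P ε ε₀' G ψ 0)
    (hxi : (fun n : ℕ => xi x n 2) =O[atTop] fun n : ℕ => (n : ℝ))
    (hr : (fun n : ℕ => rTilde x n) =O[atTop]
      fun n : ℕ => (n : ℝ) ^ (1 / 2 : ℝ) * Real.log n ^ (-2 : ℝ)) (hι : 0 < ι) (hq : 3 / 2 < q) :
    ∀ᵐ ω ∂P, ∀ᶠ d : ℕ in atTop, ∀ n ≤ 2 ^ d, ∀ β : EuclideanSpace ℝ (Fin p),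
      ‖β‖ ≤ √2 * bSeq ι (2 ^ d) →
      ‖∑ i ∈ Finset.Icc 1 n, martIncr P ε G ψ i (-inner ℝ (x i) β) ω • x i‖
        ≤ p * (2 * (4 * p + 6)) * (LSeq P ε G ψ x ι q (2 ^ d) + 1) := by
  obtain ⟨δ, hδ, hΛ⟩ := exists_lintegral_lipSup_lt_top hm hψ hA5
  obtain ⟨r, hr0, hint⟩ := exists_ae_integrable_innov hm hψ hmono hA1 hA3
  -- A net of the whole unit ball with mesh p / N², N = 2^d: its size is polynomial in N, and the
  -- mesh is fine enough to make the Lipschitz error bounded.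
  choose F hFc hF using fun d : ℕ => exists_finite_net p (M := (2 ^ d) ^ 2) (by positivity)
  have hlog := tendsto_two_pow.eventually eventually_logs_pos
  have hfin : ∀ᵐ ω ∂P, ∀ i : ℤ, lipSup P ε G ψ δ (past ε i ω) ≠ ∞ := by
    rw [ae_all_iff]
    intro i
    have hlm := measurable_lipSup hm hψ δ
    have h1 := hm.lintegral_past i hlm
    filter_upwards [ae_lt_top (hlm.comp (hm.measurable_past i)) (by rw [← h1] at hΛ; exact hΛ.ne)]
      with ω hω using hω.ne
  have hbr := ae_eventually_notMem_bracketEvent (x := x) hm hψ hmono hFc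
    (b := fun d => bSeq ι (2 ^ d)) (η := fun d => p / (((2 ^ d : ℕ) : ℝ)) ^ 2)
    (u := fun d => truncLevel P ε G ψ x ι q (2 ^ d)) (fun d => by positivity)
    (hlog.mono fun d h => truncLevel_pos h.2.1)
  have hrb := (tendsto_rTilde_mul_bSeq (x := x) (ι := ι) hr).comp tendsto_two_pow
  filter_upwards [ae_eventually_mem_envelopeEvent (x := x) (ι := ι) hm hψ hA3 hr hq, hbr,
    ae_eventually_sum_lipSup_le (x := x) hm hψ hxi hΛ (K := 2 * p) (by positivity), hint,
    ae_continuous_oneStep hm hψ hA6, hfin] with ω h1 h2 h3 h4 h5 h6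
  filter_upwards [h1, h2, h3, hlog,
    tendsto_two_pow.eventually (eventually_div_sq_le_bSeq hι (4 * p)),
    ((tendsto_bSeq ι).comp tendsto_two_pow).eventually_lt_const (show (0 : ℝ) < 1 / 2 by norm_num),
    tendsto_two_pow.eventually (eventually_logRate_pos (-(1 / 2)) (3 / 2) (1 / 2 + ι)),
    hrb.eventually_lt_const (show 0 < δ / 2 by positivity),
    hrb.eventually_lt_const (show 0 < r / 2 by positivity),
    tendsto_two_pow.eventually (tendsto_log_natCast.eventually_ge_atTop 1)]
    with d e1 e2 e3 e4 e5 e6 e7 e8 e9 e10 n hn β hβ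
  simp only [Function.comp_apply] at e6 e8 e9 e10
  -- With √2 ≤ 3/2, radius √2 b plus two mesh widths stays below 2b, the radius used in τ̃.
  have h2s : √2 ≤ 3 / 2 := Real.sqrt_le_iff.2 ⟨by norm_num, by norm_num⟩
  have hbpos : 0 < bSeq ι (2 ^ d) := e7
  have hsq : √2 * bSeq ι (2 ^ d) ≤ 3 / 2 * bSeq ι (2 ^ d) :=
    mul_le_mul_of_nonneg_right h2s hbpos.le
  set N : ℕ := 2 ^ d with hN
  have key := norm_sum_martIncr_le hmono (F := F d) (b := bSeq ι N) (b' := √2 * bSeq ι N)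
    (η := p / (N : ℝ) ^ 2) (δ := δ) (r := r)
    (T := (4 * p + 4) * (truncLevel P ε G ψ x ι q N * Real.log N))
    (u := truncLevel P ε G ψ x ι q N) (N := N) (ω := ω) (by positivity) ?_ ?_ ?_ ?_ hr0 h4 h5 h6 ?_
    (fun h => e2 ⟨e1, h⟩) hn hβ
  -- Here T = (4p + 4)(L + 1), while u and 1 are each at most L + 1, for a total of 4p + 6.
  · refine key.trans ?_
    have hu := truncLevel_pos (P := P) (ε := ε) (G := G) (ψ := ψ) (x := x) (ι := ι) (q := q) e4.2.1
    have h7 := truncLevel_mul_log (P := P) (ε := ε) (G := G) (ψ := ψ) (x := x) (ι := ι) (q := q)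
      e4.2.1
    have h8 : truncLevel P ε G ψ x ι q N ≤ LSeq P ε G ψ x ι q N + 1 := by
      rw [← h7]
      exact le_mul_of_one_le_right hu.le e10
    have h9 : 0 ≤ LSeq P ε G ψ x ι q N :=
      mul_nonneg (Real.sqrt_nonneg _) (Real.rpow_nonneg e4.2.1.le _)
    rw [h7, mul_assoc]
    refine mul_le_mul_of_nonneg_left ?_ p.cast_nonneg
    nlinarith
  · intro β hβ
    obtain ⟨θ, hθ, hle⟩ := hF d β (hβ.trans (by linarith))
    refine ⟨θ, hθ, hle.trans_eq ?_⟩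
    rw [hN]; push_cast; rfl
  · have : 2 * ((p : ℝ) / (N : ℝ) ^ 2) = (4 * p / (N : ℝ) ^ 2) / 2 := by ring
    linarith
  · linarith
  · linarith
  · refine le_trans (le_of_eq (Finset.sum_congr rfl fun i _ => ?_)) e3
    congr 3; ring

end MartingaleBound

end MEstimation

namespace MEstimation

/-! ### The M-process and the M-estimator -/

section Centering

variable {Ω : Type*} [MeasurableSpace Ω] {P : Measure Ω}
  {ε : ℤ → Ω → ℝ} {ε₀' : Ω → ℝ}
  {G : (ℕ → ℝ) → ℝ} {ρ ψ : ℝ → ℝ} {p : ℕ} {x : ℕ → EuclideanSpace ℝ (Fin p)} {ι q : ℝ}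

theorem phi_zero (hA1 : CondA1 P ε G ρ ψ) : phi P ε G ψ 0 = 0 := by
  simpa [phi] using hA1.mean_zero

theorem isLittleO_comp_nBar {f : ℕ → ℝ} {a b s : ℝ} (ha : 0 ≤ a) (hb : 0 ≤ b) (hs : 0 ≤ s)
    (h : f =o[atTop] logRate a b s) : (fun n => f (nBar n)) =o[atTop] logRate a b s :=
  (h.comp_tendsto tendsto_nBar).trans_isBigO (logRate_nBar_isBigO ha hb hs)

/-- As m² is linear near zero, each summand is O(‖x_i‖³ b_n), and one factor ‖x_i‖ is bounded by
r̃_n. -/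
theorem tauTilde_isBigO
    (hr : (fun n : ℕ => rTilde x n) =O[atTop]
      fun n : ℕ => (n : ℝ) ^ (1 / 2 : ℝ) * Real.log n ^ (-2 : ℝ))
    (hm0 : (fun t : ℝ => (mMod P ε G ψ t).toReal) =O[𝓝 0] (fun t : ℝ => √|t|)) :
    (fun n => tauTilde P ε G ψ x n (2 * bSeq ι n))
      =O[atTop] fun n => rTilde x n * bSeq ι n * xi x n 2 := by
  obtain ⟨C, hC0, hC⟩ := hm0.exists_pos
  obtain ⟨δ, hδ, hδC⟩ := Metric.eventually_nhds_iff.1 hC.bound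
  have hsq : ∀ t, |t| < δ → (mMod P ε G ψ t).toReal ^ 2 ≤ C ^ 2 * |t| := by
    intro t ht
    have h1 := hδC (y := t) (by rwa [Real.dist_0_eq_abs])
    rw [Real.norm_of_nonneg ENNReal.toReal_nonneg, Real.norm_of_nonneg (Real.sqrt_nonneg _)] at h1
    refine (pow_le_pow_left₀ ENNReal.toReal_nonneg h1 2).trans_eq ?_
    rw [mul_pow, Real.sq_sqrt (abs_nonneg _)]
  refine IsBigO.of_bound (4 * C ^ 2) ?_
  filter_upwards [(tendsto_rTilde_mul_bSeq (x := x) (ι := ι) hr).eventually_lt_const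
    (show 0 < δ / 2 by positivity),
    eventually_logRate_pos (-(1 / 2)) (3 / 2) (1 / 2 + ι)] with n h1 hb
  have hb0 : 0 < bSeq ι n := hb
  have hrt := rTilde_nonneg x n
  have hx2 := xi_nonneg x n 2
  rw [Real.norm_of_nonneg (tauTilde_nonneg _ _), Real.norm_of_nonneg (by positivity), xi_two,
    Finset.mul_sum, Finset.mul_sum, tauTilde]
  refine Finset.sum_le_sum fun i hi => ?_
  have h2 := mul_le_mul_of_nonneg_right (norm_le_rTilde x hi) hb0.le
  have h3 : |‖x i‖ * (2 * bSeq ι n)| = 2 * (‖x i‖ * bSeq ι n) := by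
    rw [abs_of_nonneg (by positivity)]; ring
  have h4 := hsq (‖x i‖ * (2 * bSeq ι n)) (by rw [h3]; linarith)
  have h5 := hsq (-(‖x i‖ * (2 * bSeq ι n))) (by rw [abs_neg, h3]; linarith)
  rw [abs_neg] at h5
  rw [h3] at h4 h5
  calc _ ≤ ‖x i‖ ^ 2 * (4 * C ^ 2 * (rTilde x n * bSeq ι n)) := by
        refine mul_le_mul_of_nonneg_left ?_ (sq_nonneg _)
        nlinarith [mul_le_mul_of_nonneg_left h2 (sq_nonneg C)]
    _ = _ := by ring

/-- Here τ̃ is O(n (log n)^{-1/2}) up to iterated logarithms, so L_n is of order at most n^{1/2}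
(log n)^{q-1/4}. This lies below n b_n as soon as q < 7/4. -/
theorem LSeq_isLittleO
    (hxi : (fun n : ℕ => xi x n 2) =O[atTop] fun n : ℕ => (n : ℝ))
    (hr : (fun n : ℕ => rTilde x n) =O[atTop]
      fun n : ℕ => (n : ℝ) ^ (1 / 2 : ℝ) * Real.log n ^ (-2 : ℝ))
    (hm0 : (fun t : ℝ => (mMod P ε G ψ t).toReal) =O[𝓝 0] (fun t : ℝ => √|t|))
    (hq : q < 7 / 4) :
    LSeq P ε G ψ x ι q =o[atTop] logRate (1 / 2) (3 / 2) (1 / 2 + ι) := by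
  have h1 : (fun n => tauTilde P ε G ψ x n (2 * bSeq ι n))
      =O[atTop] logRate 1 (-(1 / 2)) (1 / 2 + ι) := by
    refine ((tauTilde_isBigO hr hm0).trans
      ((rTilde_mul_bSeq_isBigO hr).mul (natCast_eq_logRate ▸ hxi))).trans_eventuallyEq ?_
    filter_upwards [logRate_mul 0 (-(1 / 2)) (1 / 2 + ι) 1 0 0] with n e1
    rw [e1]; norm_num
  have h2 := (isBigO_sqrt h1 ((eventually_logRate_pos _ _ _).mono fun _ h => h.le)).mul
    (isBigO_refl (logRate 0 q 0) atTop)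
  have h3 : (fun n => √(logRate 1 (-(1 / 2)) (1 / 2 + ι) n) * logRate 0 q 0 n)
      =ᶠ[atTop] logRate (1 / 2) (-(1 / 2) / 2 + q) ((1 / 2 + ι) / 2) := by
    filter_upwards [logRate_sqrt 1 (-(1 / 2)) (1 / 2 + ι),
      logRate_mul (1 / 2) (-(1 / 2) / 2) ((1 / 2 + ι) / 2) 0 q 0] with n e1 e2
    rw [e1, e2]
    simp
  refine IsBigO.trans_isLittleO ?_ (logRate_isLittleO (b := -(1 / 2) / 2 + q)
    (s := (1 / 2 + ι) / 2) (by linarith))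
  refine (h2.trans_eventuallyEq h3).congr_left fun n => ?_
  simp [LSeq, logRate]

variable [IsProbabilityMeasure P]

theorem integrable_omegaTilde (hm : IsInnovationModel P ε ε₀' G) (hψ : Measurable ψ) {r : ℝ}
    (hr : ∀ t, |t| ≤ r → MemLp (fun ω => ψ (err G ε 1 ω + t)) 2 P) {n : ℕ}
    {β : EuclideanSpace ℝ (Fin p)} (hβ : rTilde x n * ‖β‖ ≤ r) :
    Integrable (omegaTilde ε G ψ x n β) P ∧
      ∫ ω, omegaTilde ε G ψ x n β ω ∂P
        = ∑ i ∈ Finset.Icc 1 n, phi P ε G ψ (-inner ℝ (x i) β) • x i := by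
  have h : ∀ i ∈ Finset.Icc 1 n,
      Integrable (fun ω => ψ (err G ε (i : ℤ) ω - inner ℝ (x i) β) • x i) P := by
    intro i hi
    have ht : |(-inner ℝ (x i) β)| ≤ r := by
      rw [abs_neg]
      exact ((abs_real_inner_le_norm _ _).trans
        (mul_le_mul_of_nonneg_right (norm_le_rTilde x hi) (norm_nonneg _))).trans hβ
    exact ((hm.memLp_score hψ (hr _ ht) (i : ℤ)).integrable one_le_two).smul_const (x i)
  refine ⟨integrable_finsetSum _ h, ?_⟩
  unfold omegaTilde
  rw [integral_finsetSum _ h]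
  refine Finset.sum_congr rfl fun i _ => ?_
  rw [integral_smul_const, ← integral_score hm hψ _ (i : ℤ)]
  rfl

/-- Adding and subtracting the one-step prediction gives the martingale part and the predictable
part, whose oscillations are bounded by different means. -/
theorem KTilde_sub_KTilde (hm : IsInnovationModel P ε ε₀' G) (hψ : Measurable ψ) {r : ℝ}
    (hr0 : 0 ≤ r) (hr : ∀ t, |t| ≤ r → MemLp (fun ω => ψ (err G ε 1 ω + t)) 2 P) {n : ℕ}
    {β : EuclideanSpace ℝ (Fin p)} (hβ : rTilde x n * ‖β‖ ≤ r) (ω : Ω) :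
    KTilde P ε G ψ x n β ω - KTilde P ε G ψ x n 0 ω
      = ∑ i ∈ Finset.Icc 1 n, martIncr P ε G ψ i (-inner ℝ (x i) β) ω • x i
        + ∑ i ∈ Finset.Icc 1 n,
          ((oneStep P ε G ψ (-inner ℝ (x i) β) (past ε ((i : ℤ) - 1) ω)
              - phi P ε G ψ (-inner ℝ (x i) β))
            - (oneStep P ε G ψ 0 (past ε ((i : ℤ) - 1) ω) - phi P ε G ψ 0)) • x i := by
  unfold KTilde
  rw [(integrable_omegaTilde hm hψ hr hβ).2,
    (integrable_omegaTilde (x := x) (n := n) (β := 0) hm hψ hr (by simpa using hr0)).2]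
  unfold omegaTilde
  rw [← Finset.sum_sub_distrib, ← Finset.sum_sub_distrib, ← Finset.sum_sub_distrib,
    ← Finset.sum_add_distrib]
  refine Finset.sum_congr rfl fun i _ => ?_
  simp only [inner_zero_right, neg_zero, martIncr, ← sub_smul, ← add_smul,
    sub_eq_add_neg (err G ε (i : ℤ) ω)]
  congr 1
  ring_nf

theorem eventually_rTilde_mul_bSeq_lt
    (hr : (fun n : ℕ => rTilde x n) =O[atTop]
      fun n : ℕ => (n : ℝ) ^ (1 / 2 : ℝ) * Real.log n ^ (-2 : ℝ)) {c : ℝ} (hc : 0 < c) :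
    ∀ᶠ n : ℕ in atTop, ∀ β : EuclideanSpace ℝ (Fin p), ‖β‖ ≤ bSeq ι n →
      rTilde x n * ‖β‖ ≤ c := by
  filter_upwards [(tendsto_rTilde_mul_bSeq (x := x) (ι := ι) hr).eventually_lt_const hc] with
    n hn β hβ
  exact (mul_le_mul_of_nonneg_left hβ (rTilde_nonneg _ _)).trans hn.le

theorem eventually_one_le_BSeq
    (hlam : 0 < liminf (fun n : ℕ => minEigenvalue x n / (n : ℝ)) atTop) :
    ∀ᶠ n : ℕ in atTop, 1 ≤ BSeq x ι n := by
  filter_upwards [(one_isLittleO_BSeq (x := x) (ι := ι) hlam).bound one_pos,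
    eventually_logs_pos] with n hn ⟨h1, h2, h3⟩
  have h0 : 0 ≤ BSeq x ι n := by unfold BSeq bSeq; positivity
  rwa [norm_one, one_mul, Real.norm_of_nonneg h0] at hn

/-- The almost sure oscillation bound for the centered M-process. -/
theorem ae_eventually_KTilde_sub_le (hm : IsInnovationModel P ε ε₀' G) (hψ : Measurable ψ)
    (hmono : Monotone ψ) (hA1 : CondA1 P ε G ρ ψ) (hA3 : CondA3 P ε G ψ) (hA5 : CondA5 P ε G ψ)
    (hA6 : ∀ l ≤ p, CondA6 P ε ε₀' G ψ l)
    (hlam : 0 < liminf (fun n : ℕ => minEigenvalue x n / (n : ℝ)) atTop)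
    (hxi : (fun n : ℕ => xi x n 2) =O[atTop] fun n : ℕ => (n : ℝ))
    (hr : (fun n : ℕ => rTilde x n) =O[atTop]
      fun n : ℕ => (n : ℝ) ^ (1 / 2 : ℝ) * Real.log n ^ (-2 : ℝ)) (hι : 0 < ι) (hq : 3 / 2 < q) :
    ∀ᵐ ω ∂P, ∃ C : ℝ, ∀ᶠ n : ℕ in atTop, ∀ β : EuclideanSpace ℝ (Fin p), ‖β‖ ≤ bSeq ι n →
      ‖KTilde P ε G ψ x n β ω - KTilde P ε G ψ x n 0 ω‖
        ≤ C * (LSeq P ε G ψ x ι q (nBar n) + BSeq x ι (nBar n)) := by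
  obtain ⟨r, hr0, hmem⟩ := exists_memLp_radius hm hψ hA1 hA3
  filter_upwards [ae_eventually_predictable_le (x := x) hm hψ hA1 hA3 hA6 hlam hr hι,
    ae_eventually_martingale_le (x := x) hm hψ hmono hA1 hA3 hA5 (hA6 0 (Nat.zero_le _)) hxi hr hι
      hq] with ω hN hM
  refine ⟨p * (2 * (4 * p + 6)) + (p * (2 * (4 * p + 6)) + p), ?_⟩
  filter_upwards [tendsto_ceil_log.eventually hN, tendsto_ceil_log.eventually hM,
    eventually_bSeq_le hι, eventually_rTilde_mul_bSeq_lt (x := x) (ι := ι) hr hr0,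
    tendsto_nBar.eventually (eventually_one_le_BSeq (x := x) (ι := ι) hlam),
    tendsto_nBar.eventually eventually_logs_pos] with n h1 h2 h3 h4 h5 h6 β hβ
  have hβ' := hβ.trans h3
  have hL : 0 ≤ LSeq P ε G ψ x ι q (nBar n) :=
    mul_nonneg (Real.sqrt_nonneg _) (Real.rpow_nonneg h6.2.1.le _)
  rw [KTilde_sub_KTilde hm hψ hr0.le hmem (h4 β hβ)]
  refine (norm_add_le _ _).trans
    ((add_le_add (h2 n (le_nBar n) β hβ') (h1 n (le_nBar n) β hβ')).trans ?_)
  -- The dyadic index is d = ⌈log n / log 2⌉, for which 2^d is n̄ by definition. The additive 1 is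
  -- absorbed by B ≥ 1.
  change (p * (2 * (4 * p + 6)) : ℝ) * (LSeq P ε G ψ x ι q (nBar n) + 1) + p * BSeq x ι (nBar n) ≤ _
  have hp : (0 : ℝ) ≤ p := p.cast_nonneg
  set K : ℝ := p * (2 * (4 * p + 6)) with hK
  have hK0 : 0 ≤ K := by positivity
  nlinarith [mul_nonneg hK0 hL, mul_nonneg hp hL, mul_nonneg hK0 (sub_nonneg.2 h5)]

theorem KTilde_zero (hm : IsInnovationModel P ε ε₀' G) (hψ : Measurable ψ)
    (hA1 : CondA1 P ε G ρ ψ) (hA3 : CondA3 P ε G ψ) (n : ℕ) (ω : Ω) :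
    KTilde P ε G ψ x n 0 ω = ∑ i ∈ Finset.Icc 1 n, ψ (err G ε (i : ℤ) ω) • x i := by
  obtain ⟨r, hr0, hmem⟩ := exists_memLp_radius hm hψ hA1 hA3
  unfold KTilde
  rw [(integrable_omegaTilde (x := x) (n := n) (β := 0) hm hψ hmem (by simpa using hr0.le)).2]
  simp [omegaTilde, phi_zero hA1]

/-- The maximal inequality gives the exponent (1 + ι)/2 on the iterated logarithm. It is smaller
than the 1/2 + ι in b_n, and this gap is all the room there is. -/
theorem ae_isLittleO_score_sum (hm : IsInnovationModel P ε ε₀' G) (hψ : Measurable ψ)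
    (hA1 : CondA1 P ε G ρ ψ) (hA6 : CondA6 P ε ε₀' G ψ 0)
    (hxi : (fun n : ℕ => xi x n 2) =O[atTop] fun n : ℕ => (n : ℝ)) (hι : 0 < ι) :
    ∀ᵐ ω ∂P, (fun n : ℕ => ∑ i ∈ Finset.Icc 1 n, ψ (err G ε (i : ℤ) ω) • x i)
      =o[atTop] logRate (1 / 2) (3 / 2) (1 / 2 + ι) := by
  filter_upwards [ae_eventually_score_sum_le (x := x) hm hψ hA1 hA6 hxi hι] with ω hω
  have h1 : (fun n : ℕ => ∑ i ∈ Finset.Icc 1 n, ψ (err G ε (i : ℤ) ω) • x i)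
      =O[atTop] fun n => logRate (1 / 2) (3 / 2) ((1 + ι) / 2) (nBar n) := by
    refine IsBigO.of_bound p ?_
    filter_upwards [tendsto_ceil_log.eventually hω,
      tendsto_nBar.eventually (eventually_logRate_pos (1 / 2) (3 / 2) ((1 + ι) / 2))] with n h1 h2
    rw [Real.norm_of_nonneg h2.le]
    exact h1 n (le_nBar n)
  exact (h1.trans (logRate_nBar_isBigO (by norm_num) (by norm_num) (by positivity))).trans_isLittleO
    (logRate_isLittleO_last (by linarith))

end Centering

end MEstimation

namespace MEstimation

/-! ### Localization of the estimator and the Bahadur representation -/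

section Estimator

variable {Ω : Type*} {ε : ℤ → Ω → ℝ} {G : (ℕ → ℝ) → ℝ} {ψ : ℝ → ℝ} {p : ℕ}
  {x : ℕ → EuclideanSpace ℝ (Fin p)}

theorem inner_omegaTilde (n : ℕ) (β v : EuclideanSpace ℝ (Fin p)) (ω : Ω) :
    inner ℝ (omegaTilde ε G ψ x n β ω) v
      = ∑ i ∈ Finset.Icc 1 n, ψ (err G ε (i : ℤ) ω - inner ℝ (x i) β) * inner ℝ (x i) v := by
  rw [omegaTilde, sum_inner]
  exact Finset.sum_congr rfl fun i _ => real_inner_smul_left _ _ _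

/-- The M-process is monotone along rays. -/
theorem inner_omegaTilde_antitone (hmono : Monotone ψ) (n : ℕ) (v : EuclideanSpace ℝ (Fin p))
    (ω : Ω) {a b : ℝ} (hab : a ≤ b) :
    inner ℝ (omegaTilde ε G ψ x n (b • v) ω) v ≤ inner ℝ (omegaTilde ε G ψ x n (a • v) ω) v := by
  rw [inner_omegaTilde, inner_omegaTilde]
  refine Finset.sum_le_sum fun i _ => ?_
  rw [inner_smul_right, inner_smul_right]
  rcases le_total 0 (inner ℝ (x i) v) with h | h
  · exact mul_le_mul_of_nonneg_right (hmono (by nlinarith)) h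
  · exact mul_le_mul_of_nonpos_right (hmono (by nlinarith)) h

/-- Near zero the first-order error is at most half the slope, which leaves the other half as a
quadratic lower bound. -/
theorem exists_half_slope_le {φ : ℝ → ℝ} (h0 : φ 0 = 0) (hd : DifferentiableAt ℝ φ 0)
    (hpos : 0 < deriv φ 0) :
    ∃ δ : ℝ, 0 < δ ∧ ∀ t, |t| < δ → deriv φ 0 / 2 * t ^ 2 ≤ φ t * t := by
  have h1 := hd.hasDerivAt.isLittleO
  have h2 := h1.bound (half_pos hpos)
  obtain ⟨δ, hδ, h⟩ := Metric.eventually_nhds_iff.1 h2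
  refine ⟨δ, hδ, fun t ht => ?_⟩
  have h3 := h (y := t) (by rwa [Real.dist_0_eq_abs])
  simp only [h0, sub_zero, smul_eq_mul, Real.norm_eq_abs] at h3
  have h4 : |(φ t - t * deriv φ 0) * t| ≤ deriv φ 0 / 2 * t ^ 2 := by
    rw [abs_mul, ← sq_abs t]
    nlinarith [mul_le_mul_of_nonneg_right h3 (abs_nonneg t)]
  nlinarith [(abs_le.1 h4).1]

variable [MeasurableSpace Ω] {P : Measure Ω} {ρ : ℝ → ℝ} {ι q : ℝ}

/-- The drift of the M-process on the sphere of radius `b` points inwards. -/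
theorem inner_sum_phi_le {δ b : ℝ} (hb : 0 < b)
    (hδ : ∀ t, |t| < δ → deriv (phi P ε G ψ) 0 / 2 * t ^ 2 ≤ phi P ε G ψ t * t)
    (hpos : 0 < deriv (phi P ε G ψ) 0) {n : ℕ} (hr : rTilde x n * b < δ)
    {v : EuclideanSpace ℝ (Fin p)} (hv : ‖v‖ = 1) :
    inner ℝ (∑ i ∈ Finset.Icc 1 n, phi P ε G ψ (-inner ℝ (x i) (b • v)) • x i) v
      ≤ -(deriv (phi P ε G ψ) 0 / 2 * b * minEigenvalue x n) := by
  set c := deriv (phi P ε G ψ) 0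
  have h1 := minEigenvalue_mul_le x n v
  rw [hv, one_pow, mul_one] at h1
  rw [sum_inner]
  calc _ ≤ ∑ i ∈ Finset.Icc 1 n, -(c / 2 * b * inner ℝ (x i) v ^ 2) := by
        refine Finset.sum_le_sum fun i hi => ?_
        rw [real_inner_smul_left, inner_smul_right]
        have h2 : |(-(b * inner ℝ (x i) v))| < δ := by
          refine lt_of_le_of_lt ?_ hr
          rw [abs_neg, abs_mul, abs_of_pos hb, mul_comm]
          refine mul_le_mul_of_nonneg_right ?_ hb.le
          refine (abs_real_inner_le_norm _ _).trans ?_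
          rw [hv, mul_one]
          exact norm_le_rTilde x hi
        have h3 := hδ _ h2
        set s := inner ℝ (x i) v
        refine le_of_mul_le_mul_left ?_ hb
        change b * (phi P ε G ψ (-(b * s)) * s) ≤ _
        nlinarith
    _ ≤ _ := by
        rw [Finset.sum_neg_distrib, ← Finset.mul_sum]
        exact neg_le_neg (mul_le_mul_of_nonneg_left h1 (by positivity))

variable [IsProbabilityMeasure P] {ε₀' : Ω → ℝ}

/-- Outside an exceptional set, an approximate zero of the M-process lies in the ball of radius
`b_n`. -/
theorem ae_eventually_norm_le_bSeq (hm : IsInnovationModel P ε ε₀' G) (hψ : Measurable ψ)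
    (hmono : Monotone ψ) (hA1 : CondA1 P ε G ρ ψ) (hA2 : CondA2 P ε G ψ) (hA3 : CondA3 P ε G ψ)
    (hA5 : CondA5 P ε G ψ) (hA6 : ∀ l ≤ p, CondA6 P ε ε₀' G ψ l)
    (hlam : 0 < liminf (fun n : ℕ => minEigenvalue x n / (n : ℝ)) atTop)
    (hxi : (fun n : ℕ => xi x n 2) =O[atTop] fun n : ℕ => (n : ℝ))
    (hr : (fun n : ℕ => rTilde x n) =O[atTop]
      fun n : ℕ => (n : ℝ) ^ (1 / 2 : ℝ) * Real.log n ^ (-2 : ℝ)) (hι : 0 < ι)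
    (hm0 : (fun t : ℝ => (mMod P ε G ψ t).toReal) =O[𝓝 0] (fun t : ℝ => √|t|))
    {βhat : ℕ → Ω → EuclideanSpace ℝ (Fin p)}
    (hβ : IsBigOAS P (fun n ω => omegaTilde ε G ψ x n (βhat n ω) ω) (rTilde x)) :
    ∀ᵐ ω ∂P, ∀ᶠ n : ℕ in atTop, ‖βhat n ω‖ ≤ bSeq ι n := by
  obtain ⟨δ, hδ, hφ⟩ := exists_half_slope_le (phi_zero hA1) hA2.1 hA2.2
  obtain ⟨r, hr0, hmem⟩ := exists_memLp_radius hm hψ hA1 hA3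
  obtain ⟨κ, hκ, hmin⟩ := exists_pos_mul_le_minEigenvalue hlam
  set c := deriv (phi P ε G ψ) 0 with hc
  have hcpos : 0 < c := hA2.2
  have hrate : (0 : ℝ) ≤ 1 / 2 + ι := by linarith
  -- Localization is free to choose its own exponent: 8/5 lies between 3/2, needed for the
  -- oscillation bound, and 7/4, needed for L = o(n b_n).
  have hL : (fun n => LSeq P ε G ψ x ι (8 / 5) (nBar n) + BSeq x ι (nBar n))
      =o[atTop] logRate (1 / 2) (3 / 2) (1 / 2 + ι) :=
    (isLittleO_comp_nBar (by norm_num) (by norm_num) hrate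
      (LSeq_isLittleO hxi hr hm0 (by norm_num))).add
    (isLittleO_comp_nBar (by norm_num) (by norm_num) hrate (BSeq_isLittleO hxi hr))
  filter_upwards [hβ, ae_isLittleO_score_sum (x := x) hm hψ hA1 (hA6 0 (Nat.zero_le _)) hxi hι,
    ae_eventually_KTilde_sub_le (x := x) (q := 8 / 5) hm hψ hmono hA1 hA3 hA5 hA6 hlam hxi hr hι
      (by norm_num)] with ω h1 h2 ⟨C, h3⟩
  have h4 := h1.trans_isLittleO (rTilde_isLittleO (x := x) (ι := ι) hr)
  -- In units of (cκ/8) n b_n, the drift on the sphere is at least 4, whereas the residual, the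
  -- score sum and the oscillation are each at most 1.
  have hε : 0 < c * κ / 8 := by positivity
  filter_upwards [h4.bound hε, h2.bound hε, (hL.const_mul_left C).bound hε, h3, hmin,
    (tendsto_rTilde_mul_bSeq (x := x) (ι := ι) hr).eventually_lt_const hδ,
    eventually_rTilde_mul_bSeq_lt (x := x) (ι := ι) hr hr0,
    eventually_logRate_pos (-(1 / 2)) (3 / 2) (1 / 2 + ι),
    eventually_logRate_pos (1 / 2) (3 / 2) (1 / 2 + ι), mul_bSeq_eventuallyEq (ι := ι)]
    with n e1 e2 e3 e4 e5 e6 e7 e8 e9 e10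
  rw [Real.norm_of_nonneg e9.le, ← e10] at e1 e2 e3
  have hb : 0 < bSeq ι n := e8
  rw [← e10] at e9
  by_contra hlt
  rw [not_le] at hlt
  set R := ‖βhat n ω‖ with hR
  have hR0 : 0 < R := hb.trans hlt
  set v := R⁻¹ • βhat n ω with hv
  have hv1 : ‖v‖ = 1 := by
    rw [hv, norm_smul, norm_inv, Real.norm_of_nonneg hR0.le, ← hR, inv_mul_cancel₀ hR0.ne']
  have hβv : βhat n ω = R • v := by rw [hv, smul_inv_smul₀ hR0.ne']
  have hbv : ‖bSeq ι n • v‖ ≤ bSeq ι n := by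
    rw [norm_smul, hv1, mul_one, Real.norm_of_nonneg hb.le]
  -- If the estimator were outside the ball, monotonicity along its ray would carry the value there
  -- down from the sphere, where the drift makes it too negative for the size of the residual.
  have f1 : inner ℝ (omegaTilde ε G ψ x n (βhat n ω) ω) v
      ≤ inner ℝ (omegaTilde ε G ψ x n (bSeq ι n • v) ω) v := by
    rw [hβv]
    exact inner_omegaTilde_antitone hmono n v ω hlt.le
  have f2 := inner_sum_phi_le hb hφ hcpos e6 hv1
  have f3 : omegaTilde ε G ψ x n (bSeq ι n • v) ω
      = (KTilde P ε G ψ x n (bSeq ι n • v) ω - KTilde P ε G ψ x n 0 ω)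
        + ∑ i ∈ Finset.Icc 1 n, ψ (err G ε (i : ℤ) ω) • x i
        + ∑ i ∈ Finset.Icc 1 n, phi P ε G ψ (-inner ℝ (x i) (bSeq ι n • v)) • x i := by
    rw [KTilde_zero hm hψ hA1 hA3, ← (integrable_omegaTilde hm hψ hmem (e7 _ hbv)).2, KTilde]
    abel
  have f4 : ∀ w : EuclideanSpace ℝ (Fin p), |inner ℝ w v| ≤ ‖w‖ := fun w => by
    simpa [hv1] using abs_real_inner_le_norm w v
  rw [f3, inner_add_left, inner_add_left] at f1
  have g1 := (abs_le.1 (f4 (omegaTilde ε G ψ x n (βhat n ω) ω))).1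
  have g2 := (abs_le.1 (f4 (KTilde P ε G ψ x n (bSeq ι n • v) ω - KTilde P ε G ψ x n 0 ω))).2
  have g3 := (abs_le.1 (f4 (∑ i ∈ Finset.Icc 1 n, ψ (err G ε (i : ℤ) ω) • x i))).2
  have g4 := (e4 _ hbv).trans ((le_abs_self _).trans e3)
  have g5 : c / 2 * bSeq ι n * (κ * n) ≤ c / 2 * bSeq ι n * minEigenvalue x n :=
    mul_le_mul_of_nonneg_left e5 (by positivity)
  have g6 : 0 < c * κ / 8 * (n * bSeq ι n) := mul_pos hε e9
  have g7 : c / 2 * bSeq ι n * (κ * n) = 4 * (c * κ / 8 * (n * bSeq ι n)) := by ring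
  linarith

/-- The strong Bahadur representation for approximate zeros of the M-process. -/
theorem ae_isBigO_bahadur (hm : IsInnovationModel P ε ε₀' G) (hψ : Measurable ψ)
    (hmono : Monotone ψ) (hA1 : CondA1 P ε G ρ ψ) (hA3 : CondA3 P ε G ψ)
    (hA5 : CondA5 P ε G ψ) (hA6 : ∀ l ≤ p, CondA6 P ε ε₀' G ψ l)
    (hlam : 0 < liminf (fun n : ℕ => minEigenvalue x n / (n : ℝ)) atTop)
    (hxi : (fun n : ℕ => xi x n 2) =O[atTop] fun n : ℕ => (n : ℝ))
    (hr : (fun n : ℕ => rTilde x n) =O[atTop]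
      fun n : ℕ => (n : ℝ) ^ (1 / 2 : ℝ) * Real.log n ^ (-2 : ℝ)) (hι : 0 < ι) (hq : 3 / 2 < q)
    (hφ : (fun t : ℝ => phi P ε G ψ t - t * deriv (phi P ε G ψ) 0) =O[𝓝 0] (fun t : ℝ => t ^ 2))
    {βhat : ℕ → Ω → EuclideanSpace ℝ (Fin p)}
    (hβ : IsBigOAS P (fun n ω => omegaTilde ε G ψ x n (βhat n ω) ω) (rTilde x))
    (hb : ∀ᵐ ω ∂P, ∀ᶠ n : ℕ in atTop, ‖βhat n ω‖ ≤ bSeq ι n) :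
    IsBigOAS P
      (fun n ω => deriv (phi P ε G ψ) 0 • Matrix.toEuclideanLin (gramMatrix x n) (βhat n ω)
        - ∑ i ∈ Finset.Icc 1 n, ψ (err G ε (i : ℤ) ω) • x i)
      (fun n => LSeq P ε G ψ x ι q (nBar n) + BSeq x ι (nBar n)
        + xi x n 3 * bSeq ι n ^ 2 + rTilde x n) := by
  obtain ⟨r, hr0, hmem⟩ := exists_memLp_radius hm hψ hA1 hA3
  set c := deriv (phi P ε G ψ) 0 with hc
  obtain ⟨K, hK0, hK⟩ := hφ.exists_pos
  obtain ⟨δ, hδ, hφδ⟩ := Metric.eventually_nhds_iff.1 hK.bound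
  filter_upwards [hβ, hb,
    ae_eventually_KTilde_sub_le (x := x) hm hψ hmono hA1 hA3 hA5 hA6 hlam hxi hr hι hq]
    with ω h1 h2 ⟨C, h3⟩
  obtain ⟨C', hC'0, hC'⟩ := h1.exists_pos
  refine IsBigO.of_bound (|C| + C' + K) ?_
  filter_upwards [hC'.bound, h2, h3,
    eventually_rTilde_mul_bSeq_lt (x := x) (ι := ι) hr hr0,
    eventually_rTilde_mul_bSeq_lt (x := x) (ι := ι) hr (half_pos hδ),
    tendsto_nBar.eventually (eventually_one_le_BSeq (x := x) (ι := ι) hlam),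
    tendsto_nBar.eventually eventually_logs_pos] with n e1 e2 e3 e4 e5 e6 e7
  have hL : 0 ≤ LSeq P ε G ψ x ι q (nBar n) :=
    mul_nonneg (Real.sqrt_nonneg _) (Real.rpow_nonneg e7.2.1.le _)
  have hx3 := xi_nonneg x n 3
  have hrt := rTilde_nonneg x n
  set β := βhat n ω
  -- The three terms are the oscillation of the centered process, the residual at the estimator, and
  -- the error of the linear expansion of φ. They account for L + B, r̃_n and ξ_n(3) b_n²
  -- respectively.
  have key : c • Matrix.toEuclideanLin (gramMatrix x n) β
        - ∑ i ∈ Finset.Icc 1 n, ψ (err G ε (i : ℤ) ω) • x i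
      = (KTilde P ε G ψ x n β ω - KTilde P ε G ψ x n 0 ω) - omegaTilde ε G ψ x n β ω
        + ∑ i ∈ Finset.Icc 1 n,
          (phi P ε G ψ (-inner ℝ (x i) β) - -inner ℝ (x i) β * c) • x i := by
    rw [KTilde_zero hm hψ hA1 hA3, KTilde, (integrable_omegaTilde hm hψ hmem (e4 _ e2)).2,
      toEuclideanLin_gramMatrix, Finset.smul_sum]
    simp_rw [sub_smul]
    rw [Finset.sum_sub_distrib]
    have : ∑ i ∈ Finset.Icc 1 n, (-inner ℝ (x i) β * c) • x i
        = -∑ i ∈ Finset.Icc 1 n, c • inner ℝ (x i) β • x i := by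
      rw [← Finset.sum_neg_distrib]
      refine Finset.sum_congr rfl fun i _ => ?_
      rw [smul_smul, ← neg_smul]
      congr 1; ring
    rw [this]
    abel
  have hrem : ‖∑ i ∈ Finset.Icc 1 n,
      (phi P ε G ψ (-inner ℝ (x i) β) - -inner ℝ (x i) β * c) • x i‖
      ≤ K * (xi x n 3 * bSeq ι n ^ 2) := by
    rw [xi_three, Finset.sum_mul, Finset.mul_sum]
    refine (norm_sum_le _ _).trans (Finset.sum_le_sum fun i hi => ?_)
    have g1 : |(-inner ℝ (x i) β)| ≤ ‖x i‖ * ‖β‖ := by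
      rw [abs_neg]; exact abs_real_inner_le_norm _ _
    have g2 := g1.trans ((mul_le_mul_of_nonneg_right (norm_le_rTilde x hi)
      (norm_nonneg β)).trans (e5 _ e2))
    have g3 := hφδ (y := -inner ℝ (x i) β) (by rw [Real.dist_0_eq_abs]; linarith)
    rw [norm_pow, Real.norm_eq_abs (-inner ℝ (x i) β)] at g3
    rw [norm_smul]
    calc _ ≤ K * (‖x i‖ * bSeq ι n) ^ 2 * ‖x i‖ := by
          refine mul_le_mul_of_nonneg_right (g3.trans ?_) (norm_nonneg _)
          refine mul_le_mul_of_nonneg_left (pow_le_pow_left₀ (abs_nonneg _) ?_ 2) hK0.le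
          exact g1.trans (mul_le_mul_of_nonneg_left e2 (norm_nonneg _))
      _ = _ := by ring
  have g4 := e3 _ e2
  rw [Real.norm_of_nonneg hrt] at e1
  have hb2 : 0 ≤ xi x n 3 * bSeq ι n ^ 2 := mul_nonneg hx3 (sq_nonneg _)
  have hLB : 0 ≤ LSeq P ε G ψ x ι q (nBar n) + BSeq x ι (nBar n) := by linarith
  rw [key, Real.norm_of_nonneg (by linarith)]
  refine (norm_add_le _ _).trans ((add_le_add (norm_sub_le _ _) hrem).trans ?_)
  have g5 := mul_le_mul_of_nonneg_right (le_abs_self C) hLB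
  set A := LSeq P ε G ψ x ι q (nBar n) + BSeq x ι (nBar n)
  set D := xi x n 3 * bSeq ι n ^ 2
  have hCn := abs_nonneg C
  nlinarith [mul_nonneg hCn hb2, mul_nonneg hCn hrt, mul_nonneg hC'0.le hLB,
    mul_nonneg hC'0.le hb2, mul_nonneg hK0.le hLB, mul_nonneg hK0.le hrt]

end Estimator

end MEstimation
open MEstimation in
theorem theorem3 {Ω : Type*} [MeasurableSpace Ω] (P : Measure Ω) [IsProbabilityMeasure P]
    (ε : ℤ → Ω → ℝ) (ε₀' : Ω → ℝ) (G : (ℕ → ℝ) → ℝ) (hmodel : IsInnovationModel P ε ε₀' G)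
    (ρ ψ : ℝ → ℝ) (hψ : IsScoreOf ψ ρ)
    (p : ℕ) (x : ℕ → EuclideanSpace ℝ (Fin p))
    (hA1 : CondA1 P ε G ρ ψ) (hA2 : CondA2 P ε G ψ) (hA3 : CondA3 P ε G ψ)
    (hA5 : CondA5 P ε G ψ) (hA6 : ∀ l ≤ p, CondA6 P ε ε₀' G ψ l)
    (hlam : 0 < liminf (fun n : ℕ => minEigenvalue x n / (n : ℝ)) atTop)
    (hxi : (fun n : ℕ => xi x n 2) =O[atTop] fun n : ℕ => (n : ℝ))
    (hr : (fun n : ℕ => rTilde x n) =O[atTop]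
      fun n : ℕ => (n : ℝ) ^ (1 / 2 : ℝ) * Real.log n ^ (-2 : ℝ))
    (ι : ℝ) (hι : 0 < ι) (q : ℝ) (hq : 3 / 2 < q) :
    -- for large `n`, the M-process is well defined on the ball of radius `b_n`
    (∀ᶠ n : ℕ in atTop, ∀ β : EuclideanSpace ℝ (Fin p), ‖β‖ ≤ bSeq ι n →
      Integrable (omegaTilde ε G ψ x n β) P) ∧
    -- the oscillation bound for the supremum over `|β| ≤ b_n`
    (∀ᵐ ω ∂P, ∃ C : ℝ, ∀ᶠ n : ℕ in atTop, ∀ β : EuclideanSpace ℝ (Fin p), ‖β‖ ≤ bSeq ι n →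
      ‖KTilde P ε G ψ x n β ω - KTilde P ε G ψ x n 0 ω‖
        ≤ C * (LSeq P ε G ψ x ι q (nBar n) + BSeq x ι (nBar n))) ∧
    -- the rate and the strong Bahadur representation of the M-estimator
    ((fun t : ℝ => phi P ε G ψ t - t * deriv (phi P ε G ψ) 0) =O[𝓝 0] (fun t : ℝ => t ^ 2) →
      (fun t : ℝ => (mMod P ε G ψ t).toReal) =O[𝓝 0] (fun t : ℝ => √|t|) →
      ∀ βhat : ℕ → Ω → EuclideanSpace ℝ (Fin p),
        (∀ n : ℕ, ∀ᵐ ω ∂P, ∀ β, objective ε G ρ x n ω (βhat n ω) ≤ objective ε G ρ x n ω β) →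
        IsBigOAS P (fun n ω => omegaTilde ε G ψ x n (βhat n ω) ω) (rTilde x) →
        IsBigOAS P βhat (bSeq ι) ∧
        IsBigOAS P
          (fun n ω => deriv (phi P ε G ψ) 0 • Matrix.toEuclideanLin (gramMatrix x n) (βhat n ω)
            - ∑ i ∈ Finset.Icc 1 n, ψ (err G ε (i : ℤ) ω) • x i)
          (fun n => LSeq P ε G ψ x ι q (nBar n) + BSeq x ι (nBar n)
            + xi x n 3 * bSeq ι n ^ 2 + rTilde x n)) := by
  have hmono : Monotone ψ := hψ.monotone
  have hmeas : Measurable ψ := hmono.measurable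
  refine ⟨?_, ae_eventually_KTilde_sub_le hmodel hmeas hmono hA1 hA3 hA5 hA6 hlam hxi hr hι hq, ?_⟩
  · obtain ⟨r, hr0, hmem⟩ := exists_memLp_radius hmodel hmeas hA1 hA3
    filter_upwards [eventually_rTilde_mul_bSeq_lt (x := x) (ι := ι) hr hr0] with n hn β hβ
    exact (integrable_omegaTilde hmodel hmeas hmem (hn β hβ)).1
  · intro hφ hm0 βhat _ hβ
    have hb := ae_eventually_norm_le_bSeq hmodel hmeas hmono hA1 hA2 hA3 hA5 hA6 hlam hxi hr hι
      hm0 hβ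
    refine ⟨?_, ae_isBigO_bahadur hmodel hmeas hmono hA1 hA3 hA5 hA6 hlam hxi hr hι hq hφ hβ hb⟩
    filter_upwards [hb] with ω hω
    refine IsBigO.of_bound 1 ?_
    filter_upwards [hω] with n hn
    rw [one_mul]
    exact hn.trans (le_abs_self _)
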